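/- Let $n\ge 1$, let $x_1,\dots,x_n\in\mathbb{CP}^1$ be distinct points, and let $S\subset\{1,\dots,n\}$ satisfy $1\in S$ and $2\le |S|\le n-2$; write $S^c$ for its complement. **Null hyperpolygons.** For row vectors $p_i=(a_i\ b_i)$ and column vectors $q_i=(c_i\ d_i)^t$, $i=1,\dots,n$, let $\mathcal P_0^n\subset T^*\mathbb C^{2n}$ be the set of $(p,q)$ with $p_iq_i=0$, $|p_i|=|q_i|$, $\sum_i (q_ip_i)_0=0$, $\sum_i(q_iq_i^*-p_i^*p_i)_0=0$ (where $(\cdot)_0$ is the traceless part) and $(p_i,q_i)\neq(0,0)$ for all $i$; this is the zero level of the hyperkähler moment map. Let $X_0^n=\mathcal P_0^n/K$, where $K=(SU(2)\times U(1)^n)/\{\pm1\}$ acts by $p_i\mapsto e_i^{-1}p_iA$, $q_i\mapsto A^{-1}q_ie_i$. Let $Z_S\subset X_0^n$ be the set of classes $[p,q]$ such that the vectors $q_i$, $i\in S$, are all proportional and the vectors $q_i$, $i\in S^c$, are all proportional. **Quasi-parabolic Higgs bundles.** Let $\mathcal H_0^n$ be the moduli space of isomorphism classes of stable rank-$2$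 quasi-parabolic $SL(2,\mathbb C)$-Higgs bundles $(E,\Phi)$ over $\mathbb{CP}^1$ at $D=\{x_1,\dots,x_n\}$ with $E$ holomorphically trivial. Here $E$ carries lines $E_{x_i,2}\subset E_{x_i}$, and $\Phi$ is a traceless holomorphic section of $\mathrm{End}(E)\otimes K_{\mathbb{CP}^1}(D)$ with $\mathrm{Res}_{x_i}\Phi\,(E_{x_i})\subset E_{x_i,2}$ and $\mathrm{Res}_{x_i}\Phi\,(E_{x_i,2})=0$. Stability means that all residues are nonzero and that $\frac n2>\deg L+\frac12\#\{i: L_{x_i}=E_{x_i,2}\}$ for every holomorphic line subbundle $L\subset E$ preserved by $\Phi$. Let $\mathcal Z_S\subset\mathcal H_0^n$ be the set of classes with a decomposition $E=L_0\oplus L_1$ into trivial line bundles such that $E_{x_i,2}=(L_0)_{x_i}$ for $i\in S$, $E_{x_i,2}=(L_1)_{x_i}$ for $i\in S^c$, and $\Phi=\begin{pmatrix}0&\alpha\\ \beta&0\end{pmatrix}$ with the residue of $\beta$ at $x_i$ zero for $i\in S$ and that of $\alpha$ at $x_i$ zero for $i\in S^c$. **Null polygons.** Let $v\circ w=-v_1w_1-v_2w_2+v_3w_3$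 on $\mathbb R^{2,1}=\mathbb R^3\cong\mathfrak{su}(1,1)^*$. Let $M_0^{k_1,k_2}$ be the quotient by $SU(1,1)$ of the space of $(k_1+k_2)$-tuples $u$ of vectors with $u_i\circ u_i=0$, the first $k_1$ in the past light cone ($(u_i)_3<0$), the last $k_2$ in the future light cone ($(u_i)_3>0$), $\sum_iu_i=0$, and such that $u$ is a regular point of the map $u\mapsto\sum_iu_i$ on the product of these light cones. **Theorem.** With the topologies and smooth structures induced by those of $X_0^n$, of $\mathcal H_0^n$ (as a quotient of the space of stable Higgs bundles, with coordinates the residues of $\Phi$) and of the product of light cones, $Z_S$, $\mathcal Z_S$ and $M_0^{|S|,|S^c|}$ are smooth manifolds of dimension $2(n-3)$, and $Z_S$ and $\mathcal Z_S$ are diffeomorphic to $M_0^{|S|,|S^c|}$. More precisely, every point of $Z_S$ has a representative with $p_i=(0\ b_i)$, $q_i=(c_i\ 0)^t$ for $i\in S$ and $p_i=(a_i\ 0)$, $q_i=(0\ d_i)^t$ for $i\in S^c$, and a diffeomorphism $\varphi:Z_S\to M_0^{|S|,|S^c|}$ is given on every such representative by the class of the polygon with edges $$u_i=(\mathrm{Re}(b_ic_i),\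 \mathrm{Im}(b_ic_i),\ -|c_i|^2)\ (i\in S),\qquad u_i=(\mathrm{Re}(a_id_i),\ -\mathrm{Im}(a_id_i),\ |a_i|^2)\ (i\in S^c),$$ listed with the indices in $S$ first and in increasing order within $S$ and within $S^c$. There is a diffeomorphism $\psi:\mathcal Z_S\to M_0^{|S|,|S^c|}$ such that, if $[p,q]\in Z_S$ and $(E,\Phi)$ is a stable Higgs bundle as above on $E=\mathbb{CP}^1\times\mathbb C^2$ with $E_{x_i,2}=\langle q_i\rangle$ and $\mathrm{Res}_{x_i}\Phi=q_ip_i$ for all $i$, then $[E,\Phi]\in\mathcal Z_S$ and $\psi([E,\Phi])=\varphi([p,q])$. -/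

import Mathlib

open scoped Manifold ContDiff Topology Matrix

noncomputable section

/-! ## Smooth structures given by their smooth functions

The manifolds below are submanifolds of vector spaces, quotients of these by free proper group
actions, and submanifolds of such quotients. Their topologies are the subspace and quotient
topologies, and their smooth structures are given by saying which real functions are smooth on
which open sets. -/

/-- `𝒪 U f` says that the function `f` is smooth on the open set `U`. -/
abbrev SmoothFunctions (X : Type*) := Set X → (X → ℝ) → Prop

namespace SmoothFunctions

/-- The functions on a subset of a vector space (embedded by `ι`) that extend locally to smooth
functions of the vector space. -/
def ofEmbedding {Y E : Type*} [NormedAddCommGroup E] [NormedSpace ℝ E] (ι : Y → E) :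
    SmoothFunctions Y := fun U f =>
  ∀ y ∈ U, ∃ (W : Set E) (F : E → ℝ), IsOpen W ∧ ι y ∈ W ∧ ContDiffOn ℝ ∞ F W ∧
    ∀ y' ∈ U, ι y' ∈ W → f y' = F (ι y')

/-- The quotient structure: a function is smooth when its pull-back along the quotient map is. -/
def quotient {Y : Type*} (𝒪 : SmoothFunctions Y) (s : Setoid Y) :
    SmoothFunctions (Quotient s) := fun U f =>
  𝒪 (Quotient.mk s ⁻¹' U) (f ∘ Quotient.mk s)

/-- The induced structure on a subset `Z`: the functions that extend locally to smooth functions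
on open subsets of the ambient space. -/
def restrict {X : Type*} [TopologicalSpace X] (𝒪 : SmoothFunctions X) (Z : Set X) :
    SmoothFunctions Z := fun U f =>
  ∀ z ∈ U, ∃ (V : Set X) (F : X → ℝ), IsOpen V ∧ (z : X) ∈ V ∧ 𝒪 V F ∧
    ∀ z' ∈ U, (z' : X) ∈ V → f z' = F z'

/-- The atlas on `X` makes `X` a (Hausdorff, second countable) smooth manifold of dimension `d`
whose smooth functions are exactly those of `𝒪`; such a smooth structure is unique. -/
structure IsManifoldStructure {X : Type*} [TopologicalSpace X] (𝒪 : SmoothFunctions X) (d : ℕ)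
    [ChartedSpace (EuclideanSpace ℝ (Fin d)) X] : Prop where
  t2 : T2Space X
  secondCountable : SecondCountableTopology X
  isManifold : IsManifold (𝓡 d) ∞ X
  smooth_iff : ∀ U : Set X, IsOpen U → ∀ f : X → ℝ,
    ContMDiffOn (𝓡 d) 𝓘(ℝ, ℝ) ∞ f U ↔ 𝒪 U f

end SmoothFunctions

/-! ## Null hyperpolygons -/

/-- `T^*ℂ^{2n}`: pairs `(p, q)` of an `n`-tuple of row vectors `p i = (a_i, b_i)` and an
`n`-tuple of column vectors `q i = (c_i, d_i)`. -/
abbrev CotangentSpace (n : ℕ) := (Fin n → Fin 2 → ℂ) × (Fin n → Fin 2 → ℂ)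

def hermNormSq (v : Fin 2 → ℂ) : ℝ := ‖v 0‖ ^ 2 + ‖v 1‖ ^ 2

def tracelessPart (M : Matrix (Fin 2) (Fin 2) ℂ) : Matrix (Fin 2) (Fin 2) ℂ :=
  M - (M.trace / 2) • (1 : Matrix (Fin 2) (Fin 2) ℂ)

/-- The real moment map. Here `vecMulVec (q i) (star (q i)) = q_i q_i^*` and
`vecMulVec (star (p i)) (p i) = p_i^* p_i`. -/
def realMoment {n : ℕ} (z : CotangentSpace n) : Matrix (Fin 2) (Fin 2) ℂ × (Fin n → ℝ) :=
  ((1 / 2 : ℂ) • ∑ i, tracelessPart (Matrix.vecMulVec (z.2 i) (star (z.2 i))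
      - Matrix.vecMulVec (star (z.1 i)) (z.1 i)),
    fun i => -(1 / 2) * (hermNormSq (z.2 i) - hermNormSq (z.1 i)))

/-- The complex moment map. -/
def complexMoment {n : ℕ} (z : CotangentSpace n) : Matrix (Fin 2) (Fin 2) ℂ × (Fin n → ℂ) :=
  (-Complex.I • ∑ i, tracelessPart (Matrix.vecMulVec (z.2 i) (z.1 i)),
    fun i => Complex.I * (z.1 i ⬝ᵥ z.2 i))

/-- The zero level `𝒫_0^n` of the hyperkähler moment map, with `(p_i, q_i) ≠ 0` for all `i`. -/
def nullLevelSet (n : ℕ) : Set (CotangentSpace n) :=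
  {z | realMoment z = 0 ∧ complexMoment z = 0 ∧ ∀ i, hermNormSq (z.1 i) + hermNormSq (z.2 i) ≠ 0}

/-- Two points are in the same orbit of `K = (SU(2) × U(1)^n) / {±1}`, that is, of
`SU(2) × U(1)^n`, acting by `p_i ↦ e_i⁻¹ p_i A`, `q_i ↦ A⁻¹ q_i e_i`. -/
def SameOrbitK {n : ℕ} (z z' : CotangentSpace n) : Prop :=
  ∃ (A : Matrix.specialUnitaryGroup (Fin 2) ℂ) (e : Fin n → Circle), ∀ i,
    z'.1 i = (e i : ℂ)⁻¹ • (z.1 i ᵥ* (A : Matrix (Fin 2) (Fin 2) ℂ)) ∧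
    z'.2 i = (e i : ℂ) • (((A⁻¹ : Matrix.specialUnitaryGroup (Fin 2) ℂ) : Matrix (Fin 2) (Fin 2) ℂ)
      *ᵥ z.2 i)

def orbitSetoidK (n : ℕ) : Setoid (nullLevelSet n) where
  r z z' := SameOrbitK z.1 z'.1
  iseqv := by
    refine ⟨fun z => ⟨1, 1, fun i => by simp⟩, ?_, ?_⟩
    · rintro z z' ⟨A, e, h⟩
      have he : ∀ i, (e i : ℂ) ≠ 0 := fun i => Circle.coe_ne_zero _
      refine ⟨A⁻¹, e⁻¹, fun i => ?_⟩
      rw [(h i).1, (h i).2]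
      have hA : (A : Matrix (Fin 2) (Fin 2) ℂ) *
          ((A⁻¹ : Matrix.specialUnitaryGroup (Fin 2) ℂ) : Matrix (Fin 2) (Fin 2) ℂ) = 1 := by
        rw [← Submonoid.coe_mul, mul_inv_cancel]; rfl
      constructor
      · rw [Matrix.smul_vecMul, Matrix.vecMul_vecMul, hA, Matrix.vecMul_one, smul_smul]
        simp [he i]
      · rw [inv_inv, Matrix.mulVec_smul, Matrix.mulVec_mulVec, hA, Matrix.one_mulVec, smul_smul]
        simp [he i]
    · rintro z z' z'' ⟨A, e, h⟩ ⟨B, e', h'⟩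
      refine ⟨A * B, e * e', fun i => ?_⟩
      rw [(h' i).1, (h' i).2, (h i).1, (h i).2]
      constructor
      · rw [Matrix.smul_vecMul, Matrix.vecMul_vecMul, smul_smul, Submonoid.coe_mul]
        simp only [Pi.mul_apply, Circle.coe_mul, mul_inv, mul_comm]
      · rw [Matrix.mulVec_smul, Matrix.mulVec_mulVec, smul_smul, mul_inv_rev, Submonoid.coe_mul]
        simp only [Pi.mul_apply, Circle.coe_mul, mul_comm (e i : ℂ)]

/-- The space `X_0^n = 𝒫_0^n / K` of null hyperpolygons, with the quotient topology. -/
abbrev NullHyperpolygonSpace (n : ℕ) := Quotient (orbitSetoidK n)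

/-- The smooth structure of `X_0^n`. -/
def NullHyperpolygonSpace.smoothFunctions (n : ℕ) : SmoothFunctions (NullHyperpolygonSpace n) :=
  (SmoothFunctions.ofEmbedding
    (fun z : nullLevelSet n => (z : CotangentSpace n))).quotient (orbitSetoidK n)

/-- A set of indices is straight at `(p, q)` when the `q_i`, `i ∈ T`, are all proportional. -/
def IsStraight {n : ℕ} (T : Finset (Fin n)) (z : CotangentSpace n) : Prop :=
  ∀ i ∈ T, ∀ j ∈ T, ∃ c : ℂ, z.2 i = c • z.2 j

/-- The component `Z_S` of the fixed-point set of `[p, q] ↦ [qᵗ, pᵗ]` in `X_0^n`. -/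
def hyperpolygonComponent {n : ℕ} (S : Finset (Fin n)) : Set (NullHyperpolygonSpace n) :=
  {ξ | ∃ z : nullLevelSet n, Quotient.mk (orbitSetoidK n) z = ξ ∧
    IsStraight S z.1 ∧ IsStraight Sᶜ z.1}

/-! ## Quasi-parabolic Higgs bundles over the Riemann sphere -/

/-- The Riemann sphere `ℂP¹ = ℂ ∪ {∞}`. -/
abbrev RiemannSphere := OnePoint ℂ

/-- The holomorphic local parametrization of the sphere centred at `y`: `t ↦ a + t` at `a ∈ ℂ`,
and `t ↦ 1 / t` at `∞`. -/
def sphereCoord (y : RiemannSphere) (t : ℂ) : RiemannSphere :=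
  match y with
  | OnePoint.some a => OnePoint.some (a + t)
  | OnePoint.infty => if t = 0 then OnePoint.infty else OnePoint.some t⁻¹

/-- The coefficient of the matrix-valued one-form `φ dz` in the local coordinate `t` at `y`; at
`∞`, `dz = d(1/t) = - dt / t ^ 2`. -/
def localForm (φ : ℂ → Matrix (Fin 2) (Fin 2) ℂ) (y : RiemannSphere) (t : ℂ) :
    Matrix (Fin 2) (Fin 2) ℂ :=
  match y with
  | OnePoint.some a => φ (a + t)
  | OnePoint.infty => (-(t ^ 2)⁻¹) • φ t⁻¹

def MatrixAnalyticAt (h : ℂ → Matrix (Fin 2) (Fin 2) ℂ) (a : ℂ) : Prop :=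
  ∀ j k, AnalyticAt ℂ (fun t => h t j k) a

/-- The residue of `φ dz` at `y` (meaningful at points where there is at most a simple pole). -/
def formResidue (φ : ℂ → Matrix (Fin 2) (Fin 2) ℂ) (y : RiemannSphere) :
    Matrix (Fin 2) (Fin 2) ℂ :=
  Filter.limUnder (𝓝[≠] (0 : ℂ)) fun t => t • localForm φ y t

/-- A rank-2 quasi-parabolic `SL(2, ℂ)`-Higgs bundle over `ℂP¹` at the marked points `x_i`, with
underlying bundle `E = ℂP¹ × ℂ²`: the lines `E_{x_i, 2} = flag i`, and the Higgs field
`Φ = form dz`, a traceless holomorphic section of `End(E) ⊗ K(D)` (the values of `form` at marked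
points play no role) whose residues are nilpotent with respect to the flags. -/
structure HiggsBundle {n : ℕ} (x : Fin n → RiemannSphere) where
  flag : Fin n → Submodule ℂ (Fin 2 → ℂ)
  finrank_flag : ∀ i, Module.finrank ℂ (flag i) = 1
  form : ℂ → Matrix (Fin 2) (Fin 2) ℂ
  holomorphic : ∀ a : ℂ, (a : RiemannSphere) ∉ Set.range x → MatrixAnalyticAt form a
  holomorphic_infty : OnePoint.infty ∉ Set.range x → ∃ h, MatrixAnalyticAt h 0 ∧
    ∀ᶠ t in 𝓝[≠] (0 : ℂ), localForm form OnePoint.infty t = h t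
  simple_pole : ∀ i, ∃ h, MatrixAnalyticAt h 0 ∧
    ∀ᶠ t in 𝓝[≠] (0 : ℂ), t • localForm form (x i) t = h t
  traceless : ∀ a : ℂ, (a : RiemannSphere) ∉ Set.range x → (form a).trace = 0
  residue_mem : ∀ i v, formResidue form (x i) *ᵥ v ∈ flag i
  residue_flag : ∀ i, ∀ v ∈ flag i, formResidue form (x i) *ᵥ v = 0

/-- A holomorphic line subbundle of the trivial bundle `ℂP¹ × ℂ²`. -/
structure LineSubbundle where
  fiber : RiemannSphere → Submodule ℂ (Fin 2 → ℂ)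
  holomorphic : ∀ y, ∃ s : ℂ → Fin 2 → ℂ, AnalyticAt ℂ s 0 ∧
    ∀ᶠ t in 𝓝 (0 : ℂ), s t ≠ 0 ∧ fiber (sphereCoord y t) = Submodule.span ℂ {s t}

namespace LineSubbundle

/-- `L` has degree `d`: the divisor of a nonzero meromorphic section of `L` has degree `d`. -/
def HasDegree (L : LineSubbundle) (d : ℤ) : Prop :=
  ∃ s : RiemannSphere → Fin 2 → ℂ, (∀ y, s y ∈ L.fiber y) ∧
    (∀ y, MeromorphicAt (fun t => s (sphereCoord y t)) 0 ∧
      meromorphicOrderAt (fun t => s (sphereCoord y t)) 0 ≠ ⊤) ∧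
    d = ∑ᶠ y, (meromorphicOrderAt (fun t => s (sphereCoord y t)) 0).untop₀

/-- `L` is trivial: it has a nowhere vanishing global holomorphic section. -/
def IsTrivial (L : LineSubbundle) : Prop :=
  ∃ s : RiemannSphere → Fin 2 → ℂ, (∀ y, AnalyticAt ℂ (fun t => s (sphereCoord y t)) 0) ∧
    ∀ y, s y ≠ 0 ∧ L.fiber y = Submodule.span ℂ {s y}

end LineSubbundle

/-- The quasi-parabolic slope `(deg + m r / 2) / r` of a rank-`r` bundle of degree `deg` with a
quasi-parabolic structure at `m` points. -/
def quasiParabolicSlope (deg : ℤ) (m r : ℕ) : ℝ := ((deg : ℝ) + (m : ℝ) * r / 2) / r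

namespace HiggsBundle

variable {n : ℕ} {x : Fin n → RiemannSphere}

def residue (E : HiggsBundle x) (i : Fin n) : Matrix (Fin 2) (Fin 2) ℂ :=
  formResidue E.form (x i)

/-- The Higgs field maps `L` to `L' ⊗ K(D)`. -/
def MapsTo (E : HiggsBundle x) (L L' : LineSubbundle) : Prop :=
  ∀ a : ℂ, (a : RiemannSphere) ∉ Set.range x → ∀ v ∈ L.fiber a, E.form a *ᵥ v ∈ L'.fiber a

/-- Stability: the residues are nonzero, and every line subbundle `L` preserved by the Higgs field
has smaller slope than `E`. The subbundle `L` has its quasi-parabolic structure at the points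
`x_i` with `L_{x_i} ∩ E_{x_i, 2} ≠ 0`. -/
def IsStable (E : HiggsBundle x) : Prop :=
  (∀ i, E.residue i ≠ 0) ∧
  ∀ (L : LineSubbundle) (d : ℤ), E.MapsTo L L → L.HasDegree d →
    quasiParabolicSlope d {i | L.fiber (x i) ⊓ E.flag i ≠ ⊥}.ncard 1 < quasiParabolicSlope 0 n 2

/-- Isomorphism of quasi-parabolic `SL(2, ℂ)`-Higgs bundles: a holomorphic bundle automorphism `g`
of `ℂP¹ × ℂ²` of determinant one that maps flags to flags and intertwines the Higgs fields. -/
def Iso (E F : HiggsBundle x) : Prop :=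
  ∃ g : RiemannSphere → Matrix.SpecialLinearGroup (Fin 2) ℂ,
    (∀ y, MatrixAnalyticAt (fun t => (g (sphereCoord y t) : Matrix (Fin 2) (Fin 2) ℂ)) 0) ∧
    (∀ i, (E.flag i).map (Matrix.mulVecLin (g (x i) : Matrix (Fin 2) (Fin 2) ℂ)) = F.flag i) ∧
    ∀ a : ℂ, (a : RiemannSphere) ∉ Set.range x →
      (g a : Matrix (Fin 2) (Fin 2) ℂ) * E.form a = F.form a * (g a : Matrix (Fin 2) (Fin 2) ℂ)

theorem Iso.refl (E : HiggsBundle x) : E.Iso E :=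
  ⟨fun _ => 1, fun _ _ _ => analyticAt_const, fun i => by simp, fun a _ => by simp⟩

theorem Iso.symm {E F : HiggsBundle x} (h : E.Iso F) : F.Iso E := by
  obtain ⟨g, h1, h2, h3⟩ := h
  have hinv : ∀ y, ((g y)⁻¹ : Matrix.SpecialLinearGroup (Fin 2) ℂ).1 * (g y).1 = 1 := fun y => by
    rw [← Matrix.SpecialLinearGroup.coe_mul, inv_mul_cancel]; rfl
  have hinv' : ∀ y, (g y).1 * ((g y)⁻¹ : Matrix.SpecialLinearGroup (Fin 2) ℂ).1 = 1 := fun y => by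
    rw [← Matrix.SpecialLinearGroup.coe_mul, mul_inv_cancel]; rfl
  refine ⟨fun y => (g y)⁻¹, fun y => ?_, fun i => ?_, fun a ha => ?_⟩
  · intro j k
    have e : ∀ t, ((g (sphereCoord y t))⁻¹ : Matrix.SpecialLinearGroup (Fin 2) ℂ).1 =
        !![(g (sphereCoord y t)).1 1 1, -(g (sphereCoord y t)).1 0 1;
          -(g (sphereCoord y t)).1 1 0, (g (sphereCoord y t)).1 0 0] := fun t => by
      rw [Matrix.SpecialLinearGroup.coe_inv, Matrix.adjugate_fin_two]
    simp only [e]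
    fin_cases j <;> fin_cases k
    · simpa using h1 y 1 1
    · exact (h1 y 0 1).neg
    · exact (h1 y 1 0).neg
    · simpa using h1 y 0 0
  · rw [← h2 i, ← Submodule.map_comp, ← Matrix.mulVecLin_mul, hinv]
    simp
  · calc ((g a)⁻¹ : Matrix.SpecialLinearGroup (Fin 2) ℂ).1 * F.form a
        = (g a)⁻¹.1 * (F.form a * (g a).1) * (g a)⁻¹.1 := by
          rw [mul_assoc, mul_assoc, hinv', mul_one]
      _ = E.form a * (g a)⁻¹.1 := by rw [← h3 a ha, ← mul_assoc, hinv, one_mul]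

theorem Iso.trans {E F G : HiggsBundle x} (h : E.Iso F) (h' : F.Iso G) : E.Iso G := by
  obtain ⟨g, h1, h2, h3⟩ := h
  obtain ⟨g', h1', h2', h3'⟩ := h'
  refine ⟨fun y => g' y * g y, fun y j k => ?_, fun i => ?_, fun a ha => ?_⟩
  · simp only [Matrix.SpecialLinearGroup.coe_mul, Matrix.mul_apply, Fin.sum_univ_two]
    exact ((h1' y j 0).mul (h1 y 0 k)).add ((h1' y j 1).mul (h1 y 1 k))
  · rw [Matrix.SpecialLinearGroup.coe_mul, Matrix.mulVecLin_mul, Submodule.map_comp, h2, h2']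
  · rw [Matrix.SpecialLinearGroup.coe_mul, mul_assoc, h3 a ha, ← mul_assoc, h3' a ha, mul_assoc]

end HiggsBundle

/-- The stable quasi-parabolic Higgs bundles with underlying bundle `ℂP¹ × ℂ²`. -/
abbrev StableHiggsBundle {n : ℕ} (x : Fin n → RiemannSphere) := {E : HiggsBundle x // E.IsStable}

/-- The residues of the Higgs field. They determine the Higgs field, and for nonzero residues also
the flags `E_{x_i, 2} = im Res_{x_i} Φ`, so that they are coordinates on the stable bundles. -/
def StableHiggsBundle.residues {n : ℕ} {x : Fin n → RiemannSphere} (E : StableHiggsBundle x) :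
    Fin n → Fin 2 → Fin 2 → ℂ := fun i j k => E.1.residue i j k

instance StableHiggsBundle.instTopologicalSpace {n : ℕ} (x : Fin n → RiemannSphere) :
    TopologicalSpace (StableHiggsBundle x) :=
  TopologicalSpace.induced StableHiggsBundle.residues inferInstance

def higgsSetoid {n : ℕ} (x : Fin n → RiemannSphere) : Setoid (StableHiggsBundle x) where
  r E F := E.1.Iso F.1
  iseqv := ⟨fun E => HiggsBundle.Iso.refl E.1, HiggsBundle.Iso.symm, HiggsBundle.Iso.trans⟩

/-- The moduli space `ℋ_0^n`, with the quotient topology. -/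
abbrev HiggsModuliSpace {n : ℕ} (x : Fin n → RiemannSphere) := Quotient (higgsSetoid x)

/-- The smooth structure of `ℋ_0^n`. -/
def HiggsModuliSpace.smoothFunctions {n : ℕ} (x : Fin n → RiemannSphere) :
    SmoothFunctions (HiggsModuliSpace x) :=
  (SmoothFunctions.ofEmbedding
    (StableHiggsBundle.residues : StableHiggsBundle x → _)).quotient (higgsSetoid x)

/-- The component `𝒵_S` of the fixed-point set of `(E, Φ) ↦ (E^*, Φᵗ)` in `ℋ_0^n`: the classes of
bundles with a decomposition `E = L₀ ⊕ L₁` into trivial line bundles, where `E_{x_i, 2}` is the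
fibre of `L₀` for `i ∈ S` and of `L₁` otherwise, and `Φ` is off-diagonal with component
`L₀ → L₁` vanishing over `x_i` for `i ∈ S` and component `L₁ → L₀` vanishing over the others. -/
def higgsComponent {n : ℕ} (x : Fin n → RiemannSphere) (S : Finset (Fin n)) :
    Set (HiggsModuliSpace x) :=
  {ξ | ∃ E : StableHiggsBundle x, Quotient.mk (higgsSetoid x) E = ξ ∧
    ∃ L₀ L₁ : LineSubbundle, L₀.IsTrivial ∧ L₁.IsTrivial ∧
      (∀ y, IsCompl (L₀.fiber y) (L₁.fiber y)) ∧
      (∀ i ∈ S, E.1.flag i = L₀.fiber (x i)) ∧ (∀ i ∉ S, E.1.flag i = L₁.fiber (x i)) ∧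
      E.1.MapsTo L₀ L₁ ∧ E.1.MapsTo L₁ L₀ ∧
      (∀ i ∈ S, ∀ v ∈ L₀.fiber (x i), E.1.residue i *ᵥ v = 0) ∧
      (∀ i ∉ S, ∀ v ∈ L₁.fiber (x i), E.1.residue i *ᵥ v = 0)}

/-- `E` is the Higgs bundle of the hyperpolygon `(p, q)`: its flags are the lines spanned by the
`q_i`, and the residues of its Higgs field are the `q_i p_i`. -/
def HiggsBundle.IsAssociatedTo {n : ℕ} {x : Fin n → RiemannSphere} (E : HiggsBundle x)
    (z : CotangentSpace n) : Prop :=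
  ∀ i, E.flag i = Submodule.span ℂ {z.2 i} ∧ E.residue i = Matrix.vecMulVec (z.2 i) (z.1 i)

/-! ## Null polygons in Minkowski 3-space -/

def minkowski (v w : Fin 3 → ℝ) : ℝ := -(v 0 * w 0) - v 1 * w 1 + v 2 * w 2

/-- The future light cone. -/
def futureCone : Set (Fin 3 → ℝ) := {v | minkowski v v = 0 ∧ 0 < v 2}

/-- The past light cone. -/
def pastCone : Set (Fin 3 → ℝ) := {v | minkowski v v = 0 ∧ v 2 < 0}

/-- The identification of Minkowski 3-space with the Lie algebra of `SU(1,1)`. -/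
def toSu11 (v : Fin 3 → ℝ) : Matrix (Fin 2) (Fin 2) ℂ :=
  (1 / 2 : ℂ) • !![-(Complex.I * v 2), v 0 + Complex.I * v 1;
    v 0 - Complex.I * v 1, Complex.I * v 2]

/-- `SU(1,1)`, the matrices of determinant one that preserve the Hermitian form `diag(1, -1)`. -/
def SU11 : Subgroup (Matrix.SpecialLinearGroup (Fin 2) ℂ) where
  carrier := {A | A.1ᴴ * !![1, 0; 0, -1] * A.1 = !![1, 0; 0, -1]}
  one_mem' := by simp
  mul_mem' := by
    intro A B hA hB
    simp only [Set.mem_ofPred_eq, Matrix.SpecialLinearGroup.coe_mul, Matrix.conjTranspose_mul]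
      at *
    calc B.1ᴴ * A.1ᴴ * !![1, 0; 0, -1] * (A.1 * B.1)
        = B.1ᴴ * (A.1ᴴ * !![1, 0; 0, -1] * A.1) * B.1 := by simp only [mul_assoc]
      _ = _ := by rw [hA, hB]
  inv_mem' := by
    intro A hA
    simp only [Set.mem_ofPred_eq] at *
    have h : A.1 * (A⁻¹).1 = 1 := by
      rw [← Matrix.SpecialLinearGroup.coe_mul, mul_inv_cancel]; rfl
    have h' : ((A⁻¹).1)ᴴ * (A.1)ᴴ = 1 := by rw [← Matrix.conjTranspose_mul, h]; simp
    calc ((A⁻¹).1)ᴴ * !![1, 0; 0, -1] * (A⁻¹).1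
        = ((A⁻¹).1)ᴴ * (A.1ᴴ * !![1, 0; 0, -1] * A.1) * (A⁻¹).1 := by rw [hA]
      _ = (((A⁻¹).1)ᴴ * A.1ᴴ) * !![1, 0; 0, -1] * (A.1 * (A⁻¹).1) := by simp only [mul_assoc]
      _ = _ := by rw [h, h', one_mul, mul_one]

/-- The `n`-tuples of vectors with `n = k₁ + k₂`; the first `k₁` are indexed by `Sum.inl`, the
last `k₂` by `Sum.inr`. -/
abbrev EdgeTuple (k₁ k₂ : ℕ) := Fin k₁ ⊕ Fin k₂ → Fin 3 → ℝ

/-- `u` is a regular point of the moment map `u ↦ ∑ u_i` on the product of light cones: the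
differential `(w_i) ↦ ∑ w_i` is onto, where `w_i` ranges over the tangent space
`{w | w ∘ u_i = 0}` of the light cone at `u_i`. -/
def IsRegularTuple {k₁ k₂ : ℕ} (u : EdgeTuple k₁ k₂) : Prop :=
  ∀ y : Fin 3 → ℝ, ∃ w : EdgeTuple k₁ k₂, (∀ i, minkowski (w i) (u i) = 0) ∧ ∑ i, w i = y

/-- The regular closed null polygons with the first `k₁` edges in the past light cone and the last
`k₂` edges in the future light cone. -/
def regularNullPolygons (k₁ k₂ : ℕ) : Set (EdgeTuple k₁ k₂) :=
  {u | (∀ i, u (Sum.inl i) ∈ pastCone) ∧ (∀ j, u (Sum.inr j) ∈ futureCone) ∧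
    ∑ i, u i = 0 ∧ IsRegularTuple u}

/-- Orbits of the diagonal (co)adjoint action of `SU(1,1)`. -/
def polygonSetoid (k₁ k₂ : ℕ) : Setoid (regularNullPolygons k₁ k₂) where
  r u u' := ∃ A ∈ SU11, ∀ i, toSu11 (u'.1 i) = A.1 * toSu11 (u.1 i) * (A⁻¹).1
  iseqv := by
    refine ⟨fun u => ⟨1, one_mem _, fun i => by simp⟩, ?_, ?_⟩
    · rintro u u' ⟨A, hA, h⟩
      have h1 : (A⁻¹).1 * A.1 = 1 := by
        rw [← Matrix.SpecialLinearGroup.coe_mul, inv_mul_cancel]; rfl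
      refine ⟨A⁻¹, inv_mem hA, fun i => ?_⟩
      rw [h i, inv_inv]
      calc toSu11 (u.1 i) = ((A⁻¹).1 * A.1) * toSu11 (u.1 i) * ((A⁻¹).1 * A.1) := by
            rw [h1, one_mul, mul_one]
        _ = _ := by simp only [mul_assoc]
    · rintro u u' u'' ⟨A, hA, h⟩ ⟨B, hB, h'⟩
      refine ⟨B * A, mul_mem hB hA, fun i => ?_⟩
      rw [h' i, h i, mul_inv_rev, Matrix.SpecialLinearGroup.coe_mul,
        Matrix.SpecialLinearGroup.coe_mul]
      simp only [mul_assoc]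

/-- The moduli space `M_0^{k₁, k₂}` of closed null polygons, with the quotient topology. -/
abbrev NullPolygonSpace (k₁ k₂ : ℕ) := Quotient (polygonSetoid k₁ k₂)

/-- The smooth structure of `M_0^{k₁, k₂}`. -/
def NullPolygonSpace.smoothFunctions (k₁ k₂ : ℕ) : SmoothFunctions (NullPolygonSpace k₁ k₂) :=
  (SmoothFunctions.ofEmbedding
    (fun u : regularNullPolygons k₁ k₂ => (u : EdgeTuple k₁ k₂))).quotient (polygonSetoid k₁ k₂)

/-! ## The explicit map -/

/-- `(p, q)` has the form `p_i = (0, b_i)`, `q_i = (c_i, 0)` for `i ∈ S` and `p_i = (a_i, 0)`,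
`q_i = (0, d_i)` for `i ∉ S`. -/
def IsSplitForm {n : ℕ} (S : Finset (Fin n)) (z : CotangentSpace n) : Prop :=
  (∀ i ∈ S, z.1 i 0 = 0 ∧ z.2 i 1 = 0) ∧ ∀ i ∉ S, z.1 i 1 = 0 ∧ z.2 i 0 = 0

/-- The vectors `u_i = (Re (b_i c_i), Im (b_i c_i), -|c_i|²)` for `i ∈ S`, and
`u_i = (Re (a_i d_i), -Im (a_i d_i), |a_i|²)` for `i ∉ S`. -/
def splitEdge {n : ℕ} (S : Finset (Fin n)) (z : CotangentSpace n) (i : Fin n) : Fin 3 → ℝ :=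
  if i ∈ S then ![(z.1 i 1 * z.2 i 0).re, (z.1 i 1 * z.2 i 0).im, -‖z.2 i 0‖ ^ 2]
  else ![(z.1 i 0 * z.2 i 1).re, -(z.1 i 0 * z.2 i 1).im, ‖z.1 i 0‖ ^ 2]

/-- The reshuffling of the indices, preserving the order within `S` and within its complement,
after which the elements of `S` come first. -/
def reshuffle {n : ℕ} (S : Finset (Fin n)) : Fin S.card ⊕ Fin Sᶜ.card ≃ Fin n :=
  finSumEquivOfFinset rfl rfl

end

/-! All three spaces are described by the same data: nonzero complex numbers w_i with ∑_{i ∈ S} w_i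
= 0 and ∑_{i ∉ S} w_i = 0, up to w_i ↦ c w_i for i ∈ S and w_i ↦ c⁻¹ w_i for i ∉ S. For a Higgs
bundle, w_i is the only nonzero entry of the residue at x_i in a frame adapted to L₀ ⊕ L₁; the
residues add up to zero, and diag(l, l⁻¹) acts with c = l². For a hyperpolygon in split form, w_i is
the product of the nonzero entries of q_i and p_i; the real moment map adds the normalization ∑_{i ∈
S} |w_i| = ∑_{i ∉ S} |w_i|, and only |c| = 1 remains. For a null polygon, SU(1,1) moves the sum of
the future edges to the time axis; then w_i is the projection of u_i to the space-like plane
(conjugated for i ∉ S), closing gives the same three equations, and rotations remain. Each ℂ^*-orbit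
meets the normalized tuples in one U(1)-orbit, an elementary Kempf–Ness statement made explicit by
`slice`, `sum_norm_slice` and `exists_slice_pairCoord`.

Fix i₀ ∈ S and j₀ ∉ S. The invariants w_i w_{j₀} (i ∈ S) and w_i w_{i₀} (i ∉ S) separate the orbits,
and their values are exactly the points without zero entries of `coordSubspace`, a complex vector
space of dimension n - 3. So each space has one global chart onto the same open subset of Euclidean
space, and the diffeomorphisms are the identity in these charts. The formula for φ and the
compatibility of ψ with φ say only that corresponding points have equal coordinates.

For the charts to define the given smooth structures, the invariants must come from smooth functions
on an open set of the ambient vector space and must have a smooth section; `QuotientCoordinates`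
collects this. For residues and for q_i p_i the invariants are traces of products (`traceCoord`),
for polygons they are built from Minkowski products and determinants (`polygonCoord`).

The reduction to the w_i rests on a different fact in each case. For Higgs bundles it is Liouville's
theorem: isomorphisms and trivial line subbundles are constant, the Higgs field is the sum of its
polar parts (`form_eq_sum`), and line subbundles have nonpositive degree (`degree_nonpos`), which
makes stability automatic. For hyperpolygons the real moment map forces the two lines spanned by the
q_i to be orthogonal (`isSplitForm_of_isStraight`). For polygons regularity forces the sum of the
future edges to be time-like (`minkowski_sum_compl_edges_pos`). -/

noncomputable section

/-! ### Smooth structures with a single global chart. -/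

namespace SmoothFunctions

/-- `κ` is a chart with domain `X`: an open embedding into Euclidean space that identifies the
smooth functions of `𝒪` with the smooth functions of the coordinates. -/
structure IsGlobalChart {X : Type*} [TopologicalSpace X] (𝒪 : SmoothFunctions X) {d : ℕ}
    (κ : X → EuclideanSpace ℝ (Fin d)) : Prop where
  isOpenEmbedding : Topology.IsOpenEmbedding κ
  smooth_iff : ∀ U : Set X, IsOpen U → ∀ f : X → ℝ, 𝒪 U f ↔ ofEmbedding κ U f

namespace IsGlobalChart

variable {X : Type*} [TopologicalSpace X] [Nonempty X] {𝒪 : SmoothFunctions X} {d : ℕ}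
  {κ : X → EuclideanSpace ℝ (Fin d)}

/-- With one chart there are no transition maps to check, and the separation and countability axioms
are inherited from Euclidean space through the embedding. -/
theorem isManifoldStructure (h : IsGlobalChart 𝒪 κ) :
    letI := h.isOpenEmbedding.singletonChartedSpace
    𝒪.IsManifoldStructure d := by
  let _ := h.isOpenEmbedding.singletonChartedSpace
  have hκ : ContMDiff (𝓡 d) (𝓡 d) ∞ κ := contMDiff_isOpenEmbedding h.isOpenEmbedding
  have hs := contMDiffOn_isOpenEmbedding_symm (I := 𝓡 d) (n := ∞) h.isOpenEmbedding
  refine ⟨h.isOpenEmbedding.isEmbedding.t2Space,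
    h.isOpenEmbedding.isEmbedding.secondCountableTopology,
    h.isOpenEmbedding.isManifold_singleton, fun U hU f => ?_⟩
  rw [h.smooth_iff U hU f]
  constructor
  · intro hf y hy
    have hW : IsOpen (κ '' U) := h.isOpenEmbedding.isOpenMap U hU
    -- The extension is `f` read in the chart; its domain is open because `κ` is an open map.
    refine ⟨κ '' U, f ∘ (h.isOpenEmbedding.toOpenPartialHomeomorph κ).symm, hW, ⟨y, hy, rfl⟩,
      ?_, fun y' _ _ => ?_⟩
    · rw [← contMDiffOn_iff_contDiffOn]
      refine hf.comp (hs.mono (Set.image_subset_range _ _)) ?_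
      rintro _ ⟨z, hz, rfl⟩
      simpa [h.isOpenEmbedding.toOpenPartialHomeomorph_left_inv] using hz
    · simp [h.isOpenEmbedding.toOpenPartialHomeomorph_left_inv]
  · intro hf y hy
    obtain ⟨W, F, hWo, hyW, hF, hfF⟩ := hf y hy
    have h1 : ContMDiffAt (𝓡 d) 𝓘(ℝ, ℝ) ∞ (F ∘ κ) y :=
      ((hF.contDiffAt (hWo.mem_nhds hyW)).contMDiffAt).comp y hκ.contMDiffAt
    refine (h1.congr_of_eventuallyEq ?_).contMDiffWithinAt
    filter_upwards [hU.mem_nhds hy,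
      h.isOpenEmbedding.continuous.continuousAt.preimage_mem_nhds (hWo.mem_nhds hyW)] with z hz hz'
    exact hfF z hz hz'

/-- Two spaces with global charts that have the same image are diffeomorphic. -/
theorem exists_diffeomorph {X' : Type*} [TopologicalSpace X'] [Nonempty X']
    {𝒪' : SmoothFunctions X'} {κ' : X' → EuclideanSpace ℝ (Fin d)} (h : IsGlobalChart 𝒪 κ)
    (h' : IsGlobalChart 𝒪' κ') (hr : Set.range κ = Set.range κ') :
    letI := h.isOpenEmbedding.singletonChartedSpace
    letI := h'.isOpenEmbedding.singletonChartedSpace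
    ∃ φ : X ≃ₘ^∞⟮𝓡 d, 𝓡 d⟯ X', ∀ x, κ' (φ x) = κ x := by
  let _ := h.isOpenEmbedding.singletonChartedSpace
  let _ := h'.isOpenEmbedding.singletonChartedSpace
  -- Equality of the ranges puts every value of one chart in the domain of the inverse of the other.
  have key : ∀ x, κ' ((h'.isOpenEmbedding.toOpenPartialHomeomorph κ').symm (κ x)) = κ x :=
    fun x => h'.isOpenEmbedding.toOpenPartialHomeomorph_right_inv _ (hr ▸ Set.mem_range_self x)
  have key' : ∀ x, κ ((h.isOpenEmbedding.toOpenPartialHomeomorph κ).symm (κ' x)) = κ' x :=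
    fun x => h.isOpenEmbedding.toOpenPartialHomeomorph_right_inv _ (hr ▸ Set.mem_range_self x)
  refine ⟨⟨⟨fun x => (h'.isOpenEmbedding.toOpenPartialHomeomorph κ').symm (κ x),
    fun x => (h.isOpenEmbedding.toOpenPartialHomeomorph κ).symm (κ' x), fun x => ?_, fun x => ?_⟩,
    ?_, ?_⟩, key⟩
  · exact h.isOpenEmbedding.injective (by rw [key', key])
  · exact h'.isOpenEmbedding.injective (by rw [key, key'])
  · exact (contMDiffOn_isOpenEmbedding_symm (I := 𝓡 d) (n := ∞) h'.isOpenEmbedding).comp_contMDiff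
      (contMDiff_isOpenEmbedding h.isOpenEmbedding) fun x => hr ▸ Set.mem_range_self x
  · exact (contMDiffOn_isOpenEmbedding_symm (I := 𝓡 d) (n := ∞) h.isOpenEmbedding).comp_contMDiff
      (contMDiff_isOpenEmbedding h'.isOpenEmbedding) fun x => hr ▸ Set.mem_range_self x

end IsGlobalChart

/-! ### Charts on quotients from smooth invariants with a smooth section. -/

section Quotient

variable {Y E : Type*} [TopologicalSpace Y] [NormedAddCommGroup E] [NormedSpace ℝ E]

/-- Invariant coordinates `k` and a smooth section `ρ` of them over the open set `U`, for the
quotient of `Y ⊆ E` by `s` and a subset `Z` of the quotient. -/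
structure QuotientCoordinates (ι : Y → E) (s : Setoid Y) (Z : Set (Quotient s)) {d : ℕ}
    (O : Set E) (k : E → EuclideanSpace ℝ (Fin d)) (U : Set (EuclideanSpace ℝ (Fin d)))
    (ρ : U → Y) (σ : EuclideanSpace ℝ (Fin d) → E) : Prop where
  inducing : Topology.IsInducing ι
  isOpen_domain : IsOpen O
  mem_domain : ∀ y, ι y ∈ O
  contDiffOn : ContDiffOn ℝ ∞ k O
  invariant : ∀ y y', s.r y y' → k (ι y) = k (ι y')
  isOpen : IsOpen U
  section_coe : ∀ u, ι (ρ u) = σ u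
  section_contDiffOn : ContDiffOn ℝ ∞ σ U
  section_mem : ∀ u, Quotient.mk s (ρ u) ∈ Z
  coord_section : ∀ u, k (ι (ρ u)) = u
  section_coord : ∀ y, Quotient.mk s y ∈ Z → ∃ h : k (ι y) ∈ U, s.r (ρ ⟨_, h⟩) y

namespace QuotientCoordinates

variable {ι : Y → E} {s : Setoid Y} {Z : Set (Quotient s)} {d : ℕ} {O : Set E}
  {k : E → EuclideanSpace ℝ (Fin d)} {U : Set (EuclideanSpace ℝ (Fin d))} {ρ : U → Y}
  {σ : EuclideanSpace ℝ (Fin d) → E} (h : QuotientCoordinates ι s Z O k U ρ σ)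

include h

/-- The coordinates, as a function on the quotient. -/
def coord : Quotient s → EuclideanSpace ℝ (Fin d) :=
  Quotient.lift (fun y => k (ι y)) h.invariant

theorem continuous_coord : Continuous h.coord :=
  (continuousOn_iff_continuous_domRestrict.1 h.contDiffOn.continuousOn |>.comp
    (h.inducing.continuous.subtype_mk h.mem_domain)).quotient_lift h.invariant

theorem continuous_section : Continuous ρ := by
  rw [h.inducing.continuous_iff]
  have : ι ∘ ρ = U.domRestrict σ := funext h.section_coe
  rw [this]
  exact continuousOn_iff_continuous_domRestrict.1 h.section_contDiffOn.continuousOn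

theorem mk_section_coord (z : Quotient s) (hz : z ∈ Z) :
    ∃ hu : h.coord z ∈ U, Quotient.mk s (ρ ⟨_, hu⟩) = z := by
  induction z using Quotient.inductionOn with
  | _ y =>
    obtain ⟨hu, hy⟩ := h.section_coord y hz
    exact ⟨hu, Quotient.sound hy⟩

theorem range_coord : Set.range (fun z : Z => h.coord z) = U := by
  ext u
  constructor
  · rintro ⟨z, rfl⟩
    exact (h.mk_section_coord z z.2).1
  · intro hu
    exact ⟨⟨_, h.section_mem ⟨u, hu⟩⟩, h.coord_section ⟨u, hu⟩⟩

/-- The section followed by the quotient map is a continuous inverse of the coordinates on `Z`,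
which makes `Z` homeomorphic to the open set `U`. -/
theorem isOpenEmbedding_coord : Topology.IsOpenEmbedding (fun z : Z => h.coord z) := by
  let e : Z ≃ₜ U :=
    { toFun := fun z => ⟨h.coord z, (h.mk_section_coord z z.2).1⟩
      invFun := fun u => ⟨Quotient.mk s (ρ u), h.section_mem u⟩
      left_inv := fun z => Subtype.ext (h.mk_section_coord z z.2).2
      right_inv := fun u => Subtype.ext (h.coord_section u)
      continuous_toFun := (h.continuous_coord.comp continuous_subtype_val).subtype_mk _
      continuous_invFun := (continuous_quotient_mk'.comp h.continuous_section).subtype_mk _ }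
  exact h.isOpen.isOpenEmbedding_subtypeVal.comp e.isOpenEmbedding

/-- A smooth function on an open subset of the quotient is a smooth function of the coordinates
near each point of `Z`. -/
theorem exists_contDiffOn {V : Set (Quotient s)} (hV : IsOpen V) {F : Quotient s → ℝ}
    (hF : (ofEmbedding ι).quotient s V F) {z : Quotient s} (hz : z ∈ Z) (hzV : z ∈ V) :
    ∃ (W : Set (EuclideanSpace ℝ (Fin d))) (G : EuclideanSpace ℝ (Fin d) → ℝ), IsOpen W ∧
      h.coord z ∈ W ∧ ContDiffOn ℝ ∞ G W ∧
        ∀ z' ∈ Z, h.coord z' ∈ W → z' ∈ V ∧ F z' = G (h.coord z') := by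
  obtain ⟨hu, hz1⟩ := h.mk_section_coord z hz
  obtain ⟨W, G, hW, hyW, hG, hFG⟩ := hF (ρ ⟨_, hu⟩) (by simpa [hz1] using hzV)
  -- On the first set `G ∘ σ` is smooth; the second consists of the coordinates whose section point
  -- has its class in `V`. On the intersection `F` is computed at the section point, as it depends
  -- only on the class.
  have h1 : IsOpen (U ∩ σ ⁻¹' W) :=
    h.section_contDiffOn.continuousOn.isOpen_inter_preimage h.isOpen hW
  have h2 : IsOpen (Subtype.val '' ((fun u : U => Quotient.mk s (ρ u)) ⁻¹' V)) :=
    h.isOpen.isOpenMap_subtype_val _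
      (hV.preimage (continuous_quotient_mk'.comp h.continuous_section))
  refine ⟨_, G ∘ σ, h1.inter h2, ⟨⟨hu, ?_⟩, ⟨⟨_, hu⟩, ?_, rfl⟩⟩, ?_, ?_⟩
  · have := h.section_coe ⟨_, hu⟩
    simpa [← this] using hyW
  · simpa [hz1] using hzV
  · exact hG.comp (h.section_contDiffOn.mono fun u hu => hu.1.1) fun u hu => hu.1.2
  · rintro z' hz' ⟨⟨hu', hW'⟩, ⟨u, hu1, hu2⟩⟩
    obtain ⟨hu'', hz2⟩ := h.mk_section_coord z' hz'
    have hV' : z' ∈ V := by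
      obtain rfl : u = ⟨_, hu''⟩ := Subtype.ext hu2
      simpa [hz2] using hu1
    refine ⟨hV', ?_⟩
    have h3 := hFG (ρ ⟨_, hu''⟩) (by simpa [hz2] using hV') (by rw [h.section_coe]; exact hW')
    rw [h.section_coe] at h3
    simpa [hz2] using h3

theorem contDiffOn_comp {W : Set (EuclideanSpace ℝ (Fin d))} (hW : IsOpen W)
    {F : EuclideanSpace ℝ (Fin d) → ℝ} (hF : ContDiffOn ℝ ∞ F W) :
    IsOpen (O ∩ k ⁻¹' W) ∧ ContDiffOn ℝ ∞ (F ∘ k) (O ∩ k ⁻¹' W) :=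
  ⟨h.contDiffOn.continuousOn.isOpen_inter_preimage h.isOpen_domain hW,
    hF.comp (h.contDiffOn.mono Set.inter_subset_left) fun _ hx => hx.2⟩

theorem isGlobalChart_restrict :
    IsGlobalChart (((ofEmbedding ι).quotient s).restrict Z) (fun z : Z => h.coord z) := by
  refine ⟨h.isOpenEmbedding_coord, fun V hV f => ⟨fun hf z hz => ?_, fun hf z hz => ?_⟩⟩
  · obtain ⟨V', F, hV', hzV', hF, hfF⟩ := hf z hz
    obtain ⟨W, G, hW, hzW, hG, hFG⟩ := h.exists_contDiffOn hV' hF z.2 hzV'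
    refine ⟨W, G, hW, hzW, hG, fun z' hz' hz'W => ?_⟩
    obtain ⟨h1, h2⟩ := hFG z' z'.2 hz'W
    rw [hfF z' hz' h1, h2]
  · obtain ⟨W, F, hW, hzW, hF, hfF⟩ := hf z hz
    -- By invariance the coordinates are defined on the whole quotient, so a function of the
    -- coordinates extends off `Z`.
    refine ⟨h.coord ⁻¹' W, F ∘ h.coord, hW.preimage h.continuous_coord, hzW, ?_, hfF⟩
    intro y hy
    exact ⟨_, F ∘ k, (h.contDiffOn_comp hW hF).1, ⟨h.mem_domain y, hy⟩,
      (h.contDiffOn_comp hW hF).2, fun y' _ _ => rfl⟩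

end QuotientCoordinates

variable {ι : Y → E} {s : Setoid Y} {d : ℕ} {O : Set E}
  {k : E → EuclideanSpace ℝ (Fin d)} {U : Set (EuclideanSpace ℝ (Fin d))} {ρ : U → Y}
  {σ : EuclideanSpace ℝ (Fin d) → E}

theorem QuotientCoordinates.isGlobalChart
    (h : QuotientCoordinates ι s Set.univ O k U ρ σ) :
    IsGlobalChart ((ofEmbedding ι).quotient s) h.coord := by
  refine ⟨?_, fun V hV f => ⟨fun hf z hz => ?_, fun hf y hy => ?_⟩⟩
  · exact h.isOpenEmbedding_coord.comp (Homeomorph.Set.univ _).symm.isOpenEmbedding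
  · obtain ⟨W, G, hW, hzW, hG, hFG⟩ := h.exists_contDiffOn hV hf (Set.mem_univ z) hz
    exact ⟨W, G, hW, hzW, hG, fun z' _ hz'W => (hFG z' (Set.mem_univ _) hz'W).2⟩
  · obtain ⟨W, F, hW, hzW, hF, hfF⟩ := hf _ hy
    exact ⟨_, F ∘ k, (h.contDiffOn_comp hW hF).1, ⟨h.mem_domain y, hzW⟩,
      (h.contDiffOn_comp hW hF).2, fun y' hy' hy'' => hfF _ hy' hy''.2⟩

theorem QuotientCoordinates.range_coord_univ
    (h : QuotientCoordinates ι s Set.univ O k U ρ σ) : Set.range h.coord = U := by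
  have h1 := h.range_coord
  have h2 : Set.range (fun z : (Set.univ : Set (Quotient s)) => h.coord z) = Set.range h.coord := by
    ext u
    simp
  rw [← h2, h1]

end Quotient

end SmoothFunctions

end

noncomputable section

/-! ## Coordinates -/

section Coordinates

variable {n : ℕ} (S : Finset (Fin n)) (i₀ j₀ : Fin n)

/-- The values of the coordinates: the tuples with `y_{i₀} = y_{j₀}` whose sums over `S` and over
the complement of `S` vanish. -/
def coordSubspace : Submodule ℂ (Fin n → ℂ) where
  carrier := {y | ∑ i ∈ S, y i = 0 ∧ ∑ i ∈ Sᶜ, y i = 0 ∧ y i₀ = y j₀}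
  add_mem' := by
    rintro y z ⟨h1, h2, h3⟩ ⟨h1', h2', h3'⟩
    simp [Finset.sum_add_distrib, h1, h2, h3, h1', h2', h3']
  zero_mem' := by simp
  smul_mem' := by
    rintro c y ⟨h1, h2, h3⟩
    simp [← Finset.mul_sum, h1, h2, h3]

variable {S i₀ j₀}

theorem mem_coordSubspace {y : Fin n → ℂ} : y ∈ coordSubspace S i₀ j₀ ↔
    ∑ i ∈ S, y i = 0 ∧ ∑ i ∈ Sᶜ, y i = 0 ∧ y i₀ = y j₀ := Iff.rfl

/-- The three defining equations are independent as soon as both `S` and its complement have a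
second element. -/
theorem finrank_coordSubspace (hi : i₀ ∈ S) (hj : j₀ ∉ S) (h2 : 2 ≤ S.card) (hn : S.card + 2 ≤ n) :
    Module.finrank ℝ (coordSubspace S i₀ j₀) = 2 * (n - 3) := by
  obtain ⟨i₁, hi₁, hii⟩ := Finset.exists_mem_ne (by omega : 1 < S.card) i₀
  obtain ⟨j₁, hj₁, hjj⟩ := Finset.exists_mem_ne
    (by rw [Finset.card_compl, Fintype.card_fin]; omega : 1 < Sᶜ.card) j₀
  let p : Fin n → (Fin n → ℂ) →ₗ[ℂ] ℂ := LinearMap.proj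
  let f : (Fin n → ℂ) →ₗ[ℂ] (Fin 3 → ℂ) := LinearMap.pi ![∑ i ∈ S, p i, ∑ i ∈ Sᶜ, p i, p i₀ - p j₀]
  have hf : LinearMap.ker f = coordSubspace S i₀ j₀ := by
    ext y
    rw [LinearMap.mem_ker, mem_coordSubspace, funext_iff, Fin.forall_fin_succ, Fin.forall_fin_two]
    simp [f, p, sub_eq_zero]
  have hs : LinearMap.range f = ⊤ := by
    rw [LinearMap.range_eq_top]
    intro v
    -- The entry at `j₀` stays zero, so `i₀` alone produces the difference; `i₁` then corrects the
    -- sum over `S`, and `j₁` gives the other sum.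
    refine ⟨Pi.single i₀ (v 2) + Pi.single i₁ (v 0 - v 2) + Pi.single j₁ (v 1), ?_⟩
    have hj₁' : j₁ ∉ S := by simpa using hj₁
    have e : ∀ a b : Fin n, a ∈ S → b ∉ S → a ≠ b := fun a b ha hb h => hb (h ▸ ha)
    ext k
    fin_cases k
    · simp [f, p, Finset.sum_add_distrib, Finset.sum_pi_single', hi, hi₁, hj₁']
    · simp [f, p, Finset.sum_add_distrib, Finset.sum_pi_single', hi, hi₁, hj₁']
    · simp [f, p, hii.symm, hjj.symm, e i₀ j₁ hi hj₁', (e i₀ j₀ hi hj).symm, (e i₁ j₀ hi₁ hj).symm]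
  have h := f.finrank_range_add_finrank_ker
  rw [hs, hf, finrank_top, Module.finrank_fin_fun, Module.finrank_fin_fun] at h
  rw [finrank_real_of_complex]
  omega

variable (S i₀ j₀) in
/-- Linear coordinates on `coordSubspace`, extended to the space of all tuples. -/
structure LinearCoordinates (d : ℕ) where
  toTuple : EuclideanSpace ℝ (Fin d) →L[ℝ] (Fin n → ℂ)
  ofTuple : (Fin n → ℂ) →L[ℝ] EuclideanSpace ℝ (Fin d)
  ofTuple_toTuple : ∀ v, ofTuple (toTuple v) = v
  toTuple_mem : ∀ v, toTuple v ∈ coordSubspace S i₀ j₀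
  toTuple_ofTuple : ∀ y ∈ coordSubspace S i₀ j₀, toTuple (ofTuple y) = y

theorem nonempty_linearCoordinates (hi : i₀ ∈ S) (hj : j₀ ∉ S) (h2 : 2 ≤ S.card)
    (hn : S.card + 2 ≤ n) : Nonempty (LinearCoordinates S i₀ j₀ (2 * (n - 3))) := by
  have e : EuclideanSpace ℝ (Fin (2 * (n - 3))) ≃ₗ[ℝ] coordSubspace S i₀ j₀ :=
    LinearEquiv.ofFinrankEq _ _
      (by rw [finrank_coordSubspace hi hj h2 hn, finrank_euclideanSpace_fin])
  let J : EuclideanSpace ℝ (Fin (2 * (n - 3))) →ₗ[ℝ] (Fin n → ℂ) :=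
    ((coordSubspace S i₀ j₀).subtype.restrictScalars ℝ) ∘ₗ e.toLinearMap
  have hJ : Function.Injective J := Subtype.val_injective.comp e.injective
  -- A linear left inverse extends the coordinates to all tuples, which smoothness on the ambient
  -- space requires.
  obtain ⟨L, hL⟩ := J.exists_leftInverse_of_injective (LinearMap.ker_eq_bot.2 hJ)
  have hLJ : ∀ v, L (J v) = v := fun v => LinearMap.congr_fun hL v
  refine ⟨J.toContinuousLinearMap, L.toContinuousLinearMap, hLJ, fun v => (e v).2, fun y hy => ?_⟩
  have : J (e.symm ⟨y, hy⟩) = y := by simp [J]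
  change J (L y) = y
  rw [← this, hLJ]

namespace LinearCoordinates

variable {d : ℕ} (c : LinearCoordinates S i₀ j₀ d)

/-- The coordinates of the tuples without zero entries. -/
def domain : Set (EuclideanSpace ℝ (Fin d)) := {v | ∀ i, c.toTuple v i ≠ 0}

theorem isOpen_domain : IsOpen c.domain := by
  have : c.domain = ⋂ i, {v | c.toTuple v i ≠ 0} := by
    ext v
    simp [domain]
  rw [this]
  exact isOpen_iInter_of_finite fun i => isOpen_ne_fun
    ((continuous_apply i).comp c.toTuple.continuous) continuous_const

theorem toTuple_eq (v : EuclideanSpace ℝ (Fin d)) : c.toTuple v i₀ = c.toTuple v j₀ :=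
  (c.toTuple_mem v).2.2

end LinearCoordinates

/-- The coordinates of a tuple of matrices. -/
def traceCoord (S : Finset (Fin n)) (i₀ j₀ : Fin n) (N : Fin n → Fin 2 → Fin 2 → ℂ) (i : Fin n) :
    ℂ :=
  Matrix.trace ((Matrix.of (N i)) * Matrix.of (N (if i ∈ S then j₀ else i₀)))

/-- The coordinates of the off-diagonal matrices with entries `w_i`. -/
def pairCoord (S : Finset (Fin n)) (i₀ j₀ : Fin n) (w : Fin n → ℂ) (i : Fin n) : ℂ :=
  w i * w (if i ∈ S then j₀ else i₀)

/-- Strictly upper triangular matrices for `i ∈ S` and strictly lower triangular ones for the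
other `i`. -/
def offDiag (S : Finset (Fin n)) (w : Fin n → ℂ) (i : Fin n) : Matrix (Fin 2) (Fin 2) ℂ :=
  if i ∈ S then !![0, w i; 0, 0] else !![0, 0; w i, 0]

theorem sum_offDiag (w : Fin n → ℂ) :
    ∑ i, offDiag S w i = !![0, ∑ i ∈ S, w i; ∑ i ∈ Sᶜ, w i, 0] := by
  rw [← Finset.sum_add_sum_compl S]
  have h1 : ∑ i ∈ S, offDiag S w i = ∑ i ∈ S, !![0, w i; 0, 0] :=
    Finset.sum_congr rfl fun i hi => if_pos hi
  have h2 : ∑ i ∈ Sᶜ, offDiag S w i = ∑ i ∈ Sᶜ, !![0, 0; w i, 0] :=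
    Finset.sum_congr rfl fun i hi => if_neg (Finset.mem_compl.1 hi)
  rw [h1, h2]
  ext j k
  rw [Matrix.add_apply, Matrix.sum_apply, Matrix.sum_apply]
  fin_cases j <;> fin_cases k <;> simp

/-- A strictly upper times a strictly lower triangular matrix has the product of the two entries as
its trace. This is why each index is paired with one on the other side of `S`. -/
theorem traceCoord_offDiag (hi : i₀ ∈ S) (hj : j₀ ∉ S) (w : Fin n → ℂ) :
    traceCoord S i₀ j₀ (fun i => offDiag S w i) = pairCoord S i₀ j₀ w := by
  ext i
  change Matrix.trace (offDiag S w i * offDiag S w _) = _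
  by_cases h : i ∈ S
  · simp [pairCoord, offDiag, h, hj, Matrix.trace_fin_two]
  · simp [pairCoord, offDiag, h, hi, Matrix.trace_fin_two]

theorem traceCoord_conj (N : Fin n → Matrix (Fin 2) (Fin 2) ℂ) (A B : Matrix (Fin 2) (Fin 2) ℂ)
    (h : B * A = 1) :
    traceCoord S i₀ j₀ (fun i => A * N i * B) = traceCoord S i₀ j₀ (fun i => N i) := by
  ext i
  change Matrix.trace ((A * N i * B) * (A * N _ * B)) = Matrix.trace (N i * N _)
  rw [show ∀ X Y : Matrix (Fin 2) (Fin 2) ℂ, (A * X * B) * (A * Y * B) = A * (X * (B * A) * Y * B)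
    from fun X Y => by simp only [mul_assoc], h, mul_one, Matrix.trace_mul_comm,
    mul_assoc, h, mul_one]

theorem contDiff_traceCoord : ContDiff ℝ ∞ (traceCoord S i₀ j₀) := by
  rw [contDiff_pi]
  intro i
  simp only [traceCoord, Matrix.trace_fin_two, Matrix.mul_apply, Fin.sum_univ_two, Matrix.of_apply]
  fun_prop

/-- All coordinates on one side of `S` share a common factor, so their sum is a multiple of the sum
of the entries; the coordinates at i₀ and j₀ are both w_{i₀} w_{j₀}. -/
theorem pairCoord_mem (hi : i₀ ∈ S) (hj : j₀ ∉ S) {w : Fin n → ℂ} (h1 : ∑ i ∈ S, w i = 0)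
    (h2 : ∑ i ∈ Sᶜ, w i = 0) : pairCoord S i₀ j₀ w ∈ coordSubspace S i₀ j₀ := by
  refine ⟨?_, ?_, by simp [pairCoord, hi, hj, mul_comm]⟩
  · rw [← zero_mul (w j₀), ← h1, Finset.sum_mul]
    exact Finset.sum_congr rfl fun i hi => by simp [pairCoord, hi]
  · rw [← zero_mul (w i₀), ← h2, Finset.sum_mul]
    exact Finset.sum_congr rfl fun i hi => by simp [pairCoord, Finset.mem_compl.1 hi]

theorem pairCoord_ne_zero {w : Fin n → ℂ} (hw : ∀ i, w i ≠ 0) (i : Fin n) :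
    pairCoord S i₀ j₀ w i ≠ 0 := mul_ne_zero (hw _) (hw _)

/-! ### A smooth normalized section of the invariants. -/

/-- The absolute value of the `i₀`-th entry of the off-diagonal matrices that have coordinates `y`
and satisfy the normalization `∑_{i ∈ S} |w_i| = ∑_{i ∉ S} |w_i|`. -/
def sliceScale (S : Finset (Fin n)) (i₀ : Fin n) (y : Fin n → ℂ) : ℝ :=
  Real.sqrt ((∑ i ∈ Sᶜ, ‖y i‖) * ‖y i₀‖ / ∑ i ∈ S, ‖y i‖)

/-- The normalized entries with coordinates `y`. -/
def slice (S : Finset (Fin n)) (i₀ : Fin n) (y : Fin n → ℂ) (i : Fin n) : ℂ :=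
  if i ∈ S then sliceScale S i₀ y * y i / y i₀ else y i / sliceScale S i₀ y

section Slice

variable {y : Fin n → ℂ} (hy : ∀ i, y i ≠ 0)

include hy

theorem sum_norm_pos {T : Finset (Fin n)} {i : Fin n} (hi : i ∈ T) : 0 < ∑ i ∈ T, ‖y i‖ :=
  Finset.sum_pos (fun i _ => norm_pos_iff.2 (hy i)) ⟨i, hi⟩

theorem sliceScale_radicand_pos (hi : i₀ ∈ S) (hj : j₀ ∉ S) :
    0 < (∑ i ∈ Sᶜ, ‖y i‖) * ‖y i₀‖ / ∑ i ∈ S, ‖y i‖ :=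
  div_pos (mul_pos (sum_norm_pos hy (Finset.mem_compl.2 hj)) (norm_pos_iff.2 (hy _)))
    (sum_norm_pos hy hi)

theorem sliceScale_pos (hi : i₀ ∈ S) (hj : j₀ ∉ S) : 0 < sliceScale S i₀ y :=
  Real.sqrt_pos.2 (sliceScale_radicand_pos hy hi hj)

theorem slice_ne_zero (hi : i₀ ∈ S) (hj : j₀ ∉ S) (i : Fin n) : slice S i₀ y i ≠ 0 := by
  have h : ((sliceScale S i₀ y : ℝ) : ℂ) ≠ 0 := by exact_mod_cast (sliceScale_pos hy hi hj).ne'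
  unfold slice
  split_ifs
  · exact div_ne_zero (mul_ne_zero h (hy i)) (hy _)
  · exact div_ne_zero (hy i) h

/-- The slice has the entry r at i₀ and y_{j₀} / r = y_{i₀} / r at j₀, where r is the scale, so r
cancels in every product across `S`. -/
theorem pairCoord_slice (hi : i₀ ∈ S) (hj : j₀ ∉ S) (h : y i₀ = y j₀) :
    pairCoord S i₀ j₀ (slice S i₀ y) = y := by
  have hs : ((sliceScale S i₀ y : ℝ) : ℂ) ≠ 0 := by exact_mod_cast (sliceScale_pos hy hi hj).ne'
  have h0 := hy i₀
  ext i
  by_cases hS : i ∈ S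
  · simp only [pairCoord, slice, hS, hj, if_true, if_false, ← h]
    field_simp
  · simp only [pairCoord, slice, hS, hi, if_true, if_false]
    field_simp

theorem contDiffAt_sliceScale (hi : i₀ ∈ S) (hj : j₀ ∉ S) : ContDiffAt ℝ ∞ (sliceScale S i₀) y := by
  have h : ∀ i, ContDiffAt ℝ ∞ (fun y : Fin n → ℂ => ‖y i‖) y := fun i =>
    ((contDiff_apply ℝ ℂ i).contDiffAt).norm ℝ (hy i)
  refine ContDiffAt.sqrt ?_ (sliceScale_radicand_pos hy hi hj).ne'
  exact (((ContDiffAt.sum fun i _ => h i).mul (h i₀)).div (ContDiffAt.sum fun i _ => h i)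
    (sum_norm_pos hy hi).ne')

theorem contDiffAt_slice (hi : i₀ ∈ S) (hj : j₀ ∉ S) : ContDiffAt ℝ ∞ (slice S i₀) y := by
  have hs : ((sliceScale S i₀ y : ℝ) : ℂ) ≠ 0 := by exact_mod_cast (sliceScale_pos hy hi hj).ne'
  have h1 : ContDiffAt ℝ ∞ (fun y => ((sliceScale S i₀ y : ℝ) : ℂ)) y :=
    Complex.ofRealCLM.contDiff.contDiffAt.comp y (contDiffAt_sliceScale hy hi hj)
  have h2 : ∀ i, ContDiffAt ℝ ∞ (fun y : Fin n → ℂ => y i) y := fun i =>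
    (contDiff_apply ℝ ℂ i).contDiffAt
  rw [contDiffAt_pi]
  intro i
  unfold slice
  split_ifs
  · simp only [div_eq_mul_inv]
    exact (h1.mul (h2 i)).mul ((h2 i₀).inv (hy i₀))
  · simp only [div_eq_mul_inv]
    exact (h2 i).mul (h1.inv hs)

/-- With A and B the sums of |y_i| over `S` and its complement and r the scale, the two sides are r
A / |y_{i₀}| and B / r. They agree exactly when r² = B |y_{i₀}| / A, which is the radicand in
`sliceScale`. -/
theorem sum_norm_slice (hi : i₀ ∈ S) (hj : j₀ ∉ S) :
    ∑ i ∈ S, ‖slice S i₀ y i‖ = ∑ i ∈ Sᶜ, ‖slice S i₀ y i‖ := by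
  have hs := sliceScale_pos hy hi hj
  have h0 := norm_pos_iff.2 (hy i₀)
  have h1 : ∑ i ∈ S, ‖slice S i₀ y i‖ = sliceScale S i₀ y / ‖y i₀‖ * ∑ i ∈ S, ‖y i‖ := by
    rw [Finset.mul_sum]
    refine Finset.sum_congr rfl fun i hi => ?_
    simp only [slice, hi, if_true, norm_div, norm_mul, Complex.norm_real, Real.norm_eq_abs,
      abs_of_pos hs]
    ring
  have h2 : ∑ i ∈ Sᶜ, ‖slice S i₀ y i‖ = (∑ i ∈ Sᶜ, ‖y i‖) / sliceScale S i₀ y := by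
    rw [Finset.sum_div]
    refine Finset.sum_congr rfl fun i hi => ?_
    simp only [slice, Finset.mem_compl.1 hi, if_false, norm_div, Complex.norm_real,
      Real.norm_eq_abs, abs_of_pos hs]
  have h3 : sliceScale S i₀ y ^ 2 = _ := Real.sq_sqrt (sliceScale_radicand_pos hy hi hj).le
  have h4 := sum_norm_pos hy hi
  rw [h1, h2, eq_div_iff hs.ne']
  rw [eq_div_iff h4.ne'] at h3
  field_simp
  linarith

omit hy in
theorem sum_slice (h1 : ∑ i ∈ S, y i = 0) : ∑ i ∈ S, slice S i₀ y i = 0 := by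
  rw [← mul_zero (((sliceScale S i₀ y : ℝ) : ℂ) / y i₀), ← h1, Finset.mul_sum]
  exact Finset.sum_congr rfl fun i hi => by simp only [slice, hi, if_true]; ring

omit hy in
theorem sum_compl_slice (h1 : ∑ i ∈ Sᶜ, y i = 0) : ∑ i ∈ Sᶜ, slice S i₀ y i = 0 := by
  rw [← zero_div (((sliceScale S i₀ y : ℝ) : ℂ)), ← h1, Finset.sum_div]
  exact Finset.sum_congr rfl fun i hi => by simp only [slice, Finset.mem_compl.1 hi, if_false]

end Slice

/-- Entries with the same coordinates are related by the action of the diagonal matrices. -/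
theorem exists_slice_pairCoord (hi : i₀ ∈ S) (hj : j₀ ∉ S) {w : Fin n → ℂ} (hw : ∀ i, w i ≠ 0) :
    ∃ c : ℂ, c ≠ 0 ∧ (∀ i ∈ S, slice S i₀ (pairCoord S i₀ j₀ w) i = c * w i) ∧
      (∀ i ∉ S, slice S i₀ (pairCoord S i₀ j₀ w) i = c⁻¹ * w i) ∧
      (∑ i ∈ S, ‖w i‖ = ∑ i ∈ Sᶜ, ‖w i‖ → ‖c‖ = 1) := by
  have hy := pairCoord_ne_zero (S := S) (i₀ := i₀) (j₀ := j₀) hw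
  have hs := sliceScale_pos hy hi hj
  have hs' : ((sliceScale S i₀ (pairCoord S i₀ j₀ w) : ℝ) : ℂ) ≠ 0 := by exact_mod_cast hs.ne'
  -- The slice has the scale as its entry at i₀, which forces this factor. For normalized entries
  -- the scale is |w_{i₀}|, so the factor has absolute value one.
  refine ⟨sliceScale S i₀ (pairCoord S i₀ j₀ w) / w i₀, div_ne_zero hs' (hw _),
    fun i h => ?_, fun i h => ?_, fun h => ?_⟩
  · have := hw i₀
    have := hw j₀
    simp only [slice, h, if_true]
    simp only [pairCoord, h, hi, if_true]
    field_simp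
  · simp only [slice, h, if_false]
    rw [inv_div]
    simp only [pairCoord, h, if_false]
    ring
  · have h1 : ∑ i ∈ S, ‖pairCoord S i₀ j₀ w i‖ = (∑ i ∈ S, ‖w i‖) * ‖w j₀‖ := by
      rw [Finset.sum_mul]
      exact Finset.sum_congr rfl fun i hi => by simp [pairCoord, hi]
    have h2 : ∑ i ∈ Sᶜ, ‖pairCoord S i₀ j₀ w i‖ = (∑ i ∈ Sᶜ, ‖w i‖) * ‖w i₀‖ := by
      rw [Finset.sum_mul]
      exact Finset.sum_congr rfl fun i hi => by simp [pairCoord, Finset.mem_compl.1 hi]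
    have h3 : sliceScale S i₀ (pairCoord S i₀ j₀ w) = ‖w i₀‖ := by
      have := norm_pos_iff.2 (hw j₀)
      have := sum_norm_pos hw (Finset.mem_compl.2 hj)
      rw [sliceScale, h1, h2, h, Real.sqrt_eq_iff_mul_self_eq (by positivity) (norm_nonneg _)]
      simp only [pairCoord, hi, if_true, norm_mul]
      field_simp
    rw [norm_div, Complex.norm_real, Real.norm_eq_abs, abs_of_pos hs, h3,
      div_self (norm_ne_zero_iff.2 (hw _))]

/-- There are coordinates without zero entries. -/
theorem exists_mem_coordSubspace_ne_zero (hi : i₀ ∈ S) (hj : j₀ ∉ S) (h2 : 2 ≤ S.card)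
    (hn : S.card + 2 ≤ n) : ∃ y ∈ coordSubspace S i₀ j₀, ∀ i, y i ≠ 0 := by
  have key : ∀ (T : Finset (Fin n)) (k : Fin n), k ∈ T → 2 ≤ T.card →
      ∃ y : Fin n → ℂ, ∑ i ∈ T, y i = 0 ∧ y k = 1 ∧ ∀ i, y i ≠ 0 := by
    intro T k hk hT
    obtain ⟨l, hl, hlk⟩ := Finset.exists_mem_ne (by omega : 1 < T.card) k
    -- All entries are one except that at `l`, which cancels the others and is nonzero since `T` has
    -- at least two elements. As `l ≠ k`, the entry at `k` stays one; this later makes the entries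
    -- at i₀ and j₀ equal.
    refine ⟨Function.update (fun _ => 1) l (-((T.card - 1 : ℕ) : ℂ)), ?_, by simp [hlk.symm],
      fun i => ?_⟩
    · rw [Finset.sum_update_of_mem hl, Finset.sum_const, Finset.card_sdiff_of_subset (by simpa)]
      simp
    · rcases eq_or_ne i l with rfl | h
      · rw [Function.update_self, neg_ne_zero, Nat.cast_ne_zero]
        omega
      · simp [h]
  obtain ⟨y, hy1, hy2, hy3⟩ := key S i₀ hi h2
  obtain ⟨z, hz1, hz2, hz3⟩ := key Sᶜ j₀ (Finset.mem_compl.2 hj)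
    (by rw [Finset.card_compl, Fintype.card_fin]; omega)
  refine ⟨fun i => if i ∈ S then y i else z i, ⟨?_, ?_, by simp [hi, hj, hy2, hz2]⟩, fun i => ?_⟩
  · rw [← hy1]
    exact Finset.sum_congr rfl fun i hi => by simp [hi]
  · rw [← hz1]
    exact Finset.sum_congr rfl fun i hi => by simp [Finset.mem_compl.1 hi]
  · dsimp only
    split_ifs
    exacts [hy3 i, hz3 i]

namespace LinearCoordinates

variable {d : ℕ} (c : LinearCoordinates S i₀ j₀ d)

theorem nonempty_domain (hi : i₀ ∈ S) (hj : j₀ ∉ S) (h2 : 2 ≤ S.card) (hn : S.card + 2 ≤ n) :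
    c.domain.Nonempty := by
  obtain ⟨y, hy, h0⟩ := exists_mem_coordSubspace_ne_zero hi hj h2 hn
  refine ⟨c.ofTuple y, fun i => ?_⟩
  rw [c.toTuple_ofTuple y hy]
  exact h0 i

/-- The normalized entries with given coordinates. -/
def entries (v : EuclideanSpace ℝ (Fin d)) : Fin n → ℂ := slice S i₀ (c.toTuple v)

theorem contDiffOn_entries (hi : i₀ ∈ S) (hj : j₀ ∉ S) : ContDiffOn ℝ ∞ c.entries c.domain :=
  fun v hv => ((contDiffAt_slice (y := c.toTuple v) hv hi hj).comp v
    c.toTuple.contDiff.contDiffAt).contDiffWithinAt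

theorem entries_ne_zero (hi : i₀ ∈ S) (hj : j₀ ∉ S) {v : EuclideanSpace ℝ (Fin d)}
    (hv : v ∈ c.domain) (i : Fin n) : c.entries v i ≠ 0 := slice_ne_zero hv hi hj i

theorem sum_entries (v : EuclideanSpace ℝ (Fin d)) : ∑ i ∈ S, c.entries v i = 0 :=
  sum_slice (c.toTuple_mem v).1

theorem sum_compl_entries (v : EuclideanSpace ℝ (Fin d)) : ∑ i ∈ Sᶜ, c.entries v i = 0 :=
  sum_compl_slice (c.toTuple_mem v).2.1

theorem sum_norm_entries (hi : i₀ ∈ S) (hj : j₀ ∉ S) {v : EuclideanSpace ℝ (Fin d)}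
    (hv : v ∈ c.domain) : ∑ i ∈ S, ‖c.entries v i‖ = ∑ i ∈ Sᶜ, ‖c.entries v i‖ :=
  sum_norm_slice hv hi hj

theorem ofTuple_pairCoord_entries (hi : i₀ ∈ S) (hj : j₀ ∉ S) {v : EuclideanSpace ℝ (Fin d)}
    (hv : v ∈ c.domain) : c.ofTuple (pairCoord S i₀ j₀ (c.entries v)) = v := by
  rw [entries, pairCoord_slice hv hi hj (c.toTuple_eq v), c.ofTuple_toTuple]

/-- The coordinates of nonzero entries lie in the domain, and determine the entries up to the
action of the diagonal matrices. -/
theorem exists_entries_eq (hi : i₀ ∈ S) (hj : j₀ ∉ S) {w : Fin n → ℂ} (hw : ∀ i, w i ≠ 0)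
    (h1 : ∑ i ∈ S, w i = 0) (h2 : ∑ i ∈ Sᶜ, w i = 0) :
    c.ofTuple (pairCoord S i₀ j₀ w) ∈ c.domain ∧ ∃ l : ℂ, l ≠ 0 ∧
      (∀ i ∈ S, c.entries (c.ofTuple (pairCoord S i₀ j₀ w)) i = l ^ 2 * w i) ∧
      (∀ i ∉ S, c.entries (c.ofTuple (pairCoord S i₀ j₀ w)) i = (l ^ 2)⁻¹ * w i) ∧
      (∑ i ∈ S, ‖w i‖ = ∑ i ∈ Sᶜ, ‖w i‖ → ‖l‖ = 1) := by
  have h := c.toTuple_ofTuple _ (pairCoord_mem hi hj h1 h2)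
  obtain ⟨k, hk, hk1, hk2, hk3⟩ := exists_slice_pairCoord hi hj hw
  -- A square root is needed because conjugation by diag(l, l⁻¹) scales the off-diagonal entries by
  -- l² and l⁻².
  obtain ⟨l, rfl⟩ := IsSquare.exists_sq k (IsAlgClosed.exists_eq_mul_self k)
  refine ⟨fun i => ?_, l, fun hl => hk (by simp [hl]), fun i hi => ?_, fun i hi => ?_, fun h => ?_⟩
  · rw [h]
    exact pairCoord_ne_zero hw i
  · rw [entries, h, hk1 i hi]
  · rw [entries, h, hk2 i hi]
  · have := hk3 h
    rw [norm_pow] at this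
    exact (pow_eq_one_iff_of_nonneg (norm_nonneg _) two_ne_zero).1 this

end LinearCoordinates

end Coordinates

end

noncomputable section

/-! ## Meromorphic functions on the sphere -/

section Sphere

open Filter

theorem sphereCoord_coe (a t : ℂ) :
    sphereCoord (a : RiemannSphere) t = ((a + t : ℂ) : RiemannSphere) :=
  rfl

theorem sphereCoord_infty_zero : sphereCoord OnePoint.infty 0 = OnePoint.infty := if_pos rfl

theorem sphereCoord_infty {t : ℂ} (ht : t ≠ 0) :
    sphereCoord OnePoint.infty t = ((t⁻¹ : ℂ) : RiemannSphere) := if_neg ht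

theorem sphereCoord_zero (y : RiemannSphere) : sphereCoord y 0 = y := by
  induction y using OnePoint.rec with
  | infty => exact sphereCoord_infty_zero
  | coe a => rw [sphereCoord_coe, add_zero]

theorem analyticAt_comp_coe {F : Type*} [NormedAddCommGroup F] [NormedSpace ℂ F]
    {s : RiemannSphere → F} {a : ℂ}
    (hs : AnalyticAt ℂ (fun t => s (sphereCoord (a : RiemannSphere) t)) 0) :
    AnalyticAt ℂ (fun z : ℂ => s z) a := by
  have h : AnalyticAt ℂ (fun z => z - a) a := analyticAt_id.sub analyticAt_const
  have h1 := AnalyticAt.comp_of_eq hs h (sub_self a)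
  simpa [Function.comp_def, sphereCoord_coe] using h1

theorem tendsto_inv_cocompact : Tendsto (fun z : ℂ => z⁻¹) (cocompact ℂ) (𝓝[≠] 0) := by
  rw [← Metric.cobounded_eq_cocompact]
  exact tendsto_inv₀_cobounded'

/-- Holomorphic functions on the sphere are constant. -/
theorem eq_infty_of_analytic_sphere {s : RiemannSphere → ℂ}
    (hs : ∀ y, AnalyticAt ℂ (fun t => s (sphereCoord y t)) 0) (y : RiemannSphere) :
    s y = s OnePoint.infty := by
  have hd : Differentiable ℂ (fun z : ℂ => s z) := fun a =>
    (analyticAt_comp_coe (hs a)).differentiableAt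
  have h1 : Tendsto (fun t => s (sphereCoord OnePoint.infty t)) (𝓝[≠] 0)
      (𝓝 (s OnePoint.infty)) := by
    have := (hs OnePoint.infty).continuousAt.tendsto
    rw [sphereCoord_infty_zero] at this
    exact this.mono_left nhdsWithin_le_nhds
  have h2 : Tendsto (fun z : ℂ => s z) (cocompact ℂ) (𝓝 (s OnePoint.infty)) := by
    refine (h1.comp tendsto_inv_cocompact).congr' ?_
    filter_upwards [tendsto_inv_cocompact.eventually self_mem_nhdsWithin] with z hz
    simp [sphereCoord_infty hz]
  induction y using OnePoint.rec with
  | infty => rfl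
  | coe a => exact hd.apply_eq_of_tendsto_cocompact a h2

/-- A function with removable singularities that tends to zero at infinity vanishes. -/
theorem eq_zero_of_removable {F : Set ℂ} (hF : F.Finite) {g : ℂ → ℂ}
    (hg : ∀ a ∉ F, AnalyticAt ℂ g a)
    (hr : ∀ a ∈ F, ∃ h : ℂ → ℂ, AnalyticAt ℂ h a ∧ ∀ᶠ z in 𝓝[≠] a, g z = h z)
    (h0 : Tendsto g (cocompact ℂ) (𝓝 0)) {a : ℂ} (ha : a ∉ F) : g a = 0 := by
  have hall : ∀ a, ∃ h : ℂ → ℂ, AnalyticAt ℂ h a ∧ ∀ᶠ z in 𝓝[≠] a, g z = h z := fun a => by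
    by_cases h : a ∈ F
    · exact hr a h
    · exact ⟨g, hg a h, .of_forall fun _ => rfl⟩
  -- Taking limits fills in the removable singularities; the resulting entire function tends to zero
  -- at infinity, so Liouville's theorem applies.
  let G : ℂ → ℂ := fun a => limUnder (𝓝[≠] a) g
  have hlim : ∀ a c, Tendsto g (𝓝[≠] a) (𝓝 c) → G a = c := fun a c h => h.limUnder_eq
  have hGg : ∀ a ∉ F, G a = g a := fun a ha =>
    hlim a _ ((hg a ha).continuousAt.tendsto.mono_left nhdsWithin_le_nhds)
  have hG : Differentiable ℂ G := by
    intro a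
    obtain ⟨h, hh, he⟩ := hall a
    refine (hh.congr ?_).differentiableAt
    have h1 : ∀ᶠ z in 𝓝[≠] a, z ∉ F := by
      have : (F \ {a})ᶜ ∈ 𝓝 a :=
        (hF.subset Set.sdiff_subset).isClosed.isOpen_compl.mem_nhds (by simp)
      filter_upwards [mem_nhdsWithin_of_mem_nhds this, self_mem_nhdsWithin] with z hz hz' hzF
      exact hz ⟨hzF, hz'⟩
    have h2 : ∀ᶠ z in 𝓝[≠] a, h z = G z := by
      filter_upwards [h1, he] with z hz hz'
      rw [hGg z hz, hz']
    rw [Filter.EventuallyEq]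
    have h3 : h a = G a := (hlim a _ ((hh.continuousAt.tendsto.mono_left nhdsWithin_le_nhds).congr'
      (he.mono fun z hz => hz.symm))).symm
    rw [eventually_nhdsWithin_iff] at h2
    filter_upwards [h2] with z hz
    rcases eq_or_ne z a with rfl | hza
    exacts [h3, hz hza]
  have hG0 : Tendsto G (cocompact ℂ) (𝓝 0) := by
    refine h0.congr' ?_
    filter_upwards [hF.isCompact.compl_mem_cocompact] with z hz
    exact (hGg z hz).symm
  rw [← hGg a ha]
  exact hG.apply_eq_of_tendsto_cocompact a hG0

/-- The coefficient of `dz` in the one-form with residue one at `y` (and at infinity). -/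
def poleCoeff (y : RiemannSphere) (z : ℂ) : ℂ :=
  match y with
  | OnePoint.some a => (z - a)⁻¹
  | OnePoint.infty => 0

theorem poleCoeff_coe (a z : ℂ) : poleCoeff (a : RiemannSphere) z = (z - a)⁻¹ := rfl

theorem analyticAt_poleCoeff {y : RiemannSphere} {a : ℂ} (h : y ≠ a) :
    AnalyticAt ℂ (poleCoeff y) a := by
  induction y using OnePoint.rec with
  | infty => exact analyticAt_const
  | coe b =>
    exact (analyticAt_id.sub analyticAt_const).inv (sub_ne_zero.2 fun (e : a = b) => h (by rw [e]))

/-- `poleCoeff y (1 / t) / t`, extended to `t = 0`. -/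
def poleCoeffInfty (y : RiemannSphere) (t : ℂ) : ℂ :=
  match y with
  | OnePoint.some a => (1 - a * t)⁻¹
  | OnePoint.infty => 0

theorem poleCoeff_inv (y : RiemannSphere) {t : ℂ} (ht : t ≠ 0) :
    poleCoeff y t⁻¹ = t * poleCoeffInfty y t := by
  induction y using OnePoint.rec with
  | infty => simp [poleCoeff, poleCoeffInfty]
  | coe a =>
    rw [poleCoeff_coe]
    simp only [poleCoeffInfty]
    rw [← inv_inj, mul_inv, inv_inv, inv_inv, mul_sub, mul_one, mul_left_comm, inv_mul_cancel₀ ht,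
      mul_one]

theorem analyticAt_poleCoeffInfty (y : RiemannSphere) : AnalyticAt ℂ (poleCoeffInfty y) 0 := by
  induction y using OnePoint.rec with
  | infty => exact analyticAt_const
  | coe a =>
    exact (analyticAt_const.sub (analyticAt_const.mul analyticAt_id)).inv (by simp)

-- Up to sign these values are the residues at infinity: with t = 1 / z, the form `poleCoeff y` dz
-- becomes -`poleCoeffInfty y` dt / t.
open Classical in
theorem poleCoeffInfty_zero (y : RiemannSphere) :
    poleCoeffInfty y 0 = if y = OnePoint.infty then 0 else 1 := by
  induction y using OnePoint.rec with
  | infty => simp [poleCoeffInfty]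
  | coe a => simp [poleCoeffInfty]

open Classical in
/-- Partial fractions and the residue theorem for one-forms `f dz` with simple poles. -/
theorem eq_sum_poleCoeff {n : ℕ} {x : Fin n → RiemannSphere} (hx : Function.Injective x)
    {f : ℂ → ℂ} {r : Fin n → ℂ}
    (hf : ∀ a : ℂ, (a : RiemannSphere) ∉ Set.range x → AnalyticAt ℂ f a)
    (hp : ∀ (i : Fin n) (a : ℂ), x i = a → ∃ h : ℂ → ℂ, AnalyticAt ℂ h 0 ∧ h 0 = r i ∧
      ∀ᶠ t in 𝓝[≠] (0 : ℂ), t * f (a + t) = h t)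
    (hinf : ∃ h : ℂ → ℂ, AnalyticAt ℂ h 0 ∧ h 0 = ∑ i, (if x i = OnePoint.infty then r i else 0) ∧
      ∀ᶠ t in 𝓝[≠] (0 : ℂ), f t⁻¹ = -(t * h t)) :
    (∀ a : ℂ, (a : RiemannSphere) ∉ Set.range x → f a = ∑ i, poleCoeff (x i) a * r i) ∧
      ∑ i, r i = 0 := by
  obtain ⟨h, hh, hh0, hfh⟩ := hinf
  have hF : {a : ℂ | (a : RiemannSphere) ∈ Set.range x}.Finite :=
    (Set.finite_range x).preimage OnePoint.coe_injective.injOn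
  have hlim : ∀ k : ℂ → ℂ, AnalyticAt ℂ k 0 → Tendsto (fun t => t * k t) (𝓝[≠] 0) (𝓝 0) := by
    intro k hk
    have : Tendsto (fun t => t * k t) (𝓝 0) (𝓝 (0 * k 0)) :=
      (continuousAt_id.mul hk.continuousAt).tendsto
    rw [zero_mul] at this
    exact this.mono_left nhdsWithin_le_nhds
  have key : ∀ a : ℂ, (a : RiemannSphere) ∉ Set.range x → f a = ∑ i, poleCoeff (x i) a * r i := by
    intro a ha
    rw [← sub_eq_zero]
    refine eq_zero_of_removable (g := fun z => f z - ∑ i, poleCoeff (x i) z * r i) hF ?_ ?_ ?_ ha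
    · intro b hb
      exact (hf b hb).sub (Finset.analyticAt_fun_sum _ fun i _ =>
        (analyticAt_poleCoeff fun e => hb ⟨i, e⟩).mul analyticAt_const)
    · rintro b ⟨i, hi⟩
      obtain ⟨k, hk, hk0, hkf⟩ := hp i b hi
      -- The divided difference (k(t) - k(0)) / t at t = z - b is `f` minus its polar part at `b`.
      have hd : AnalyticAt ℂ (fun z => dslope k 0 (z - b)) b := by
        obtain ⟨p, hpk⟩ := hk
        have hd : AnalyticAt ℂ (dslope k 0) 0 := ⟨_, hpk.has_fpower_series_dslope_fslope⟩
        exact AnalyticAt.comp_of_eq (f := fun z => z - b) hd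
          (analyticAt_id.sub analyticAt_const) (sub_self b)
      refine ⟨fun z => dslope k 0 (z - b) - ∑ j ∈ Finset.univ.erase i, poleCoeff (x j) z * r j,
        hd.sub (Finset.analyticAt_fun_sum _ fun j hj => (analyticAt_poleCoeff fun e =>
          Finset.ne_of_mem_erase hj (hx (e.trans hi.symm))).mul analyticAt_const), ?_⟩
      have ht : Tendsto (fun z => z - b) (𝓝[≠] b) (𝓝[≠] 0) := by
        refine tendsto_nhdsWithin_of_tendsto_nhds_of_eventually_within _ ?_ ?_
        · have : ContinuousAt (fun z => z - b) b := by fun_prop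
          simpa using this.tendsto.mono_left nhdsWithin_le_nhds
        · filter_upwards [self_mem_nhdsWithin] with z hz
          exact sub_ne_zero.2 hz
      filter_upwards [ht.eventually hkf, self_mem_nhdsWithin] with z hz hzb
      have hzb' : z - b ≠ 0 := sub_ne_zero.2 hzb
      rw [← Finset.add_sum_erase _ _ (Finset.mem_univ i), hi, poleCoeff_coe, ← sub_sub,
        dslope_of_ne _ hzb', slope_def_field, hk0, ← hz]
      congr 1
      rw [add_sub_cancel, sub_zero]
      field_simp
    -- In t = 1 / z, both `f` and the sum are t times a function analytic at zero, so the difference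
    -- vanishes at infinity.
    · have h1 : Tendsto (fun t => f t⁻¹ - ∑ i, poleCoeff (x i) t⁻¹ * r i) (𝓝[≠] 0) (𝓝 0) := by
        have h2 := ((hlim h hh).neg).sub (tendsto_finsetSum Finset.univ fun i _ =>
          (hlim _ (analyticAt_poleCoeffInfty (x i))).mul_const (r i))
        simp only [neg_zero, zero_mul, Finset.sum_const_zero, sub_zero] at h2
        refine h2.congr' ?_
        filter_upwards [hfh, self_mem_nhdsWithin] with t ht ht0
        rw [ht]
        simp only [poleCoeff_inv _ ht0]
      refine (h1.comp tendsto_inv_cocompact).congr fun z => ?_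
      simp
  refine ⟨key, ?_⟩
  have hnot : ∀ᶠ t in 𝓝[≠] (0 : ℂ), ((t⁻¹ : ℂ) : RiemannSphere) ∉ Set.range x := by
    have h1 : Tendsto (fun t : ℂ => t⁻¹) (𝓝[≠] 0) (cocompact ℂ) := by
      rw [← Metric.cobounded_eq_cocompact]
      exact tendsto_inv₀_nhdsNE_zero
    exact h1.eventually hF.isCompact.compl_mem_cocompact
  -- Dividing the partial fraction identity by t = 1 / z and letting t tend to zero compares the
  -- coefficients of 1 / z. This is the residue theorem: h(0) supplies the residue at a marked
  -- infinity, the other terms the finite ones.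
  have h1 : Tendsto (fun t => h t + ∑ i, poleCoeffInfty (x i) t * r i) (𝓝[≠] 0)
      (𝓝 (h 0 + ∑ i, poleCoeffInfty (x i) 0 * r i)) :=
    ((hh.continuousAt.tendsto).add (tendsto_finsetSum _ fun i _ =>
      ((analyticAt_poleCoeffInfty (x i)).continuousAt.tendsto).mul_const _)).mono_left
      nhdsWithin_le_nhds
  have h2 : (fun t => h t + ∑ i, poleCoeffInfty (x i) t * r i) =ᶠ[𝓝[≠] 0] fun _ => 0 := by
    filter_upwards [hnot, hfh, self_mem_nhdsWithin] with t ht1 ht2 ht0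
    have h3 := key _ ht1
    simp only [poleCoeff_inv _ ht0, mul_assoc] at h3
    rw [ht2, ← Finset.mul_sum, ← mul_neg] at h3
    have := mul_left_cancel₀ ht0 h3
    rw [← this]
    ring
  have h3 := tendsto_nhds_unique (h1.congr' h2) tendsto_const_nhds
  rw [hh0, ← Finset.sum_add_distrib] at h3
  rw [← h3]
  refine Finset.sum_congr rfl fun i _ => ?_
  rw [poleCoeffInfty_zero]
  split_ifs <;> simp

end Sphere

end

noncomputable section

/-! ### Degrees of line subbundles of the trivial bundle, and stability. -/

section Degree

open Filter

theorem tendsto_inv_nhdsNE_zero_cocompact : Tendsto (fun t : ℂ => t⁻¹) (𝓝[≠] 0) (cocompact ℂ) := by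
  rw [← Metric.cobounded_eq_cocompact]
  exact tendsto_inv₀_nhdsNE_zero

/-- A nonzero meromorphic vector-valued function on the sphere has nonpositive degree, and is
a multiple of a constant vector if its degree is zero. -/
theorem degree_nonpos {F : Type*} [NormedAddCommGroup F] [NormedSpace ℂ F]
    [CompleteSpace F] {s : RiemannSphere → F}
    (hs : ∀ y, MeromorphicAt (fun t => s (sphereCoord y t)) 0 ∧
      meromorphicOrderAt (fun t => s (sphereCoord y t)) 0 ≠ ⊤) {d : ℤ}
    (hd : d = ∑ᶠ y, (meromorphicOrderAt (fun t => s (sphereCoord y t)) 0).untop₀) :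
    d ≤ 0 ∧ (d = 0 → ∃ v : F, v ≠ 0 ∧ ∀ y, ∀ᶠ t in 𝓝[≠] (0 : ℂ), ∃ c : ℂ, c ≠ 0 ∧
      s (sphereCoord y t) = c • v) := by
  classical
  let f : ℂ → F := fun z => s z
  have hcoord : ∀ a : ℂ, (fun t => s (sphereCoord (a : RiemannSphere) t)) =
      f ∘ (· + a) := fun a => by
    ext t
    simp [f, sphereCoord_coe, add_comm]
  have hford : ∀ a : ℂ, meromorphicOrderAt (fun t => s (sphereCoord (a : RiemannSphere) t)) 0 =
      meromorphicOrderAt f a := fun a => by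
    rw [hcoord, meromorphicOrderAt_comp_add_const_eq_meromorphicOrderAt, zero_add]
  have hfm : ∀ a, MeromorphicAt f a := fun a => by
    have := (hs a).1
    rw [hcoord, meromorphicAt_comp_add_const_iff_meromorphicAt, zero_add] at this
    exact this
  have hfo : ∀ a, meromorphicOrderAt f a ≠ ⊤ := fun a => hford a ▸ (hs a).2
  -- the behaviour at infinity
  obtain ⟨m, hm⟩ := WithTop.ne_top_iff_exists.1 (hs OnePoint.infty).2
  obtain ⟨k, hk, hk0, hsk⟩ := (meromorphicOrderAt_eq_int_iff (hs OnePoint.infty).1).1 hm.symm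
  have hfk : ∀ᶠ t in 𝓝[≠] (0 : ℂ), f t⁻¹ = t ^ m • k t := by
    filter_upwards [hsk, self_mem_nhdsWithin] with t ht ht0
    rw [sub_zero, sphereCoord_infty ht0] at ht
    exact ht
  have hkne : ∀ᶠ t in 𝓝[≠] (0 : ℂ), AnalyticAt ℂ k t ∧ k t ≠ 0 :=
    (hk.eventually_analyticAt.and (hk.continuousAt.eventually_ne hk0)).filter_mono
      nhdsWithin_le_nhds
  -- Finite order at infinity excludes zeros and poles near infinity, so the divisor on the plane is
  -- supported in a compact set and is finite.
  have hreg : ∀ᶠ a in cocompact ℂ, AnalyticAt ℂ f a ∧ f a ≠ 0 := by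
    have h1 := (eventually_nhdsNE_eventually_nhds_iff.2 hfk).and hkne
    filter_upwards [tendsto_inv_cocompact.eventually h1,
      tendsto_inv_cocompact.eventually self_mem_nhdsWithin] with a ⟨ha1, ha2, ha3⟩ ha0
    have ha0' : a ≠ 0 := by simpa using ha0
    have hinv : AnalyticAt ℂ (fun z : ℂ => z⁻¹) a := analyticAt_id.inv ha0'
    have h2 : ∀ᶠ z in 𝓝 a, f z = z⁻¹ ^ m • k z⁻¹ := by
      filter_upwards [hinv.continuousAt.eventually ha1] with z hz
      simpa using hz
    constructor
    · have h3 : AnalyticAt ℂ (fun z => z⁻¹ ^ m • k z⁻¹) a :=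
        (hinv.zpow (n := m) (by simpa using ha0')).smul (ha2.comp hinv)
      refine h3.congr ?_
      filter_upwards [h2] with z hz
      exact hz.symm
    · rw [h2.self_of_nhds]
      exact smul_ne_zero (zpow_ne_zero _ (by simpa using ha0')) ha3
  obtain ⟨K, hK, hKreg⟩ := mem_cocompact.1 hreg
  let D := MeromorphicOn.divisor f Set.univ
  have hfU : MeromorphicOn f Set.univ := fun a _ => hfm a
  have hDa : ∀ a, D a = (meromorphicOrderAt f a).untop₀ := fun a =>
    MeromorphicOn.divisor_apply hfU (Set.mem_univ a)
  have hDfin : D.support.Finite := by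
    refine ((MeromorphicOn.divisor f K).finiteSupport hK).subset fun a ha => ?_
    have haK : a ∈ K := by
      by_contra haK
      obtain ⟨h1, h2⟩ := hKreg haK
      refine ha ?_
      rw [hDa, h1.meromorphicOrderAt_eq, h1.analyticOrderAt_eq_zero.2 h2]
      rfl
    rw [Function.mem_support, MeromorphicOn.divisor_apply (fun a _ => hfm a) haK, ← hDa]
    exact ha
  -- Here f = P g, where the rational function P carries the whole divisor and g is entire without
  -- zeros.
  obtain ⟨g, hg, hg0, hfg⟩ := MeromorphicOn.extract_zeros_poles hfU (fun u => hfo u) hDfin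
  let T := hDfin.toFinset
  let P : ℂ → ℂ := fun z => ∏ u ∈ T, (z - u) ^ D u
  have hP : (∏ᶠ u, (· - u) ^ D u) = P := by
    rw [finprod_eq_prod_of_mulSupport_subset (s := T)]
    · ext z
      simp [P]
    · rw [Function.FactorizedRational.mulSupport]
      simp [T]
  have hPne : ∀ z ∉ T, P z ≠ 0 := fun z hz => Finset.prod_ne_zero_iff.2 fun u hu =>
    zpow_ne_zero _ (sub_ne_zero.2 fun h => hz (h ▸ hu))
  have hPan : ∀ z ∉ T, ContinuousAt P z := fun z hz => tendsto_finsetProd _ fun u hu => by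
    have : ContinuousAt (fun z : ℂ => (z - u) ^ D u) z :=
      ContinuousAt.zpow₀ (by fun_prop) _ (Or.inl (sub_ne_zero.2 fun h => hz (h ▸ hu)))
    exact this.tendsto
  have hfPg : ∀ a, ∀ᶠ z in 𝓝[≠] a, f z = P z • g z := fun a => by
    have h1 := mem_codiscreteWithin_iff_forall_mem_nhdsNE.1 hfg a (Set.mem_univ a)
    filter_upwards [h1] with z hz
    rcases hz with hz | hz
    · rw [hP] at hz
      exact hz
    · exact absurd (Set.mem_univ z) hz
  have hTev : ∀ a, ∀ᶠ z in 𝓝[≠] a, z ∉ T := fun a => by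
    have : ((T : Set ℂ) \ {a})ᶜ ∈ 𝓝 a :=
      (T.finite_toSet.subset Set.sdiff_subset).isClosed.isOpen_compl.mem_nhds (by simp)
    filter_upwards [mem_nhdsWithin_of_mem_nhds this, self_mem_nhdsWithin] with z hz hz' hzT
    exact hz ⟨hzT, hz'⟩
  have hTinf : ∀ᶠ z in cocompact ℂ, z ∉ T := T.finite_toSet.isCompact.compl_mem_cocompact
  have hinf : ∀ᶠ z in cocompact ℂ, f z = P z • g z := by
    filter_upwards [hreg, hTinf] with a ha haT
    have h1 := ha.1.continuousAt.tendsto.mono_left (nhdsWithin_le_nhds (s := {a}ᶜ))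
    have h2 := (((hPan a haT).smul (hg a (Set.mem_univ a)).continuousAt).tendsto).mono_left
      (nhdsWithin_le_nhds (s := {a}ᶜ))
    exact tendsto_nhds_unique_of_eventuallyEq h1 h2 (hfPg a)
  have hdsum : d = m + ∑ u ∈ T, D u := by
    rw [hd, finsum_eq_sum_of_support_subset (s := insert OnePoint.infty (T.image (↑)))]
    · rw [Finset.sum_insert (by simp), Finset.sum_image (OnePoint.coe_injective.injOn)]
      congr 1
      · rw [← hm]; rfl
      · exact Finset.sum_congr rfl fun a _ => by rw [hford, hDa]
    · intro y hy
      induction y using OnePoint.rec with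
      | infty => simp
      | coe a =>
        rw [Function.mem_support, hford, ← hDa] at hy
        simp [T, hy]
  have hPinv : ∀ t : ℂ, t ≠ 0 → P t⁻¹ = t ^ (-∑ u ∈ T, D u) * ∏ u ∈ T, (1 - u * t) ^ D u := by
    intro t ht
    have hsum : ∀ A : Finset ℂ, t ^ (∑ u ∈ A, -D u) = ∏ u ∈ A, t ^ (-D u) := fun A => by
      induction A using Finset.induction_on with
      | empty => simp
      | insert a A ha ih => rw [Finset.sum_insert ha, Finset.prod_insert ha, zpow_add₀ ht, ih]
    rw [← Finset.sum_neg_distrib, hsum, ← Finset.prod_mul_distrib]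
    refine Finset.prod_congr rfl fun u _ => ?_
    rw [zpow_neg, ← inv_zpow, ← mul_zpow]
    congr 1
    field_simp
  let Q : ℂ → ℂ := fun t => ∏ u ∈ T, (1 - u * t) ^ D u
  have hQ : Tendsto Q (𝓝 0) (𝓝 1) := by
    have h1 : ∀ u : ℂ, Tendsto (fun t : ℂ => (1 - u * t) ^ D u) (𝓝 0) (𝓝 1) := fun u => by
      have : ContinuousAt (fun t : ℂ => (1 - u * t) ^ D u) 0 :=
        ContinuousAt.zpow₀ (by fun_prop) _ (Or.inl (by simp))
      simpa using this.tendsto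
    simpa using tendsto_finsetProd T fun u _ => h1 u
  -- The orders of f and P at infinity combine to the degree d. If d > 0, then g tends to zero, so g
  -- = 0 by Liouville's theorem, which is absurd; if d = 0, then g is the constant k(0).
  have hgk : ∀ᶠ t in 𝓝[≠] (0 : ℂ), g t⁻¹ = t ^ d • (Q t)⁻¹ • k t := by
    filter_upwards [hfk, tendsto_inv_nhdsNE_zero_cocompact.eventually hinf, self_mem_nhdsWithin,
      tendsto_inv_nhdsNE_zero_cocompact.eventually hTinf] with t h1 h2 ht h3
    have hPt := hPne _ h3
    have hQt : Q t ≠ 0 := fun h => hPt (by rw [hPinv t ht]; exact mul_eq_zero_of_right _ h)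
    have h4 : g t⁻¹ = (P t⁻¹)⁻¹ • f t⁻¹ := by rw [h2, inv_smul_smul₀ hPt]
    rw [h4, h1, hPinv t ht, smul_smul, smul_smul, hdsum, zpow_add₀ ht, zpow_neg, mul_inv, inv_inv]
    congr 1
    simp only [Q]
    ring
  have hgd : Differentiable ℂ g := fun a => (hg a (Set.mem_univ a)).differentiableAt
  have hkQ : Tendsto (fun t => (Q t)⁻¹ • k t) (𝓝[≠] 0) (𝓝 (k 0)) := by
    have := (hQ.inv₀ one_ne_zero).smul hk.continuousAt.tendsto
    rw [inv_one, one_smul] at this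
    exact this.mono_left nhdsWithin_le_nhds
  have hlim : ∀ c : F, Tendsto (fun t => g t⁻¹) (𝓝[≠] 0) (𝓝 c) → ∀ z, g z = c := by
    intro c hc z
    refine hgd.apply_eq_of_tendsto_cocompact z ((hc.comp tendsto_inv_cocompact).congr fun z => ?_)
    simp
  refine ⟨?_, fun hd0 => ⟨k 0, hk0, fun y => ?_⟩⟩
  · by_contra! hpos
    refine hg0 ⟨0, Set.mem_univ _⟩ (hlim 0 ?_ 0)
    have h1 : Tendsto (fun t : ℂ => t ^ d) (𝓝[≠] 0) (𝓝 0) := by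
      have : ContinuousAt (fun t : ℂ => t ^ d) 0 := continuousAt_id.zpow₀ _ (Or.inr hpos.le)
      have h2 := this.tendsto.mono_left (nhdsWithin_le_nhds (s := {0}ᶜ))
      rwa [zero_zpow _ hpos.ne'] at h2
    have h2 := h1.smul hkQ
    rw [zero_smul] at h2
    exact h2.congr' (hgk.mono fun t ht => ht.symm)
  · have hgc := hlim (k 0) (hkQ.congr' (hgk.mono fun t ht =>
      (ht.trans (by rw [hd0, zpow_zero, one_smul])).symm))
    induction y using OnePoint.rec with
    | infty =>
      filter_upwards [tendsto_inv_nhdsNE_zero_cocompact.eventually hinf, self_mem_nhdsWithin,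
        tendsto_inv_nhdsNE_zero_cocompact.eventually hTinf] with t h1 ht h2
      refine ⟨P t⁻¹, hPne _ h2, ?_⟩
      rw [sphereCoord_infty ht, ← hgc t⁻¹]
      exact h1
    | coe a =>
      have ht : Tendsto (fun t => a + t) (𝓝[≠] 0) (𝓝[≠] a) := by
        refine tendsto_nhdsWithin_of_tendsto_nhds_of_eventually_within _ ?_ ?_
        · have : ContinuousAt (fun t => a + t) 0 := by fun_prop
          simpa using this.tendsto.mono_left nhdsWithin_le_nhds
        · filter_upwards [self_mem_nhdsWithin] with z hz
          simpa using hz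
      filter_upwards [ht.eventually (hfPg a), ht.eventually (hTev a)] with t h1 h2
      refine ⟨P (a + t), hPne _ h2, ?_⟩
      rw [sphereCoord_coe, ← hgc (a + t)]
      exact h1

theorem mem_span_singleton_of_det {v w : Fin 2 → ℂ} (hw : w ≠ 0) (h : v 0 * w 1 - v 1 * w 0 = 0) :
    v ∈ Submodule.span ℂ {w} := by
  rw [Submodule.mem_span_singleton]
  by_cases h0 : w 0 = 0
  · have h1 : w 1 ≠ 0 := fun h1 => hw (by ext i; fin_cases i <;> simp [h0, h1])
    refine ⟨v 1 / w 1, ?_⟩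
    have : v 0 = 0 := by simpa [h0, h1] using h
    ext i
    fin_cases i
    · simp [h0, this]
    · simp [h1]
  · refine ⟨v 0 / w 0, ?_⟩
    ext i
    fin_cases i
    · simp [h0]
    · simp
      field_simp
      linear_combination h

theorem det_of_mem_span_singleton {v w : Fin 2 → ℂ} (h : v ∈ Submodule.span ℂ {w}) :
    v 0 * w 1 - v 1 * w 0 = 0 := by
  obtain ⟨c, rfl⟩ := Submodule.mem_span_singleton.1 h
  simp
  ring

theorem span_singleton_eq_of_mem {v w : Fin 2 → ℂ} (hv : v ≠ 0) (h : v ∈ Submodule.span ℂ {w}) :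
    Submodule.span ℂ {w} = Submodule.span ℂ {v} := by
  obtain ⟨c, rfl⟩ := Submodule.mem_span_singleton.1 h
  have hc : c ≠ 0 := fun h => hv (by simp [h])
  rw [Submodule.span_singleton_smul_eq (IsUnit.mk0 c hc)]

/-- Line subbundles of the trivial bundle have nonpositive degree, and are constant if their degree
is zero. -/
theorem LineSubbundle.HasDegree.nonpos {L : LineSubbundle} {d : ℤ} (h : L.HasDegree d) :
    d ≤ 0 ∧ (d = 0 → ∃ v : Fin 2 → ℂ, v ≠ 0 ∧ ∀ y, L.fiber y = Submodule.span ℂ {v}) := by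
  obtain ⟨s, hsL, hs, hd⟩ := h
  obtain ⟨h1, h2⟩ := degree_nonpos hs hd
  refine ⟨h1, fun hd0 => ?_⟩
  obtain ⟨v, hv, hsv⟩ := h2 hd0
  refine ⟨v, hv, fun y => ?_⟩
  obtain ⟨σ, hσ, hσL⟩ := L.holomorphic y
  have hσ0 := hσL.self_of_nhds
  rw [sphereCoord_zero] at hσ0
  have hdet : ContinuousAt (fun t => v 0 * σ t 1 - v 1 * σ t 0) 0 := by
    have := continuousAt_pi.1 hσ.continuousAt
    exact (continuousAt_const.mul (this 1)).sub (continuousAt_const.mul (this 0))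
  have hev : ∀ᶠ t in 𝓝[≠] (0 : ℂ), v 0 * σ t 1 - v 1 * σ t 0 = 0 := by
    filter_upwards [hsv y, hσL.filter_mono nhdsWithin_le_nhds] with t ⟨c, hc, ht⟩ ⟨_, ht'⟩
    refine det_of_mem_span_singleton ?_
    have := hsL (sphereCoord y t)
    rw [ht', ht] at this
    exact (Submodule.smul_mem_iff _ hc).1 this
  -- The meromorphic section controls the fibres only away from the centre; continuity of the
  -- determinant prevents the fibre from jumping there.
  have hz : v 0 * σ 0 1 - v 1 * σ 0 0 = 0 :=
    tendsto_nhds_unique_of_eventuallyEq (hdet.tendsto.mono_left nhdsWithin_le_nhds)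
      (tendsto_const_nhds (x := (0 : ℂ))) hev
  rw [hσ0.2]
  exact span_singleton_eq_of_mem hv (mem_span_singleton_of_det hσ0.1 hz)

/-- A Higgs bundle on the trivial bundle with nonzero residues is stable if its flags are not
all equal. -/
theorem HiggsBundle.isStable_of_flag_ne {n : ℕ} {x : Fin n → RiemannSphere} {E : HiggsBundle x}
    (hres : ∀ i, E.residue i ≠ 0) {i j : Fin n} (hij : E.flag i ≠ E.flag j) : E.IsStable := by
  refine ⟨hres, fun L d _ hd => ?_⟩
  obtain ⟨h1, h2⟩ := hd.nonpos
  set m := {i | L.fiber (x i) ⊓ E.flag i ≠ ⊥} with hm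
  have hmn : m.ncard ≤ n := by
    have := Set.ncard_le_ncard (Set.subset_univ m)
    rwa [Set.ncard_univ, Nat.card_eq_fintype_card, Fintype.card_fin] at this
  have hlt : d = 0 → m.ncard ≠ n := by
    rintro hd0 hmn
    obtain ⟨v, hv, hL⟩ := h2 hd0
    have hmu : m = Set.univ := by
      refine Set.eq_of_subset_of_ncard_le (Set.subset_univ _) ?_
      rw [Set.ncard_univ, Nat.card_eq_fintype_card, Fintype.card_fin, hmn]
    have hfl : ∀ i, E.flag i = Submodule.span ℂ {v} := by
      intro i
      have hi : i ∈ m := hmu ▸ Set.mem_univ i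
      rw [hm, Set.mem_ofPred_eq, hL] at hi
      have hle : Submodule.span ℂ {v} ≤ E.flag i := by
        have := (nonzero_span_atom v hv)
          |>.le_iff.1 (inf_le_left : Submodule.span ℂ {v} ⊓ E.flag i ≤ _)
        exact inf_eq_left.1 (this.resolve_left hi)
      refine (Submodule.eq_of_le_of_finrank_eq hle ?_).symm
      rw [finrank_span_singleton hv, E.finrank_flag]
    exact hij ((hfl i).trans (hfl j).symm)
  simp only [quasiParabolicSlope, Int.cast_zero, Nat.cast_one, Nat.cast_ofNat, mul_one, div_one,
    zero_add]
  -- If d < 0, the bound by n on the number of points is enough. If d = 0, the subbundle is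
  -- constant, and meeting all n flags would make them equal.
  have key : 2 * d + m.ncard < n := by
    rcases h1.lt_or_eq with h | h
    · omega
    · have := hlt h
      omega
  have key' : (2 * d + m.ncard : ℝ) < n := by exact_mod_cast key
  linarith

end Degree

end

noncomputable section

/-! ### Higgs fields on the trivial bundle and their residues. -/

section Higgs

open Filter

variable {n : ℕ} {x : Fin n → RiemannSphere}

theorem MatrixAnalyticAt.continuousAt {h : ℂ → Matrix (Fin 2) (Fin 2) ℂ} {a : ℂ}
    (hh : MatrixAnalyticAt h a) : ContinuousAt h a :=
  continuousAt_pi.2 fun j => continuousAt_pi.2 fun k => (hh j k).continuousAt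

theorem formResidue_eq {φ : ℂ → Matrix (Fin 2) (Fin 2) ℂ} {y : RiemannSphere}
    {h : ℂ → Matrix (Fin 2) (Fin 2) ℂ} (hh : MatrixAnalyticAt h 0)
    (he : ∀ᶠ t in 𝓝[≠] (0 : ℂ), t • localForm φ y t = h t) : formResidue φ y = h 0 :=
  ((hh.continuousAt.tendsto.mono_left nhdsWithin_le_nhds).congr'
    (he.mono fun _ ht => ht.symm)).limUnder_eq

theorem localForm_coe (φ : ℂ → Matrix (Fin 2) (Fin 2) ℂ) (a t : ℂ) :
    localForm φ (a : RiemannSphere) t = φ (a + t) := rfl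

theorem localForm_infty (φ : ℂ → Matrix (Fin 2) (Fin 2) ℂ) (t : ℂ) :
    localForm φ OnePoint.infty t = (-(t ^ 2)⁻¹) • φ t⁻¹ := rfl

theorem HiggsBundle.exists_residue_eq (E : HiggsBundle x) (i : Fin n) :
    ∃ h, MatrixAnalyticAt h 0 ∧ h 0 = E.residue i ∧
      ∀ᶠ t in 𝓝[≠] (0 : ℂ), t • localForm E.form (x i) t = h t := by
  obtain ⟨h, hh, he⟩ := E.simple_pole i
  exact ⟨h, hh, (formResidue_eq hh he).symm, he⟩

/-- A Higgs field is determined by its residues, which have sum zero. -/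
theorem HiggsBundle.form_eq_sum (hx : Function.Injective x) (E : HiggsBundle x) :
    (∀ a : ℂ, (a : RiemannSphere) ∉ Set.range x →
      E.form a = ∑ i, poleCoeff (x i) a • E.residue i) ∧ ∑ i, E.residue i = 0 := by
  classical
  have key : ∀ j k : Fin 2, (∀ a : ℂ, (a : RiemannSphere) ∉ Set.range x →
      E.form a j k = ∑ i, poleCoeff (x i) a * E.residue i j k) ∧ ∑ i, E.residue i j k = 0 := by
    intro j k
    refine eq_sum_poleCoeff hx (fun a ha => E.holomorphic a ha j k) (fun i a hi => ?_) ?_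
    · obtain ⟨h, hh, h0, he⟩ := E.exists_residue_eq i
      refine ⟨fun t => h t j k, hh j k, by dsimp only; rw [h0], ?_⟩
      filter_upwards [he] with t ht
      rw [← ht, hi, localForm_coe]
      rfl
    · by_cases hi : OnePoint.infty ∈ Set.range x
      · obtain ⟨l, hl⟩ := hi
        obtain ⟨h, hh, h0, he⟩ := E.exists_residue_eq l
        refine ⟨fun t => h t j k, hh j k, ?_, ?_⟩
        · dsimp only
          rw [Finset.sum_eq_single l, if_pos hl, h0]
          · exact fun i _ hil => if_neg fun hi => hil (hx (hi.trans hl.symm))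
          · simp
        · filter_upwards [he, self_mem_nhdsWithin] with t ht ht0
          have ht0' : t ≠ 0 := ht0
          rw [← ht, hl, localForm_infty]
          simp only [Matrix.smul_apply, smul_eq_mul]
          field_simp
      -- At an unmarked infinity the form is regular; the extra factor t records that its residue
      -- there is zero.
      · obtain ⟨h, hh, he⟩ := E.holomorphic_infty hi
        refine ⟨fun t => t * h t j k, analyticAt_id.mul (hh j k), ?_, ?_⟩
        · dsimp only
          rw [zero_mul, Finset.sum_eq_zero]
          exact fun i _ => if_neg fun h => hi ⟨i, h⟩
        · filter_upwards [he, self_mem_nhdsWithin] with t ht ht0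
          have ht0' : t ≠ 0 := ht0
          rw [← ht, localForm_infty]
          simp only [Matrix.smul_apply, smul_eq_mul]
          field_simp
  refine ⟨fun a ha => ?_, ?_⟩
  · ext j k
    rw [(key j k).1 a ha, Matrix.sum_apply]
    rfl
  · ext j k
    rw [Matrix.sum_apply, (key j k).2]
    rfl

/-- The Higgs field with residues `N`. -/
def rationalForm (x : Fin n → RiemannSphere) (N : Fin n → Matrix (Fin 2) (Fin 2) ℂ) (z : ℂ) :
    Matrix (Fin 2) (Fin 2) ℂ := ∑ i, poleCoeff (x i) z • N i

theorem rationalForm_apply (N : Fin n → Matrix (Fin 2) (Fin 2) ℂ) (z : ℂ) (j k : Fin 2) :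
    rationalForm x N z j k = ∑ i, poleCoeff (x i) z * N i j k := by
  rw [rationalForm, Matrix.sum_apply]
  rfl

/-- At a finite marked point only one summand has a pole. At infinity the finite poles contribute
minus the sum of their residues, which is the remaining residue because the total is zero. -/
theorem exists_rationalForm_residue (hx : Function.Injective x)
    {N : Fin n → Matrix (Fin 2) (Fin 2) ℂ} (hN : ∑ i, N i = 0) (i : Fin n) :
    ∃ h, MatrixAnalyticAt h 0 ∧ h 0 = N i ∧
      ∀ᶠ t in 𝓝[≠] (0 : ℂ), t • localForm (rationalForm x N) (x i) t = h t := by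
  have happ : ∀ (c : Fin n → ℂ) (A : Finset (Fin n)) (j k : Fin 2),
      (∑ l ∈ A, c l • N l) j k = ∑ l ∈ A, c l * N l j k := fun c A j k => by
    rw [Matrix.sum_apply]
    rfl
  generalize hy : x i = y
  induction y using OnePoint.rec with
  | infty =>
    refine ⟨fun t => -∑ l, poleCoeffInfty (x l) t • N l, fun j k => ?_, ?_, ?_⟩
    · simp only [Matrix.neg_apply, happ]
      exact (Finset.analyticAt_fun_sum _ fun l _ =>
        (analyticAt_poleCoeffInfty (x l)).mul analyticAt_const).neg
    · dsimp only
      rw [← add_right_inj (∑ l, poleCoeffInfty (x l) 0 • N l), add_neg_cancel, ← hN,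
        ← Finset.add_sum_erase Finset.univ _ (Finset.mem_univ i),
        ← Finset.add_sum_erase Finset.univ _ (Finset.mem_univ i), poleCoeffInfty_zero, if_pos hy,
        zero_smul, zero_add, add_comm]
      congr 1
      refine Finset.sum_congr rfl fun l hl => ?_
      rw [poleCoeffInfty_zero, if_neg fun h => Finset.ne_of_mem_erase hl (hx (h.trans hy.symm)),
        one_smul]
    · filter_upwards [self_mem_nhdsWithin] with t ht
      have ht' : t ≠ 0 := ht
      rw [localForm_infty, rationalForm, smul_smul, Finset.smul_sum, ← Finset.sum_neg_distrib]
      refine Finset.sum_congr rfl fun l _ => ?_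
      rw [poleCoeff_inv _ ht', smul_smul, ← neg_smul]
      congr 1
      field_simp
  | coe a =>
    refine ⟨fun t => N i + t • ∑ l ∈ Finset.univ.erase i, poleCoeff (x l) (a + t) • N l,
      fun j k => ?_, by simp, ?_⟩
    · simp only [Matrix.add_apply, Matrix.smul_apply, happ]
      refine analyticAt_const.add (analyticAt_id.mul (Finset.analyticAt_fun_sum _ fun l hl => ?_))
      refine AnalyticAt.mul ?_ analyticAt_const
      exact AnalyticAt.comp_of_eq (f := fun t => a + t) (analyticAt_poleCoeff (a := a) fun h =>
        Finset.ne_of_mem_erase hl (hx (h.trans hy.symm))) (analyticAt_const.add analyticAt_id)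
        (add_zero a)
    · filter_upwards [self_mem_nhdsWithin] with t ht
      have ht' : t ≠ 0 := ht
      rw [localForm_coe, rationalForm, ← Finset.add_sum_erase Finset.univ _ (Finset.mem_univ i),
        smul_add, hy, poleCoeff_coe, smul_smul]
      simp [ht']

/-- The Higgs bundle with given flags and residues. -/
def HiggsBundle.ofResidues (hx : Function.Injective x) (N : Fin n → Matrix (Fin 2) (Fin 2) ℂ)
    (hN : ∑ i, N i = 0) (htr : ∀ i, (N i).trace = 0) (flag : Fin n → Submodule ℂ (Fin 2 → ℂ))
    (hrank : ∀ i, Module.finrank ℂ (flag i) = 1) (hmem : ∀ i v, N i *ᵥ v ∈ flag i)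
    (hker : ∀ i, ∀ v ∈ flag i, N i *ᵥ v = 0) : HiggsBundle x where
  flag := flag
  finrank_flag := hrank
  form := rationalForm x N
  holomorphic a ha j k := by
    simp only [rationalForm_apply]
    exact Finset.analyticAt_fun_sum _ fun i _ =>
      (analyticAt_poleCoeff fun e => ha ⟨i, e⟩).mul analyticAt_const
  holomorphic_infty hi := by
    let K : Fin 2 → Fin 2 → ℂ → ℂ := fun j k t => ∑ i, poleCoeffInfty (x i) t * N i j k
    have hK : ∀ j k, AnalyticAt ℂ (K j k) 0 := fun j k => Finset.analyticAt_fun_sum _ fun i _ =>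
      (analyticAt_poleCoeffInfty (x i)).mul analyticAt_const
    -- The vanishing sum of the residues cancels the term of order 1 / z, so the form can be divided
    -- by t once more and is regular at an unmarked infinity.
    have hK0 : ∀ j k, K j k 0 = 0 := fun j k => by
      have h := congrFun (congrFun hN j) k
      rw [Matrix.sum_apply] at h
      refine Eq.trans (Finset.sum_congr rfl fun i _ => ?_) h
      rw [poleCoeffInfty_zero, if_neg fun h => hi ⟨i, h⟩, one_mul]
    refine ⟨fun t => Matrix.of fun j k => -dslope (K j k) 0 t, fun j k => ?_, ?_⟩
    · obtain ⟨p, hp⟩ := hK j k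
      have hd : AnalyticAt ℂ (dslope (K j k) 0) 0 := ⟨_, hp.has_fpower_series_dslope_fslope⟩
      exact hd.neg
    · filter_upwards [self_mem_nhdsWithin] with t ht
      have ht' : t ≠ 0 := ht
      ext j k
      rw [localForm_infty, Matrix.smul_apply, rationalForm_apply, Matrix.of_apply,
        dslope_of_ne _ ht', slope_def_field, hK0]
      simp only [poleCoeff_inv _ ht', mul_assoc, ← Finset.mul_sum, smul_eq_mul, K]
      field_simp
      ring
  simple_pole i := by
    obtain ⟨h, hh, _, he⟩ := exists_rationalForm_residue hx hN i
    exact ⟨h, hh, he⟩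
  traceless a _ := by
    rw [rationalForm, Matrix.trace_sum]
    exact Finset.sum_eq_zero fun i _ => by rw [Matrix.trace_smul, htr, smul_zero]
  residue_mem i v := by
    obtain ⟨h, hh, h0, he⟩ := exists_rationalForm_residue hx hN i
    rw [formResidue_eq hh he, h0]
    exact hmem i v
  residue_flag i v hv := by
    obtain ⟨h, hh, h0, he⟩ := exists_rationalForm_residue hx hN i
    rw [formResidue_eq hh he, h0]
    exact hker i v hv

namespace HiggsBundle

theorem residue_ofResidues (hx : Function.Injective x) (N : Fin n → Matrix (Fin 2) (Fin 2) ℂ)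
    (hN : ∑ i, N i = 0) (htr : ∀ i, (N i).trace = 0) (flag : Fin n → Submodule ℂ (Fin 2 → ℂ))
    (hrank : ∀ i, Module.finrank ℂ (flag i) = 1) (hmem : ∀ i v, N i *ᵥ v ∈ flag i)
    (hker : ∀ i, ∀ v ∈ flag i, N i *ᵥ v = 0) (i : Fin n) :
    (ofResidues hx N hN htr flag hrank hmem hker).residue i = N i := by
  obtain ⟨h, hh, h0, he⟩ := exists_rationalForm_residue hx hN i
  exact (formResidue_eq hh he).trans h0

/-- Higgs fields are compared only at unmarked points of the plane. This transfers an identity there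
to the local forms near a marked point, since the factor `c` does not depend on the field. -/
theorem eventually_notMem_range (i : Fin n) : ∀ᶠ t in 𝓝[≠] (0 : ℂ), ∃ a : ℂ,
    (a : RiemannSphere) ∉ Set.range x ∧ ∃ c : ℂ, ∀ φ, localForm φ (x i) t = c • φ a := by
  have hF : {a : ℂ | (a : RiemannSphere) ∈ Set.range x}.Finite :=
    (Set.finite_range x).preimage OnePoint.coe_injective.injOn
  generalize x i = y
  induction y using OnePoint.rec with
  | infty =>
    filter_upwards [tendsto_inv_nhdsNE_zero_cocompact.eventually hF.isCompact.compl_mem_cocompact]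
      with t ht
    exact ⟨t⁻¹, ht, _, fun φ => localForm_infty φ t⟩
  | coe b =>
    have h1 : ∀ᶠ z in 𝓝 b, z ∉ {a : ℂ | (a : RiemannSphere) ∈ Set.range x} \ {b} :=
      (hF.subset Set.sdiff_subset).isClosed.isOpen_compl.mem_nhds (by simp)
    have h2 : Tendsto (fun t => b + t) (𝓝[≠] 0) (𝓝 b) := by
      have : ContinuousAt (fun t => b + t) 0 := by fun_prop
      simpa using this.tendsto.mono_left nhdsWithin_le_nhds
    filter_upwards [h2.eventually h1, self_mem_nhdsWithin] with t ht ht0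
    have ht0' : t ≠ 0 := ht0
    exact ⟨b + t, fun h => ht ⟨h, by simpa using ht0'⟩, 1, fun φ => by rw [one_smul, localForm_coe]⟩

/-- Isomorphisms are given by constant matrices. -/
theorem Iso.exists_const {E F : HiggsBundle x} (h : E.Iso F) :
    ∃ g : Matrix.SpecialLinearGroup (Fin 2) ℂ,
      (∀ i, (E.flag i).map (Matrix.mulVecLin g.1) = F.flag i) ∧
      ∀ i, g.1 * E.residue i = F.residue i * g.1 := by
  obtain ⟨g, h1, h2, h3⟩ := h
  have hg : ∀ y, g y = g OnePoint.infty := fun y => by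
    ext j k
    exact eq_infty_of_analytic_sphere (s := fun y => (g y).1 j k) (fun y => h1 y j k) y
  refine ⟨g OnePoint.infty, fun i => by rw [← h2 i, hg (x i)], fun i => ?_⟩
  obtain ⟨k, hk, hk0, hke⟩ := E.exists_residue_eq i
  obtain ⟨l, hl, hl0, hle⟩ := F.exists_residue_eq i
  have hev : ∀ᶠ t in 𝓝[≠] (0 : ℂ), (g OnePoint.infty).1 * k t = l t * (g OnePoint.infty).1 := by
    filter_upwards [hke, hle, eventually_notMem_range (x := x) i] with t ht1 ht2 ⟨a, ha, c, hc⟩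
    rw [← ht1, ← ht2, hc, hc]
    have := h3 a ha
    rw [hg] at this
    simp only [mul_smul_comm, smul_mul_assoc, this]
  have hk' : Tendsto (fun t => (g OnePoint.infty).1 * k t) (𝓝[≠] 0)
      (𝓝 ((g OnePoint.infty).1 * k 0)) :=
    ((continuous_const.matrix_mul continuous_id).tendsto _).comp
      (hk.continuousAt.tendsto.mono_left nhdsWithin_le_nhds)
  have hl' : Tendsto (fun t => l t * (g OnePoint.infty).1) (𝓝[≠] 0)
      (𝓝 (l 0 * (g OnePoint.infty).1)) :=
    ((continuous_id.matrix_mul continuous_const).tendsto _).comp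
      (hl.continuousAt.tendsto.mono_left nhdsWithin_le_nhds)
  rw [← hk0, ← hl0]
  exact tendsto_nhds_unique_of_eventuallyEq hk' hl' hev

/-- By partial fractions the Higgs field is linear in its residues, with the same scalar
coefficients for both bundles. -/
theorem Iso.of_const (hx : Function.Injective x) {E F : HiggsBundle x}
    (g : Matrix.SpecialLinearGroup (Fin 2) ℂ)
    (h1 : ∀ i, (E.flag i).map (Matrix.mulVecLin g.1) = F.flag i)
    (h2 : ∀ i, g.1 * E.residue i = F.residue i * g.1) : E.Iso F := by
  refine ⟨fun _ => g, fun y j k => analyticAt_const, h1, fun a ha => ?_⟩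
  rw [(E.form_eq_sum hx).1 a ha, (F.form_eq_sum hx).1 a ha, Finset.mul_sum, Finset.sum_mul]
  refine Finset.sum_congr rfl fun i _ => ?_
  rw [mul_smul_comm, smul_mul_assoc, h2]

end HiggsBundle

/-- The constant line subbundle spanned by `v`. -/
def LineSubbundle.const (v : Fin 2 → ℂ) (hv : v ≠ 0) : LineSubbundle where
  fiber _ := Submodule.span ℂ {v}
  holomorphic _ := ⟨fun _ => v, analyticAt_const, .of_forall fun _ => ⟨hv, rfl⟩⟩

theorem LineSubbundle.isTrivial_const (v : Fin 2 → ℂ) (hv : v ≠ 0) :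
    (LineSubbundle.const v hv).IsTrivial :=
  ⟨fun _ => v, fun _ => analyticAt_const, fun _ => ⟨hv, rfl⟩⟩

/-- The components of the trivializing section are holomorphic on the sphere, hence constant. -/
theorem LineSubbundle.IsTrivial.exists_const {L : LineSubbundle} (h : L.IsTrivial) :
    ∃ v : Fin 2 → ℂ, v ≠ 0 ∧ ∀ y, L.fiber y = Submodule.span ℂ {v} := by
  obtain ⟨s, hs, hL⟩ := h
  refine ⟨s OnePoint.infty, (hL _).1, fun y => ?_⟩
  have : s y = s OnePoint.infty := by
    ext j
    refine eq_infty_of_analytic_sphere (s := fun y => s y j) (fun y => ?_) y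
    exact (ContinuousLinearMap.proj (R := ℂ) (φ := fun _ : Fin 2 => ℂ) j).analyticAt _
      |>.comp (hs y)
  rw [(hL y).2, this]

theorem isCompl_span_iff {v w : Fin 2 → ℂ} (hv : v ≠ 0) (hw : w ≠ 0) :
    IsCompl (Submodule.span ℂ {v}) (Submodule.span ℂ {w}) ↔ v 0 * w 1 - v 1 * w 0 ≠ 0 := by
  constructor
  · intro h h0
    have h1 := mem_span_singleton_of_det hw h0
    have h2 := h.disjoint.le_bot (Submodule.mem_inf.2 ⟨Submodule.mem_span_singleton_self v, h1⟩)
    exact hv ((Submodule.mem_bot ℂ).1 h2)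
  · intro h0
    refine ⟨?_, ?_⟩
    · rw [Submodule.disjoint_def]
      intro u hu hu'
      obtain ⟨c, rfl⟩ := Submodule.mem_span_singleton.1 hu
      by_contra hc
      have hc' : c ≠ 0 := fun h => hc (by simp [h])
      exact h0 (det_of_mem_span_singleton ((Submodule.smul_mem_iff _ hc').1 hu'))
    · rw [codisjoint_iff, eq_top_iff]
      intro u _
      rw [Submodule.mem_sup]
      -- The coefficients come from Cramer's rule.
      refine ⟨((u 0 * w 1 - u 1 * w 0) / (v 0 * w 1 - v 1 * w 0)) • v,
        Submodule.smul_mem _ _ (Submodule.mem_span_singleton_self v),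
        ((v 0 * u 1 - v 1 * u 0) / (v 0 * w 1 - v 1 * w 0)) • w,
        Submodule.smul_mem _ _ (Submodule.mem_span_singleton_self w), ?_⟩
      ext j
      fin_cases j
      · simp only [Pi.add_apply, Pi.smul_apply, smul_eq_mul, Fin.zero_eta]
        rw [div_mul_eq_mul_div, div_mul_eq_mul_div, ← add_div, div_eq_iff h0]
        ring
      · simp only [Pi.add_apply, Pi.smul_apply, smul_eq_mul, Fin.mk_one]
        rw [div_mul_eq_mul_div, div_mul_eq_mul_div, ← add_div, div_eq_iff h0]
        ring

end Higgs

end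

noncomputable section

/-! ### The component of the moduli space of Higgs bundles. -/

section HiggsComponent

variable {n : ℕ} {x : Fin n → RiemannSphere} {S : Finset (Fin n)} {i₀ j₀ : Fin n}

/-- The flags are spanned by `v` over the points of `S` and by `w` over the other points. -/
def HiggsBundle.HasTwoFlags (S : Finset (Fin n)) (E : HiggsBundle x) (v w : Fin 2 → ℂ) : Prop :=
  (∀ i ∈ S, E.flag i = Submodule.span ℂ {v}) ∧ ∀ i ∉ S, E.flag i = Submodule.span ℂ {w}

theorem ne_zero_of_det_ne_zero {v w : Fin 2 → ℂ} (h : v 0 * w 1 - v 1 * w 0 ≠ 0) :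
    v ≠ 0 ∧ w ≠ 0 :=
  ⟨fun hv => h (by simp [hv]), fun hw => h (by simp [hw])⟩

/-- The flags alone decide: a residue kills its flag and has its image in it. So when only two
complementary lines occur, the residues, and with them the Higgs field, are off-diagonal with the
required vanishing entries. -/
theorem HiggsBundle.HasTwoFlags.mem_higgsComponent (hx : Function.Injective x)
    {E : StableHiggsBundle x} {v w : Fin 2 → ℂ} (h : E.1.HasTwoFlags S v w)
    (hvw : v 0 * w 1 - v 1 * w 0 ≠ 0) : Quotient.mk (higgsSetoid x) E ∈ higgsComponent x S := by
  obtain ⟨hv, hw⟩ := ne_zero_of_det_ne_zero hvw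
  refine ⟨E, rfl, LineSubbundle.const v hv, LineSubbundle.const w hw,
    LineSubbundle.isTrivial_const v hv, LineSubbundle.isTrivial_const w hw,
    fun y => (isCompl_span_iff hv hw).2 hvw, h.1, h.2, ?_, ?_, ?_, ?_⟩
  · intro a ha u hu
    rw [(E.1.form_eq_sum hx).1 a ha, Matrix.sum_mulVec]
    refine Submodule.sum_mem _ fun i _ => ?_
    rw [Matrix.smul_mulVec]
    refine Submodule.smul_mem _ _ ?_
    by_cases hi : i ∈ S
    · rw [HiggsBundle.residue, E.1.residue_flag i u (by rw [h.1 i hi]; exact hu)]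
      exact Submodule.zero_mem _
    · have := E.1.residue_mem i u
      rwa [h.2 i hi] at this
  · intro a ha u hu
    rw [(E.1.form_eq_sum hx).1 a ha, Matrix.sum_mulVec]
    refine Submodule.sum_mem _ fun i _ => ?_
    rw [Matrix.smul_mulVec]
    refine Submodule.smul_mem _ _ ?_
    by_cases hi : i ∈ S
    · have := E.1.residue_mem i u
      rwa [h.1 i hi] at this
    · rw [HiggsBundle.residue, E.1.residue_flag i u (by rw [h.2 i hi]; exact hu)]
      exact Submodule.zero_mem _
  · exact fun i hi u hu => E.1.residue_flag i u (by rw [h.1 i hi]; exact hu)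
  · exact fun i hi u hu => E.1.residue_flag i u (by rw [h.2 i hi]; exact hu)

/-- Trivial line subbundles and isomorphisms are both constant, so the two lines of one
representative can be carried over to any other. -/
theorem exists_hasTwoFlags {E : StableHiggsBundle x}
    (h : Quotient.mk (higgsSetoid x) E ∈ higgsComponent x S) :
    ∃ v w : Fin 2 → ℂ, v 0 * w 1 - v 1 * w 0 ≠ 0 ∧ E.1.HasTwoFlags S v w := by
  obtain ⟨F, hFE, L₀, L₁, h0, h1, hc, hS, hSc, -⟩ := h
  obtain ⟨g, hg, -⟩ := HiggsBundle.Iso.exists_const (Quotient.exact hFE : F.1.Iso E.1)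
  obtain ⟨v, hv, hL0⟩ := h0.exists_const
  obtain ⟨w, hw, hL1⟩ := h1.exists_const
  have hvw := hc OnePoint.infty
  rw [hL0, hL1, isCompl_span_iff hv hw] at hvw
  refine ⟨g.1 *ᵥ v, g.1 *ᵥ w, ?_, fun i hi => ?_, fun i hi => ?_⟩
  · have hdet := g.2
    rw [Matrix.det_fin_two] at hdet
    simp only [Matrix.mulVec, dotProduct, Fin.sum_univ_two]
    intro h
    apply hvw
    linear_combination h - (v 0 * w 1 - v 1 * w 0) * hdet
  · rw [← hg i, hS i hi, hL0, Submodule.map_span, Set.image_singleton, Matrix.mulVecLin_apply]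
  · rw [← hg i, hSc i hi, hL1, Submodule.map_span, Set.image_singleton, Matrix.mulVecLin_apply]

/-- A Higgs bundle in the component has off-diagonal residues in a suitable frame. -/
theorem HiggsBundle.HasTwoFlags.exists_offDiag (hx : Function.Injective x)
    {E : StableHiggsBundle x} {v w : Fin 2 → ℂ} (h : E.1.HasTwoFlags S v w)
    (hvw : v 0 * w 1 - v 1 * w 0 ≠ 0) :
    ∃ (G : Matrix.SpecialLinearGroup (Fin 2) ℂ) (r : Fin n → ℂ), (∀ i, r i ≠ 0) ∧
      ∑ i ∈ S, r i = 0 ∧ ∑ i ∈ Sᶜ, r i = 0 ∧ (∀ i, E.1.residue i * G.1 = G.1 * offDiag S r i) ∧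
      (∀ i ∈ S, E.1.flag i = Submodule.span ℂ {G.1 *ᵥ ![1, 0]}) ∧
      ∀ i ∉ S, E.1.flag i = Submodule.span ℂ {G.1 *ᵥ ![0, 1]} := by
  set D := v 0 * w 1 - v 1 * w 0 with hD
  -- The rescaling gives the frame determinant one, so that it belongs to SL(2, ℂ).
  let w' : Fin 2 → ℂ := D⁻¹ • w
  have hw' : Submodule.span ℂ {w'} = Submodule.span ℂ {w} :=
    Submodule.span_singleton_smul_eq (IsUnit.mk0 _ (inv_ne_zero hvw)) w
  let G : Matrix.SpecialLinearGroup (Fin 2) ℂ := ⟨!![v 0, w' 0; v 1, w' 1], by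
    rw [Matrix.det_fin_two_of]
    simp only [w', Pi.smul_apply, smul_eq_mul]
    field_simp
    rw [hD]
    ring⟩
  have hG0 : G.1 *ᵥ ![1, 0] = v := by
    ext j
    fin_cases j <;> simp [G, Matrix.mulVec]
  have hG1 : G.1 *ᵥ ![0, 1] = w' := by
    ext j
    fin_cases j <;> simp [G, Matrix.mulVec]
  have hres : ∀ i, ∃ c : ℂ, (i ∈ S → E.1.residue i *ᵥ v = 0 ∧ E.1.residue i *ᵥ w' = c • v) ∧
      (i ∉ S → E.1.residue i *ᵥ v = c • w' ∧ E.1.residue i *ᵥ w' = 0) := by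
    intro i
    by_cases hi : i ∈ S
    · have h1 := E.1.residue_mem i w'
      rw [h.1 i hi] at h1
      obtain ⟨c, hc⟩ := Submodule.mem_span_singleton.1 h1
      exact ⟨c, fun _ => ⟨E.1.residue_flag i v (by
        rw [h.1 i hi]; exact Submodule.mem_span_singleton_self v), hc.symm⟩, fun h => absurd hi h⟩
    · have h1 := E.1.residue_mem i v
      rw [h.2 i hi, ← hw'] at h1
      obtain ⟨c, hc⟩ := Submodule.mem_span_singleton.1 h1
      exact ⟨c, fun h => absurd h hi, fun _ => ⟨hc.symm, E.1.residue_flag i w' (by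
        rw [h.2 i hi, ← hw']; exact Submodule.mem_span_singleton_self w')⟩⟩
  choose r hr using hres
  have hz : (![0, 0] : Fin 2 → ℂ) = 0 := by
    ext j
    fin_cases j <;> rfl
  have hGr : ∀ i, E.1.residue i * G.1 = G.1 * offDiag S r i := by
    intro i
    have hcol : ∀ M : Matrix (Fin 2) (Fin 2) ℂ, M *ᵥ v = (M * G.1) *ᵥ ![1, 0] ∧
        M *ᵥ w' = (M * G.1) *ᵥ ![0, 1] := fun M => by
      rw [← hG0, ← hG1, Matrix.mulVec_mulVec, Matrix.mulVec_mulVec]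
      exact ⟨rfl, rfl⟩
    have hext : ∀ M M' : Matrix (Fin 2) (Fin 2) ℂ, M *ᵥ ![1, 0] = M' *ᵥ ![1, 0] →
        M *ᵥ ![0, 1] = M' *ᵥ ![0, 1] → M = M' := fun M M' h0 h1 => by
      ext j k
      have h0j := congrFun h0 j
      have h1j := congrFun h1 j
      simp only [Matrix.mulVec, dotProduct, Fin.sum_univ_two] at h0j h1j
      fin_cases k
      · simpa using h0j
      · simpa using h1j
    refine hext _ _ ?_ ?_
    · rw [← (hcol _).1, ← Matrix.mulVec_mulVec]
      by_cases hi : i ∈ S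
      · rw [((hr i).1 hi).1]
        simp [offDiag, hi, hz]
      · rw [((hr i).2 hi).1, ← hG1, ← Matrix.mulVec_smul]
        simp [offDiag, hi]
    · rw [← (hcol _).2, ← Matrix.mulVec_mulVec]
      by_cases hi : i ∈ S
      · rw [((hr i).1 hi).2, ← hG0, ← Matrix.mulVec_smul]
        simp [offDiag, hi]
      · rw [((hr i).2 hi).2]
        simp [offDiag, hi, hz]
  have hGinv : G⁻¹.1 * G.1 = 1 := by
    rw [← Matrix.SpecialLinearGroup.coe_mul, inv_mul_cancel]; rfl
  have hGinv' : G.1 * G⁻¹.1 = 1 := by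
    rw [← Matrix.SpecialLinearGroup.coe_mul, mul_inv_cancel]; rfl
  have hsum : ∑ i, offDiag S r i = 0 := by
    have h1 : ∀ i, offDiag S r i = G⁻¹.1 * (E.1.residue i * G.1) := fun i => by
      rw [hGr, ← mul_assoc, hGinv, one_mul]
    rw [Finset.sum_congr rfl fun i _ => h1 i, ← Finset.mul_sum, ← Finset.sum_mul,
      (E.1.form_eq_sum hx).2, zero_mul, mul_zero]
  rw [sum_offDiag] at hsum
  refine ⟨G, r, fun i hi => E.2.1 i ?_, by simpa using congrFun (congrFun hsum 0) 1,
    by simpa using congrFun (congrFun hsum 1) 0, hGr, fun i hi => by rw [hG0, h.1 i hi],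
    fun i hi => by rw [hG1, hw', h.2 i hi]⟩
  have h1 : offDiag S r i = 0 := by
    ext j k
    unfold offDiag
    split_ifs <;> fin_cases j <;> fin_cases k <;> simp [hi]
  have h2 := hGr i
  rw [h1, mul_zero] at h2
  rw [← mul_one (E.1.residue i), ← hGinv', ← mul_assoc, h2, zero_mul]

/-- The Higgs bundle with off-diagonal residues and coordinate lines as flags. -/
def HiggsBundle.ofEntries (hx : Function.Injective x) (S : Finset (Fin n)) (w : Fin n → ℂ)
    (h1 : ∑ i ∈ S, w i = 0) (h2 : ∑ i ∈ Sᶜ, w i = 0) : HiggsBundle x :=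
  HiggsBundle.ofResidues hx (offDiag S w)
    (by
      rw [sum_offDiag, h1, h2]
      ext j k
      fin_cases j <;> fin_cases k <;> rfl)
    (fun i => by
      unfold offDiag
      split_ifs <;> simp [Matrix.trace_fin_two])
    (fun i => Submodule.span ℂ {if i ∈ S then ![1, 0] else ![0, 1]})
    (fun i => finrank_span_singleton (by split_ifs <;> simp))
    (fun i v => by
      rw [Submodule.mem_span_singleton]
      unfold offDiag
      split_ifs
      · exact ⟨w i * v 1, by ext j; fin_cases j <;> simp [Matrix.mulVec, dotProduct]⟩
      · exact ⟨w i * v 0, by ext j; fin_cases j <;> simp [Matrix.mulVec, dotProduct]⟩)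
    (fun i v hv => by
      obtain ⟨c, rfl⟩ := Submodule.mem_span_singleton.1 hv
      unfold offDiag
      split_ifs <;> ext j <;> fin_cases j <;> simp [Matrix.mulVec, dotProduct])

section

variable (hx : Function.Injective x) {w : Fin n → ℂ} (h1 : ∑ i ∈ S, w i = 0)
  (h2 : ∑ i ∈ Sᶜ, w i = 0)

theorem HiggsBundle.residue_ofEntries (i : Fin n) :
    (HiggsBundle.ofEntries hx S w h1 h2).residue i = offDiag S w i :=
  HiggsBundle.residue_ofResidues hx _ _ _ _ _ _ _ i

theorem HiggsBundle.hasTwoFlags_ofEntries :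
    (HiggsBundle.ofEntries hx S w h1 h2).HasTwoFlags S ![1, 0] ![0, 1] := by
  refine ⟨fun i hi => ?_, fun i hi => ?_⟩ <;>
  simp [HiggsBundle.ofEntries, HiggsBundle.ofResidues, hi]

theorem HiggsBundle.isStable_ofEntries (hi : i₀ ∈ S) (hj : j₀ ∉ S) (hw : ∀ i, w i ≠ 0) :
    (HiggsBundle.ofEntries hx S w h1 h2).IsStable := by
  refine HiggsBundle.isStable_of_flag_ne (fun i h => hw i ?_) (i := i₀) (j := j₀) ?_
  · rw [HiggsBundle.residue_ofEntries] at h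
    have h01 := congrFun (congrFun h 0) 1
    have h10 := congrFun (congrFun h 1) 0
    unfold offDiag at h01 h10
    split_ifs at h01 h10
    · simpa using h01
    · simpa using h10
  · obtain ⟨hS, hSc⟩ := HiggsBundle.hasTwoFlags_ofEntries hx h1 h2
    rw [hS i₀ hi, hSc j₀ hj]
    intro h
    have := det_of_mem_span_singleton (h ▸ Submodule.mem_span_singleton_self ![1, 0])
    simp at this

end

/-- Conjugation by diag(l, l⁻¹) scales the two off-diagonal positions by l² and l⁻². -/
theorem diagonal_mul_offDiag {l : ℂ} (hl : l ≠ 0) {w w' : Fin n → ℂ}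
    (h1 : ∀ i ∈ S, w' i = l ^ 2 * w i) (h2 : ∀ i ∉ S, w' i = (l ^ 2)⁻¹ * w i) (i : Fin n) :
    !![l, 0; 0, l⁻¹] * offDiag S w i = offDiag S w' i * !![l, 0; 0, l⁻¹] := by
  by_cases hi : i ∈ S
  · simp only [offDiag, hi, if_true, h1 i hi, Matrix.mul_fin_two]
    congr 1
    simp
    field_simp
  · simp only [offDiag, hi, if_false, h2 i hi, Matrix.mul_fin_two]
    congr 1
    simp
    field_simp

/-- The stable Higgs bundle with given coordinates. -/
def higgsSection (hx : Function.Injective x) (hi : i₀ ∈ S) (hj : j₀ ∉ S) {d : ℕ}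
    (c : LinearCoordinates S i₀ j₀ d) (u : c.domain) : StableHiggsBundle x :=
  ⟨HiggsBundle.ofEntries hx S (c.entries u) (c.sum_entries u) (c.sum_compl_entries u),
    HiggsBundle.isStable_ofEntries hx _ _ hi hj (c.entries_ne_zero hi hj u.2)⟩

theorem residues_higgsSection (hx : Function.Injective x) (hi : i₀ ∈ S) (hj : j₀ ∉ S) {d : ℕ}
    (c : LinearCoordinates S i₀ j₀ d) (u : c.domain) :
    (higgsSection hx hi hj c u).residues = fun i => offDiag S (c.entries u) i :=
  funext fun i => HiggsBundle.residue_ofEntries hx (c.sum_entries u) (c.sum_compl_entries u) i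

/-- Coordinates on the component of the moduli space of Higgs bundles. -/
theorem higgsComponent_quotientCoordinates (hx : Function.Injective x) (hi : i₀ ∈ S) (hj : j₀ ∉ S)
    {d : ℕ} (c : LinearCoordinates S i₀ j₀ d) :
    SmoothFunctions.QuotientCoordinates (StableHiggsBundle.residues : StableHiggsBundle x → _)
      (higgsSetoid x) (higgsComponent x S) Set.univ (fun N => c.ofTuple (traceCoord S i₀ j₀ N))
      c.domain
      (higgsSection hx hi hj c)
      (fun v i j k => offDiag S (c.entries v) i j k) where
  inducing := ⟨rfl⟩
  isOpen_domain := isOpen_univ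
  mem_domain _ := Set.mem_univ _
  contDiffOn := (c.ofTuple.contDiff.comp contDiff_traceCoord).contDiffOn
  invariant E F hEF := by
    obtain ⟨g, -, hg⟩ := HiggsBundle.Iso.exists_const hEF
    have h1 : g⁻¹.1 * g.1 = 1 := by
      rw [← Matrix.SpecialLinearGroup.coe_mul, inv_mul_cancel]; rfl
    have h2 : g.1 * g⁻¹.1 = 1 := by
      rw [← Matrix.SpecialLinearGroup.coe_mul, mul_inv_cancel]; rfl
    have h3 := traceCoord_conj (S := S) (i₀ := i₀) (j₀ := j₀) (fun i => E.1.residue i) _ _ h1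
    have h4 : (fun i => g.1 * E.1.residue i * g⁻¹.1) = fun i => F.1.residue i := by
      ext1 i
      rw [hg, mul_assoc, h2, mul_one]
    rw [h4] at h3
    exact congrArg c.ofTuple h3.symm
  isOpen := c.isOpen_domain
  section_coe := residues_higgsSection hx hi hj c
  section_contDiffOn := by
    have h := c.contDiffOn_entries hi hj
    rw [contDiffOn_pi] at h ⊢
    intro i
    rw [contDiffOn_pi]
    intro j
    rw [contDiffOn_pi]
    intro k
    unfold offDiag
    split_ifs <;> fin_cases j <;> fin_cases k
    all_goals first | exact h i | exact contDiffOn_const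
  section_mem u := (HiggsBundle.hasTwoFlags_ofEntries hx (c.sum_entries u)
    (c.sum_compl_entries u)).mem_higgsComponent hx (by simp)
  coord_section u := by
    rw [residues_higgsSection, traceCoord_offDiag hi hj, c.ofTuple_pairCoord_entries hi hj u.2]
  section_coord E hE := by
    obtain ⟨v, w, hvw, hE⟩ := exists_hasTwoFlags hE
    obtain ⟨G, r, hr, hr1, hr2, hGr, hf1, hf2⟩ := hE.exists_offDiag hx hvw
    have hG : G⁻¹.1 * G.1 = 1 := by
      rw [← Matrix.SpecialLinearGroup.coe_mul, inv_mul_cancel]; rfl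
    have hG' : G.1 * G⁻¹.1 = 1 := by
      rw [← Matrix.SpecialLinearGroup.coe_mul, mul_inv_cancel]; rfl
    have hk : c.ofTuple (traceCoord S i₀ j₀ (StableHiggsBundle.residues E)) =
        c.ofTuple (pairCoord S i₀ j₀ r) := by
      rw [← traceCoord_offDiag hi hj, ← traceCoord_conj (fun i => offDiag S r i) _ _ hG]
      congr 2
      ext1 i
      rw [← hGr, mul_assoc, hG', mul_one]
      rfl
    obtain ⟨hu, l, hl, hl1, hl2, -⟩ := c.exists_entries_eq hi hj hr hr1 hr2
    rw [← hk] at hu hl1 hl2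
    refine ⟨hu, HiggsBundle.Iso.symm ?_⟩
    -- The isomorphism is G⁻¹, which makes the residues off-diagonal, followed by Λ, which
    -- normalizes their entries.
    let Λ : Matrix.SpecialLinearGroup (Fin 2) ℂ := ⟨!![l, 0; 0, l⁻¹], by
      rw [Matrix.det_fin_two_of]; simp [hl]⟩
    have hflag := HiggsBundle.hasTwoFlags_ofEntries hx (c.sum_entries _) (c.sum_compl_entries
      (c.ofTuple (traceCoord S i₀ j₀ (StableHiggsBundle.residues E))))
    have hΛ0 : Λ.1 *ᵥ ![1, 0] = l • ![1, 0] := by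
      ext j
      fin_cases j <;> simp [Λ, Matrix.mulVec, dotProduct]
    have hΛ1 : Λ.1 *ᵥ ![0, 1] = l⁻¹ • ![0, 1] := by
      ext j
      fin_cases j <;> simp [Λ, Matrix.mulVec, dotProduct]
    have hmap : ∀ u : Fin 2 → ℂ, (Submodule.span ℂ {G.1 *ᵥ u}).map (Matrix.mulVecLin (Λ * G⁻¹).1) =
        Submodule.span ℂ {Λ.1 *ᵥ u} := fun u => by
      rw [Submodule.map_span, Set.image_singleton, Matrix.mulVecLin_apply, Matrix.mulVec_mulVec,
        Matrix.SpecialLinearGroup.coe_mul, mul_assoc, hG, mul_one]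
    refine HiggsBundle.Iso.of_const hx (Λ * G⁻¹) (fun i => ?_) fun i => ?_
    · by_cases h : i ∈ S
      · rw [hf1 i h, hmap, hΛ0, Submodule.span_singleton_smul_eq (IsUnit.mk0 l hl)]
        exact (hflag.1 i h).symm
      · rw [hf2 i h, hmap, hΛ1, Submodule.span_singleton_smul_eq (IsUnit.mk0 _ (inv_ne_zero hl))]
        exact (hflag.2 i h).symm
    · have h0 : (higgsSection hx hi hj c ⟨_, hu⟩).1.residue i = offDiag S (c.entries _) i :=
        HiggsBundle.residue_ofEntries hx (c.sum_entries _) (c.sum_compl_entries _) i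
      rw [h0, Matrix.SpecialLinearGroup.coe_mul]
      have h1 := diagonal_mul_offDiag hl hl1 hl2 i
      have h2 : E.1.residue i = G.1 * offDiag S r i * G⁻¹.1 := by
        rw [← hGr, mul_assoc, hG', mul_one]
      rw [h2, ← mul_assoc, ← mul_assoc, mul_assoc Λ.1, mul_assoc Λ.1, hG, one_mul]
      change !![l, 0; 0, l⁻¹] * offDiag S r i * _ = _
      rw [h1, mul_assoc]

end HiggsComponent

end

noncomputable section

/-! ### The level set of null hyperpolygons and its points in split form. -/

section Hyperpolygon

variable {n : ℕ} {S : Finset (Fin n)} {i₀ j₀ : Fin n}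

theorem tracelessPart_conj (M A B : Matrix (Fin 2) (Fin 2) ℂ) (h : B * A = 1) :
    tracelessPart (B * M * A) = B * tracelessPart M * A := by
  have ht : (B * M * A).trace = M.trace := by
    rw [Matrix.trace_mul_comm, ← mul_assoc, mul_eq_one_comm.1 h, one_mul]
  rw [tracelessPart, tracelessPart, ht, mul_sub, sub_mul, mul_smul_comm, smul_mul_assoc, mul_one, h]

theorem tracelessPart_apply_zero_one (M : Matrix (Fin 2) (Fin 2) ℂ) :
    tracelessPart M 0 1 = M 0 1 := by
  simp [tracelessPart]

theorem tracelessPart_apply_zero_zero (M : Matrix (Fin 2) (Fin 2) ℂ) :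
    tracelessPart M 0 0 = (M 0 0 - M 1 1) / 2 := by
  simp [tracelessPart, Matrix.trace_fin_two]
  ring

theorem tracelessPart_of_trace_eq_zero {M : Matrix (Fin 2) (Fin 2) ℂ} (h : M.trace = 0) :
    tracelessPart M = M := by
  simp [tracelessPart, h]

theorem hermNormSq_nonneg (v : Fin 2 → ℂ) : 0 ≤ hermNormSq v := by
  unfold hermNormSq
  positivity

theorem hermNormSq_eq_zero {v : Fin 2 → ℂ} : hermNormSq v = 0 ↔ v = 0 := by
  constructor
  · intro h
    unfold hermNormSq at h
    have h0 : ‖v 0‖ ^ 2 = 0 := by nlinarith [sq_nonneg ‖v 0‖, sq_nonneg ‖v 1‖]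
    have h1 : ‖v 1‖ ^ 2 = 0 := by nlinarith [sq_nonneg ‖v 0‖, sq_nonneg ‖v 1‖]
    ext j
    fin_cases j
    · simpa using h0
    · simpa using h1
  · rintro rfl
    simp [hermNormSq]

/-- Since p_i q_i = 0 is the vanishing of the trace of q_i p_i, no traceless parts are needed in the
complex equation; and |p_i| = |q_i| reduces the nonvanishing condition to q_i. -/
theorem mem_nullLevelSet_iff {z : CotangentSpace n} : z ∈ nullLevelSet n ↔
    (∑ i, tracelessPart (Matrix.vecMulVec (z.2 i) (star (z.2 i))
      - Matrix.vecMulVec (star (z.1 i)) (z.1 i)) = 0) ∧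
    (∀ i, hermNormSq (z.2 i) = hermNormSq (z.1 i)) ∧
    (∑ i, Matrix.vecMulVec (z.2 i) (z.1 i) = 0) ∧ (∀ i, z.1 i ⬝ᵥ z.2 i = 0) ∧ ∀ i, z.2 i ≠ 0 := by
  have htr : ∀ i, (Matrix.vecMulVec (z.2 i) (z.1 i)).trace = z.1 i ⬝ᵥ z.2 i := fun i => by
    rw [Matrix.trace_vecMulVec, dotProduct_comm]
  have hC : complexMoment z = 0 ↔ (∑ i, Matrix.vecMulVec (z.2 i) (z.1 i) = 0) ∧
      ∀ i, z.1 i ⬝ᵥ z.2 i = 0 := by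
    rw [complexMoment, Prod.mk_eq_zero, funext_iff, and_comm, and_comm (a := ∑ i, _ = _)]
    have h1 : (∀ i, Complex.I * (z.1 i ⬝ᵥ z.2 i) = (0 : Fin n → ℂ) i) ↔
        ∀ i, z.1 i ⬝ᵥ z.2 i = 0 := forall_congr' fun i => by simp
    rw [h1]
    refine and_congr_right fun h => ?_
    rw [smul_eq_zero, Finset.sum_congr rfl fun i _ => tracelessPart_of_trace_eq_zero
      ((htr i).trans (h i))]
    simp
  have hR : realMoment z = 0 ↔ (∑ i, tracelessPart (Matrix.vecMulVec (z.2 i) (star (z.2 i))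
      - Matrix.vecMulVec (star (z.1 i)) (z.1 i)) = 0) ∧
      ∀ i, hermNormSq (z.2 i) = hermNormSq (z.1 i) := by
    rw [realMoment, Prod.mk_eq_zero, funext_iff, smul_eq_zero]
    refine and_congr (by simp) (forall_congr' fun i => ?_)
    simp [sub_eq_zero]
  rw [nullLevelSet, Set.mem_ofPred_eq, hR, hC]
  have hne : (∀ i, hermNormSq (z.2 i) = hermNormSq (z.1 i)) →
      ((∀ i, hermNormSq (z.1 i) + hermNormSq (z.2 i) ≠ 0) ↔ ∀ i, z.2 i ≠ 0) := fun h =>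
    forall_congr' fun i => by
      rw [← h i, ← two_mul, Ne, mul_eq_zero, hermNormSq_eq_zero]
      simp
  constructor
  · rintro ⟨⟨h1, h2⟩, ⟨h3, h4⟩, h5⟩
    exact ⟨h1, h2, h3, h4, (hne h2).1 h5⟩
  · rintro ⟨h1, h2, h3, h4, h5⟩
    exact ⟨⟨h1, h2⟩, ⟨h3, h4⟩, (hne h2).2 h5⟩

/-- The point in split form with given entries. -/
def splitPoint (S : Finset (Fin n)) (β γ : Fin n → ℂ) : CotangentSpace n :=
  (fun i => if i ∈ S then ![0, β i] else ![β i, 0], fun i => if i ∈ S then ![γ i, 0] else ![0, γ i])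

theorem isSplitForm_splitPoint (β γ : Fin n → ℂ) : IsSplitForm S (splitPoint S β γ) := by
  refine ⟨fun i hi => ?_, fun i hi => ?_⟩ <;> simp [splitPoint, hi]

theorem IsSplitForm.eq_splitPoint {z : CotangentSpace n} (h : IsSplitForm S z) :
    z = splitPoint S (fun i => if i ∈ S then z.1 i 1 else z.1 i 0)
      (fun i => if i ∈ S then z.2 i 0 else z.2 i 1) := by
  refine Prod.ext (funext fun i => ?_) (funext fun i => ?_)
  all_goals
    by_cases hi : i ∈ S
    · have := h.1 i hi
      ext j
      fin_cases j <;> simp [splitPoint, hi, this]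
    · have := h.2 i hi
      ext j
      fin_cases j <;> simp [splitPoint, hi, this]

theorem vecMulVec_splitPoint (β γ : Fin n → ℂ) (i : Fin n) :
    Matrix.vecMulVec ((splitPoint S β γ).2 i) ((splitPoint S β γ).1 i) =
      offDiag S (fun i => γ i * β i) i := by
  ext j k
  by_cases hi : i ∈ S <;> fin_cases j <;> fin_cases k <;>
    simp [splitPoint, offDiag, hi, Matrix.vecMulVec_apply]

/-- Once |γ_i| = |β_i|, each summand of the real moment map is ±|γ_i β_i| diag(1, -1), with sign
plus exactly for i ∈ S. -/
theorem splitPoint_mem_nullLevelSet_iff {β γ : Fin n → ℂ} : splitPoint S β γ ∈ nullLevelSet n ↔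
    (∀ i, ‖γ i‖ = ‖β i‖) ∧ (∀ i, γ i ≠ 0) ∧ ∑ i ∈ S, γ i * β i = 0 ∧ ∑ i ∈ Sᶜ, γ i * β i = 0 ∧
      ∑ i ∈ S, ‖γ i * β i‖ = ∑ i ∈ Sᶜ, ‖γ i * β i‖ := by
  have hB : (∀ i, hermNormSq ((splitPoint S β γ).2 i) = hermNormSq ((splitPoint S β γ).1 i)) ↔
      ∀ i, ‖γ i‖ = ‖β i‖ := forall_congr' fun i => by
    by_cases hi : i ∈ S <;> simp [hermNormSq, splitPoint, hi]
  have hC : ∑ i, Matrix.vecMulVec ((splitPoint S β γ).2 i) ((splitPoint S β γ).1 i) = 0 ↔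
      ∑ i ∈ S, γ i * β i = 0 ∧ ∑ i ∈ Sᶜ, γ i * β i = 0 := by
    simp only [vecMulVec_splitPoint, sum_offDiag]
    constructor
    · intro h
      exact ⟨by simpa using congrFun (congrFun h 0) 1, by simpa using congrFun (congrFun h 1) 0⟩
    · rintro ⟨h1, h2⟩
      rw [h1, h2]
      ext j k
      fin_cases j <;> fin_cases k <;> rfl
  have hD : ∀ i, (splitPoint S β γ).1 i ⬝ᵥ (splitPoint S β γ).2 i = 0 := fun i => by
    by_cases hi : i ∈ S <;> simp [splitPoint, hi]
  have hE : (∀ i, (splitPoint S β γ).2 i ≠ 0) ↔ ∀ i, γ i ≠ 0 := forall_congr' fun i => by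
    by_cases hi : i ∈ S <;> simp [splitPoint, hi]
  have hA : (∀ i, ‖γ i‖ = ‖β i‖) → (∑ i, tracelessPart
      (Matrix.vecMulVec ((splitPoint S β γ).2 i) (star ((splitPoint S β γ).2 i))
      - Matrix.vecMulVec (star ((splitPoint S β γ).1 i)) ((splitPoint S β γ).1 i)) = 0 ↔
      ∑ i ∈ S, ‖γ i * β i‖ = ∑ i ∈ Sᶜ, ‖γ i * β i‖) := by
    intro h
    have h1 : ∀ i, tracelessPart
        (Matrix.vecMulVec ((splitPoint S β γ).2 i) (star ((splitPoint S β γ).2 i))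
        - Matrix.vecMulVec (star ((splitPoint S β γ).1 i)) ((splitPoint S β γ).1 i)) =
        ((if i ∈ S then ‖γ i * β i‖ else -‖γ i * β i‖ : ℝ) : ℂ) • !![1, 0; 0, -1] := by
      intro i
      have hγ : γ i * (starRingEnd ℂ) (γ i) = (‖γ i * β i‖ : ℝ) := by
        rw [norm_mul, ← h i, ← sq, Complex.ofReal_pow, Complex.mul_conj']
      have hβ : (starRingEnd ℂ) (β i) * β i = (‖γ i * β i‖ : ℝ) := by
        rw [norm_mul, h i, ← sq, Complex.ofReal_pow, Complex.conj_mul']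
      have h2 : Matrix.vecMulVec ((splitPoint S β γ).2 i) (star ((splitPoint S β γ).2 i))
          - Matrix.vecMulVec (star ((splitPoint S β γ).1 i)) ((splitPoint S β γ).1 i) =
          ((if i ∈ S then ‖γ i * β i‖ else -‖γ i * β i‖ : ℝ) : ℂ) • !![1, 0; 0, -1] := by
        generalize ‖γ i * β i‖ = m at hγ hβ
        ext j k
        rw [Matrix.sub_apply, Matrix.vecMulVec_apply, Matrix.vecMulVec_apply, Matrix.smul_apply]
        by_cases hi : i ∈ S <;> fin_cases j <;> fin_cases k <;> simp [splitPoint, hi, hγ, hβ]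
      rw [h2, tracelessPart_of_trace_eq_zero (by simp [Matrix.trace_fin_two])]
    have hM : (!![1, 0; 0, -1] : Matrix (Fin 2) (Fin 2) ℂ) ≠ 0 := fun h =>
      one_ne_zero (α := ℂ) (congrFun (congrFun h 0) 0)
    rw [Finset.sum_congr rfl fun i _ => h1 i, ← Finset.sum_smul, smul_eq_zero,
      or_iff_left hM, ← Complex.ofReal_sum,
      Complex.ofReal_eq_zero, ← Finset.sum_add_sum_compl S]
    have h3 : ∑ i ∈ S, (if i ∈ S then ‖γ i * β i‖ else -‖γ i * β i‖) = ∑ i ∈ S, ‖γ i * β i‖ :=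
      Finset.sum_congr rfl fun i hi => if_pos hi
    have h4 : ∑ i ∈ Sᶜ, (if i ∈ S then ‖γ i * β i‖ else -‖γ i * β i‖) = -∑ i ∈ Sᶜ, ‖γ i * β i‖ := by
      rw [← Finset.sum_neg_distrib]
      exact Finset.sum_congr rfl fun i hi => if_neg (Finset.mem_compl.1 hi)
    rw [h3, h4, ← sub_eq_add_neg, sub_eq_zero]
  rw [mem_nullLevelSet_iff, hB, hC, hE]
  constructor
  · rintro ⟨h1, h2, ⟨h3, h4⟩, -, h5⟩
    exact ⟨h2, h5, h3, h4, (hA h2).1 h1⟩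
  · rintro ⟨h1, h2, h3, h4, h5⟩
    exact ⟨(hA h1).2 h5, h1, ⟨h3, h4⟩, hD, h2⟩

/-- The matrices of `SU(2)`. -/
def su2 (a b : ℂ) (h : ‖a‖ ^ 2 + ‖b‖ ^ 2 = 1) : Matrix.specialUnitaryGroup (Fin 2) ℂ :=
  ⟨!![a, -(starRingEnd ℂ) b; b, (starRingEnd ℂ) a], by
    have h' : (starRingEnd ℂ) a * a + (starRingEnd ℂ) b * b = 1 := by
      rw [Complex.conj_mul', Complex.conj_mul']
      exact_mod_cast h
    rw [Matrix.mem_specialUnitaryGroup_iff, Matrix.mem_unitaryGroup_iff']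
    refine ⟨?_, ?_⟩
    · ext j k
      fin_cases j <;> fin_cases k <;>
        simp [Matrix.mul_apply, Matrix.star_apply, Fin.sum_univ_two]
      · linear_combination h'
      · ring
      · ring
      · linear_combination h'
    · rw [Matrix.det_fin_two_of]
      linear_combination h'⟩

theorem SameOrbitK.isStraight {T : Finset (Fin n)} {z z' : CotangentSpace n} (h : SameOrbitK z z')
    (hz : IsStraight T z) : IsStraight T z' := by
  obtain ⟨A, e, h⟩ := h
  intro i hi j hj
  obtain ⟨c, hc⟩ := hz i hi j hj
  refine ⟨e i * c * (e j : ℂ)⁻¹, ?_⟩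
  rw [(h i).2, (h j).2, hc, Matrix.mulVec_smul, smul_smul, smul_smul, mul_assoc _ _ (e j : ℂ),
    inv_mul_cancel₀ (Circle.coe_ne_zero _), mul_one]

/-- The phases e_i cancel in q_i p_i, so traces of products of these matrices are invariants of `K`.
-/
theorem SameOrbitK.vecMulVec {z z' : CotangentSpace n} {A : Matrix.specialUnitaryGroup (Fin 2) ℂ}
    {e : Fin n → Circle} (h : ∀ i, z'.1 i = (e i : ℂ)⁻¹ • (z.1 i ᵥ* A.1) ∧
      z'.2 i = (e i : ℂ) • ((A⁻¹).1 *ᵥ z.2 i)) (i : Fin n) :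
    Matrix.vecMulVec (z'.2 i) (z'.1 i) = (A⁻¹).1 * Matrix.vecMulVec (z.2 i) (z.1 i) * A.1 := by
  rw [(h i).1, (h i).2, Matrix.mul_vecMulVec, Matrix.vecMulVec_mul, Matrix.smul_vecMulVec,
    Matrix.vecMulVec_smul, smul_smul, mul_inv_cancel₀ (Circle.coe_ne_zero _), one_smul]

theorem specialUnitaryGroup_inv_mul (A : Matrix.specialUnitaryGroup (Fin 2) ℂ) :
    (A⁻¹).1 * A.1 = 1 := by
  rw [← Submonoid.coe_mul, inv_mul_cancel]; rfl

theorem specialUnitaryGroup_mul_inv (A : Matrix.specialUnitaryGroup (Fin 2) ℂ) :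
    A.1 * (A⁻¹).1 = 1 := by
  rw [← Submonoid.coe_mul, mul_inv_cancel]; rfl

theorem hermNormSq_eq (v : Fin 2 → ℂ) : (hermNormSq v : ℂ) = star v ⬝ᵥ v := by
  simp [hermNormSq, dotProduct, Fin.sum_univ_two, Complex.conj_mul']

theorem smul_circle_vecMulVec_star (e : Circle) (q : Fin 2 → ℂ) :
    Matrix.vecMulVec ((e : ℂ) • q) (star ((e : ℂ) • q)) = Matrix.vecMulVec q (star q) := by
  have he : (e : ℂ) * star (e : ℂ) = 1 := by
    change (e : ℂ) * (starRingEnd ℂ) (e : ℂ) = 1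
    rw [Complex.mul_conj', Circle.norm_coe]
    simp
  rw [star_smul, Matrix.smul_vecMulVec, Matrix.vecMulVec_smul, smul_smul, he, one_smul]

theorem SameOrbitK.vecMulVec_star {z z' : CotangentSpace n}
    {A : Matrix.specialUnitaryGroup (Fin 2) ℂ} {e : Fin n → Circle}
    (h : ∀ i, z'.1 i = (e i : ℂ)⁻¹ • (z.1 i ᵥ* A.1) ∧
      z'.2 i = (e i : ℂ) • ((A⁻¹).1 *ᵥ z.2 i)) (i : Fin n) :
    Matrix.vecMulVec (z'.2 i) (star (z'.2 i)) - Matrix.vecMulVec (star (z'.1 i)) (z'.1 i) =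
      (A⁻¹).1 * (Matrix.vecMulVec (z.2 i) (star (z.2 i)) -
        Matrix.vecMulVec (star (z.1 i)) (z.1 i)) *
        A.1 := by
  have hA : (A⁻¹).1 = (A.1)ᴴ := rfl
  have h1 := smul_circle_vecMulVec_star (e i) ((A⁻¹).1 *ᵥ z.2 i)
  -- The conjugate of e⁻¹ is e, so p_i^* picks up the same phase as q_i and both terms are handled
  -- alike.
  have h2 := smul_circle_vecMulVec_star (e i) (star (z.1 i ᵥ* A.1))
  have h3 : star ((e i : ℂ)⁻¹ • (z.1 i ᵥ* A.1)) = (e i : ℂ) • star (z.1 i ᵥ* A.1) := by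
    rw [star_smul]
    congr 1
    rw [← Circle.coe_inv, Circle.coe_inv_eq_conj]
    exact star_star _
  rw [(h i).2, h1]
  rw [(h i).1, h3]
  rw [← h3, star_star] at h2
  rw [h3] at h2
  rw [h2, star_star, Matrix.star_mulVec, Matrix.star_vecMul, mul_sub, sub_mul, Matrix.mul_vecMulVec,
    Matrix.vecMulVec_mul, Matrix.mul_vecMulVec, Matrix.vecMulVec_mul, hA,
    Matrix.conjTranspose_conjTranspose]

/-- The matrices in the moment maps are conjugated by the unitary matrix `A` and the phases drop
out. This allows a representative to be put in split form inside the level set. -/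
theorem SameOrbitK.mem_nullLevelSet {z z' : CotangentSpace n} (h : SameOrbitK z z')
    (hz : z ∈ nullLevelSet n) : z' ∈ nullLevelSet n := by
  obtain ⟨A, e, h⟩ := h
  rw [mem_nullLevelSet_iff] at hz ⊢
  obtain ⟨h1, h2, h3, h4, h5⟩ := hz
  have hA : (A⁻¹).1 = (A.1)ᴴ := rfl
  have htr : ∀ i, (Matrix.vecMulVec (z.2 i) (star (z.2 i)) -
      Matrix.vecMulVec (star (z.1 i)) (z.1 i)).trace =
      (hermNormSq (z.2 i) : ℂ) - hermNormSq (z.1 i) := fun i => by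
    rw [Matrix.trace_sub, Matrix.trace_vecMulVec, Matrix.trace_vecMulVec, dotProduct_comm,
      ← hermNormSq_eq, ← hermNormSq_eq]
  have htr' : ∀ i, (Matrix.vecMulVec (z'.2 i) (star (z'.2 i)) -
      Matrix.vecMulVec (star (z'.1 i)) (z'.1 i)).trace =
      (hermNormSq (z'.2 i) : ℂ) - hermNormSq (z'.1 i) := fun i => by
    rw [Matrix.trace_sub, Matrix.trace_vecMulVec, Matrix.trace_vecMulVec, dotProduct_comm,
      ← hermNormSq_eq, ← hermNormSq_eq]
  have hconj : ∀ M : Matrix (Fin 2) (Fin 2) ℂ, ((A⁻¹).1 * M * A.1).trace = M.trace := fun M => by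
    rw [Matrix.trace_mul_comm, ← mul_assoc, specialUnitaryGroup_mul_inv, one_mul]
  refine ⟨?_, fun i => ?_, ?_, fun i => ?_, fun i hi => h5 i ?_⟩
  · simp only [SameOrbitK.vecMulVec_star h,
      tracelessPart_conj _ _ _ (specialUnitaryGroup_inv_mul A)]
    rw [← Finset.sum_mul, ← Finset.mul_sum, h1, mul_zero, zero_mul]
  · have := htr' i
    rw [SameOrbitK.vecMulVec_star h, hconj, htr, h2, sub_self] at this
    exact_mod_cast (sub_eq_zero.1 this.symm)
  · simp only [SameOrbitK.vecMulVec h]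
    rw [← Finset.sum_mul, ← Finset.mul_sum, h3, mul_zero, zero_mul]
  · rw [dotProduct_comm, ← Matrix.trace_vecMulVec, SameOrbitK.vecMulVec h, hconj,
      Matrix.trace_vecMulVec, dotProduct_comm, h4]
  · rw [(h i).2, smul_eq_zero] at hi
    have h6 := hi.resolve_left (Circle.coe_ne_zero _)
    rw [← Matrix.one_mulVec (z.2 i), ← specialUnitaryGroup_mul_inv A, ← Matrix.mulVec_mulVec, h6,
      Matrix.mulVec_zero]

end Hyperpolygon

end

noncomputable section

/-! ### The component of the space of null hyperpolygons. -/

section HyperpolygonComponent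

variable {n : ℕ} {S : Finset (Fin n)} {i₀ j₀ : Fin n}

/-- A hyperpolygon whose `q_i` are multiples of the first coordinate vector for `i ∈ S`, and of one
fixed vector for the other `i`, is in split form. -/
theorem isSplitForm_of_isStraight (hj : j₀ ∉ S) {z : CotangentSpace n} (hz : z ∈ nullLevelSet n)
    (hS : ∀ i ∈ S, z.2 i 1 = 0) (hSc : IsStraight Sᶜ z) : IsSplitForm S z := by
  rw [mem_nullLevelSet_iff] at hz
  obtain ⟨h1, -, -, h4, h5⟩ := hz
  have hdot : ∀ i, z.1 i 0 * z.2 i 0 + z.1 i 1 * z.2 i 1 = 0 := fun i => by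
    have := h4 i
    rwa [dotProduct, Fin.sum_univ_two] at this
  have hp : ∀ i, z.2 i 1 = 0 → z.1 i 0 = 0 := fun i hi => by
    have h6 := hdot i
    rw [hi, mul_zero, add_zero, mul_eq_zero] at h6
    refine h6.resolve_right fun h0 => h5 i ?_
    ext j
    fin_cases j
    exacts [h0, hi]
  have hp' : ∀ i, z.2 i 0 = 0 → z.1 i 1 = 0 := fun i hi => by
    have h6 := hdot i
    rw [hi, mul_zero, zero_add, mul_eq_zero] at h6
    refine h6.resolve_right fun h0 => h5 i ?_
    ext j
    fin_cases j
    exacts [hi, h0]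
  have hq : ∀ i ∉ S, ∃ t : ℂ, z.2 i = t • z.2 j₀ := fun i hi =>
    hSc i (Finset.mem_compl.2 hi) j₀ (Finset.mem_compl.2 hj)
  have hent : ∀ j k, ∑ i, tracelessPart (Matrix.vecMulVec (z.2 i) (star (z.2 i))
      - Matrix.vecMulVec (star (z.1 i)) (z.1 i)) j k = 0 := fun j k => by
    rw [← Matrix.sum_apply, h1]
    rfl
  -- If all q_i were multiples of the first coordinate vector, every summand of the upper left entry
  -- of the real moment map would be positive.
  by_cases hδ : z.2 j₀ 1 = 0
  · exfalso
    have hall : ∀ i, z.2 i 1 = 0 := fun i => by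
      by_cases hi : i ∈ S
      · exact hS i hi
      · obtain ⟨t, ht⟩ := hq i hi
        rw [ht, Pi.smul_apply, hδ, smul_zero]
    have h00 := hent 0 0
    simp only [tracelessPart_apply_zero_zero, Matrix.sub_apply, Matrix.vecMulVec_apply,
      Pi.star_apply, hall, hp _ (hall _), star_zero, mul_zero, sub_zero, zero_sub,
      RCLike.star_def, Complex.mul_conj', Complex.conj_mul'] at h00
    have hpos : 0 < ∑ i, (‖z.2 i 0‖ ^ 2 - -‖z.1 i 1‖ ^ 2) / 2 := by
      refine Finset.sum_pos (fun i _ => ?_) ⟨j₀, Finset.mem_univ _⟩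
      have h0 : z.2 i 0 ≠ 0 := fun h0 => h5 i (by
        ext j
        fin_cases j
        exacts [h0, hall i])
      have := norm_pos_iff.2 h0
      rw [sub_neg_eq_add]
      positivity
    exact hpos.ne' (by exact_mod_cast h00)
  · have hα : z.2 j₀ 0 = 0 := by
      have h01 := hent 0 1
      simp only [tracelessPart_apply_zero_one, Matrix.sub_apply, Matrix.vecMulVec_apply,
        Pi.star_apply, RCLike.star_def] at h01
      -- For i ∉ S, q_i lies on the line of q_{j₀} and p_i annihilates it, so the upper right
      -- entries are nonnegative multiples of one number. Their sum vanishes while the coefficient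
      -- at j₀ is positive; hence this number is zero, and the two lines are orthogonal.
      have hterm : ∀ i, ∃ r : ℝ, 0 ≤ r ∧ (i = j₀ → 0 < r) ∧
          z.2 i 0 * (starRingEnd ℂ) (z.2 i 1) - (starRingEnd ℂ) (z.1 i 0) * z.1 i 1 =
            z.2 j₀ 0 / z.2 j₀ 1 * r := by
        intro i
        by_cases hi : i ∈ S
        · refine ⟨0, le_rfl, fun h => absurd (h ▸ hi) hj, ?_⟩
          simp [hS i hi, hp i (hS i hi)]
        · obtain ⟨t, ht⟩ := hq i hi
          refine ⟨‖z.2 i 1‖ ^ 2 + ‖z.1 i 0‖ ^ 2, by positivity, ?_, ?_⟩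
          · rintro rfl
            have := norm_pos_iff.2 hδ
            positivity
          · have ht0 : t ≠ 0 := fun h => h5 i (by rw [ht, h, zero_smul])
            have h6 := hdot i
            rw [ht] at h6 ⊢
            simp only [Pi.smul_apply, smul_eq_mul] at h6 ⊢
            have h7 : z.1 i 0 * z.2 j₀ 0 + z.1 i 1 * z.2 j₀ 1 = 0 := by
              apply mul_left_cancel₀ ht0
              linear_combination h6
            have h8 : z.1 i 1 = -(z.1 i 0 * z.2 j₀ 0) / z.2 j₀ 1 := by
              rw [eq_div_iff hδ]
              linear_combination h7
            push_cast
            rw [← Complex.mul_conj', ← Complex.conj_mul', h8]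
            field_simp
            ring
      choose r hr1 hr2 hr3 using hterm
      have hpos : 0 < ∑ i, r i :=
        Finset.sum_pos' (fun i _ => hr1 i) ⟨j₀, Finset.mem_univ _, hr2 j₀ rfl⟩
      rw [Finset.sum_congr rfl fun i _ => hr3 i, ← Finset.mul_sum, ← Complex.ofReal_sum,
        mul_eq_zero, Complex.ofReal_eq_zero, or_iff_left hpos.ne', div_eq_zero_iff,
        or_iff_left hδ] at h01
      exact h01
    refine ⟨fun i hi => ⟨hp i (hS i hi), hS i hi⟩, fun i hi => ?_⟩
    obtain ⟨t, ht⟩ := hq i hi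
    have h0 : z.2 i 0 = 0 := by rw [ht, Pi.smul_apply, hα, smul_zero]
    exact ⟨hp' i h0, h0⟩

/-- The matrix in SU(2) with first column q_{i₀} / |q_{i₀}| moves the line of the q_i, i ∈ S, to the
first axis; the moment map equations do the rest, by `isSplitForm_of_isStraight`. -/
theorem exists_isSplitForm (hi : i₀ ∈ S) (hj : j₀ ∉ S) {z : CotangentSpace n}
    (hz : z ∈ nullLevelSet n) (hS : IsStraight S z) (hSc : IsStraight Sᶜ z) :
    ∃ z', SameOrbitK z z' ∧ z' ∈ nullLevelSet n ∧ IsSplitForm S z' := by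
  set q := z.2 i₀ with hq
  have hq0 : q ≠ 0 := (mem_nullLevelSet_iff.1 hz).2.2.2.2 i₀
  have hN : 0 < hermNormSq q := (hermNormSq_nonneg q).lt_of_ne' (hermNormSq_eq_zero.not.2 hq0)
  set N := Real.sqrt (hermNormSq q)
  have hN0 : 0 < N := Real.sqrt_pos.2 hN
  have hN2 : N ^ 2 = hermNormSq q := Real.sq_sqrt hN.le
  let A := su2 (q 0 / N) (q 1 / N) (by
    rw [norm_div, norm_div, Complex.norm_real, Real.norm_eq_abs, abs_of_pos hN0, div_pow, div_pow,
      hN2, ← add_div]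
    exact div_self hN.ne')
  let z' : CotangentSpace n := (fun i => z.1 i ᵥ* A.1, fun i => (A⁻¹).1 *ᵥ z.2 i)
  have hzz : SameOrbitK z z' := ⟨A, 1, fun i => by simp [z']⟩
  have hz' := hzz.mem_nullLevelSet hz
  refine ⟨z', hzz, hz', isSplitForm_of_isStraight hj hz' (fun i hiS => ?_) (hzz.isStraight hSc)⟩
  obtain ⟨c, hc⟩ := hzz.isStraight hS i hiS i₀ hi
  have h1 : z'.2 i₀ 1 = 0 := by
    change ((star A.1) *ᵥ q) 1 = 0
    simp only [Matrix.mulVec, dotProduct, Fin.sum_univ_two, Matrix.star_apply]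
    simp [A, su2]
    ring
  rw [hc, Pi.smul_apply, h1, smul_zero]

theorem IsSplitForm.isStraight {z : CotangentSpace n} (hz : z ∈ nullLevelSet n)
    (h : IsSplitForm S z) : IsStraight S z ∧ IsStraight Sᶜ z := by
  have h5 := (mem_nullLevelSet_iff.1 hz).2.2.2.2
  refine ⟨fun i hi j hj => ⟨z.2 i 0 / z.2 j 0, ?_⟩, fun i hi j hj => ⟨z.2 i 1 / z.2 j 1, ?_⟩⟩
  · have hj0 : z.2 j 0 ≠ 0 := fun h0 => h5 j (by
      ext k
      fin_cases k
      exacts [h0, (h.1 j hj).2])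
    ext k
    fin_cases k
    · simp [hj0]
    · simp [(h.1 j hj).2, (h.1 i hi).2]
  · rw [Finset.mem_compl] at hi hj
    have hj1 : z.2 j 1 ≠ 0 := fun h1 => h5 j (by
      ext k
      fin_cases k
      exacts [(h.2 j hj).2, h1])
    ext k
    fin_cases k
    · simp [(h.2 j hj).2, (h.2 i hi).2]
    · simp [hj1]

theorem mem_hyperpolygonComponent_iff {z : nullLevelSet n} :
    Quotient.mk (orbitSetoidK n) z ∈ hyperpolygonComponent S ↔
      IsStraight S z.1 ∧ IsStraight Sᶜ z.1 := by
  constructor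
  · rintro ⟨z', hz', h1, h2⟩
    have h : SameOrbitK z'.1 z.1 := Quotient.exact hz'
    exact ⟨h.isStraight h1, h.isStraight h2⟩
  · exact fun h => ⟨z, rfl, h⟩

/-- The residues `q_i p_i`. -/
def hyperResidues (z : CotangentSpace n) : Fin n → Fin 2 → Fin 2 → ℂ :=
  fun i => Matrix.vecMulVec (z.2 i) (z.1 i)

theorem contDiff_hyperResidues : ContDiff ℝ ∞ (hyperResidues (n := n)) := by
  rw [contDiff_pi]
  intro i
  rw [contDiff_pi]
  intro j
  rw [contDiff_pi]
  intro k
  simp only [hyperResidues, Matrix.vecMulVec_apply]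
  fun_prop

theorem traceCoord_splitPoint (hi : i₀ ∈ S) (hj : j₀ ∉ S) (β γ : Fin n → ℂ) :
    traceCoord S i₀ j₀ (hyperResidues (splitPoint S β γ)) =
      pairCoord S i₀ j₀ (fun i => γ i * β i) := by
  rw [← traceCoord_offDiag hi hj]
  congr 1
  ext1 i
  exact vecMulVec_splitPoint β γ i

theorem SameOrbitK.traceCoord_eq {z z' : CotangentSpace n} (h : SameOrbitK z z') :
    traceCoord S i₀ j₀ (hyperResidues z) = traceCoord S i₀ j₀ (hyperResidues z') := by
  obtain ⟨A, e, h⟩ := h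
  have h1 := traceCoord_conj (S := S) (i₀ := i₀) (j₀ := j₀)
    (fun i => Matrix.vecMulVec (z.2 i) (z.1 i)) _ _ (specialUnitaryGroup_mul_inv A)
  have h2 : hyperResidues z' = fun i => (A⁻¹).1 * Matrix.vecMulVec (z.2 i) (z.1 i) * A.1 :=
    funext fun i => SameOrbitK.vecMulVec h i
  rw [h2, h1]
  rfl

/-- The point in split form with `q_i p_i` given by `w_i` and with positive entries of `q_i`. -/
def splitSection (S : Finset (Fin n)) (w : Fin n → ℂ) : CotangentSpace n :=
  splitPoint S (fun i => w i / Real.sqrt ‖w i‖) (fun i => (Real.sqrt ‖w i‖ : ℂ))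

theorem sqrt_norm_ne_zero {w : ℂ} (hw : w ≠ 0) : (Real.sqrt ‖w‖ : ℂ) ≠ 0 := by
  exact_mod_cast (Real.sqrt_pos.2 (norm_pos_iff.2 hw)).ne'

theorem splitSection_mem {w : Fin n → ℂ} (hw : ∀ i, w i ≠ 0) (h1 : ∑ i ∈ S, w i = 0)
    (h2 : ∑ i ∈ Sᶜ, w i = 0) (h3 : ∑ i ∈ S, ‖w i‖ = ∑ i ∈ Sᶜ, ‖w i‖) :
    splitSection S w ∈ nullLevelSet n := by
  rw [splitSection, splitPoint_mem_nullLevelSet_iff]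
  have hmul : ∀ i, (Real.sqrt ‖w i‖ : ℂ) * (w i / Real.sqrt ‖w i‖) = w i := fun i =>
    mul_div_cancel₀ _ (sqrt_norm_ne_zero (hw i))
  simp only [hmul]
  refine ⟨fun i => ?_, fun i => sqrt_norm_ne_zero (hw i), h1, h2, h3⟩
  rw [norm_div, Complex.norm_real, Real.norm_eq_abs, abs_of_nonneg (Real.sqrt_nonneg _),
    Real.div_sqrt]

theorem contDiffAt_splitSection {w : Fin n → ℂ} (hw : ∀ i, w i ≠ 0) :
    ContDiffAt ℝ ∞ (splitSection S) w := by
  have h0 : ∀ i, ContDiffAt ℝ ∞ (fun w : Fin n → ℂ => w i) w := fun i =>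
    (contDiff_apply ℝ ℂ i).contDiffAt
  have h1 : ∀ i, ContDiffAt ℝ ∞ (fun w : Fin n → ℂ => (Real.sqrt ‖w i‖ : ℂ)) w := fun i =>
    Complex.ofRealCLM.contDiff.contDiffAt.comp w
      (((h0 i).norm ℝ (hw i)).sqrt (norm_ne_zero_iff.2 (hw i)))
  have h2 : ∀ i, ContDiffAt ℝ ∞ (fun w : Fin n → ℂ => w i / (Real.sqrt ‖w i‖ : ℂ)) w := fun i => by
    simp only [div_eq_mul_inv]
    exact (h0 i).mul ((h1 i).inv (sqrt_norm_ne_zero (hw i)))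
  unfold splitSection splitPoint
  refine ContDiffAt.prodMk ?_ ?_
  all_goals
    rw [contDiffAt_pi]
    intro i
    rw [contDiffAt_pi]
    intro j
    split_ifs <;> fin_cases j
    all_goals first | exact h1 i | exact h2 i | exact contDiffAt_const

/-- Split points whose entries are related by the action of the diagonal matrices are in the same
orbit. -/
theorem sameOrbitK_splitPoint {β γ β' γ' : Fin n → ℂ} {l : ℂ} (hl : ‖l‖ = 1)
    (hγ : ∀ i, γ i ≠ 0) (hγ' : ∀ i, γ' i ≠ 0) (hn : ∀ i, ‖γ' i‖ = ‖γ i‖)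
    (h1 : ∀ i ∈ S, γ' i * β' i = l ^ 2 * (γ i * β i))
    (h2 : ∀ i ∉ S, γ' i * β' i = (l ^ 2)⁻¹ * (γ i * β i)) :
    SameOrbitK (splitPoint S β γ) (splitPoint S β' γ') := by
  have hl0 : l ≠ 0 := fun h => by simp [h] at hl
  have hconj : (starRingEnd ℂ) l = l⁻¹ := (Complex.inv_eq_conj hl).symm
  have hunit : ∀ i, ‖γ' i / γ i * (if i ∈ S then l⁻¹ else l)‖ = 1 := fun i => by
    have : ‖(if i ∈ S then l⁻¹ else l)‖ = 1 := by split_ifs <;> simp [hl]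
    rw [norm_mul, this, norm_div, hn, div_self (norm_ne_zero_iff.2 (hγ i)), mul_one]
  -- The inverse diag(l, l⁻¹) multiplies q_i by l or l⁻¹; the phase corrects the result to γ'_i, and
  -- p_i is then right because the products match.
  refine ⟨su2 l⁻¹ 0 (by simp [hl]), fun i => ⟨_, mem_sphere_zero_iff_norm.2 (hunit i)⟩, fun i => ?_⟩
  have hA : ((su2 l⁻¹ 0 (by simp [hl])).1 : Matrix (Fin 2) (Fin 2) ℂ) = !![l⁻¹, 0; 0, l] := by
    simp [su2, hconj]
  have hA' : (((su2 l⁻¹ 0 (by simp [hl]))⁻¹).1 : Matrix (Fin 2) (Fin 2) ℂ) = !![l, 0; 0, l⁻¹] := by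
    change star (su2 l⁻¹ 0 _).1 = _
    rw [hA]
    ext j k
    fin_cases j <;> fin_cases k <;> simp [Matrix.star_apply, hconj]
  rw [hA, hA']
  have hg := hγ i
  have hg' := hγ' i
  by_cases hi : i ∈ S
  · have h3 : β' i = l ^ 2 * (γ i * β i) / γ' i := by
      rw [eq_div_iff hg', ← h1 i hi]
      ring
    constructor
    · ext j
      fin_cases j
      · simp [splitPoint, hi]
      · simp [splitPoint, hi, h3]
        field_simp
    · ext j
      fin_cases j
      · simp [splitPoint, hi]
        field_simp
      · simp [splitPoint, hi]
  · have h3 : β' i = (l ^ 2)⁻¹ * (γ i * β i) / γ' i := by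
      rw [eq_div_iff hg', ← h2 i hi]
      ring
    constructor
    · ext j
      fin_cases j
      · simp [splitPoint, hi, h3]
        field_simp
      · simp [splitPoint, hi]
    · ext j
      fin_cases j
      · simp [splitPoint, hi]
      · simp [splitPoint, hi]
        field_simp

/-- The hyperpolygon with given coordinates. -/
def hyperSection (hi : i₀ ∈ S) (hj : j₀ ∉ S) {d : ℕ} (c : LinearCoordinates S i₀ j₀ d)
    (u : c.domain) : nullLevelSet n :=
  ⟨splitSection S (c.entries u), splitSection_mem (c.entries_ne_zero hi hj u.2) (c.sum_entries u)
    (c.sum_compl_entries u) (c.sum_norm_entries hi hj u.2)⟩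

/-- Coordinates on the component of the space of null hyperpolygons. -/
theorem hyperpolygonComponent_quotientCoordinates (hi : i₀ ∈ S) (hj : j₀ ∉ S) {d : ℕ}
    (c : LinearCoordinates S i₀ j₀ d) :
    SmoothFunctions.QuotientCoordinates (fun z : nullLevelSet n => (z : CotangentSpace n))
      (orbitSetoidK n) (hyperpolygonComponent S) Set.univ
      (fun z => c.ofTuple (traceCoord S i₀ j₀ (hyperResidues z))) c.domain (hyperSection hi hj c)
      (fun v => splitSection S (c.entries v)) where
  inducing := Topology.IsInducing.subtypeVal
  isOpen_domain := isOpen_univ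
  mem_domain _ := Set.mem_univ _
  contDiffOn := (c.ofTuple.contDiff.comp
    (contDiff_traceCoord.comp contDiff_hyperResidues)).contDiffOn
  invariant z z' h := congrArg c.ofTuple (SameOrbitK.traceCoord_eq h)
  isOpen := c.isOpen_domain
  section_coe _ := rfl
  section_contDiffOn v hv := (contDiffAt_splitSection
    (c.entries_ne_zero hi hj hv)).comp_contDiffWithinAt v (c.contDiffOn_entries hi hj v hv)
  section_mem u := mem_hyperpolygonComponent_iff.2
    ((isSplitForm_splitPoint _ _).isStraight (hyperSection hi hj c u).2)
  coord_section u := by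
    have h : ∀ i, (Real.sqrt ‖c.entries u i‖ : ℂ) * (c.entries u i / Real.sqrt ‖c.entries u i‖) =
        c.entries u i := fun i =>
      mul_div_cancel₀ _ (sqrt_norm_ne_zero (c.entries_ne_zero hi hj u.2 i))
    change c.ofTuple (traceCoord S i₀ j₀ (hyperResidues (splitSection S (c.entries u)))) = u
    rw [splitSection, traceCoord_splitPoint hi hj]
    simp only [h]
    exact c.ofTuple_pairCoord_entries hi hj u.2
  section_coord z hz := by
    obtain ⟨h1, h2⟩ := mem_hyperpolygonComponent_iff.1 hz
    obtain ⟨z', hzz, hz', hs⟩ := exists_isSplitForm hi hj z.2 h1 h2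
    rw [hs.eq_splitPoint] at hzz hz'
    revert hzz hz'
    generalize (fun i => if i ∈ S then z'.1 i 1 else z'.1 i 0) = β
    generalize (fun i => if i ∈ S then z'.2 i 0 else z'.2 i 1) = γ
    intro hzz hz'
    obtain ⟨hn, hγ, hs1, hs2, hs3⟩ := splitPoint_mem_nullLevelSet_iff.1 hz'
    have hβ : ∀ i, β i ≠ 0 := fun i => norm_ne_zero_iff.1 (hn i ▸ norm_ne_zero_iff.2 (hγ i))
    have hk : c.ofTuple (traceCoord S i₀ j₀ (hyperResidues z.1)) =
        c.ofTuple (pairCoord S i₀ j₀ fun i => γ i * β i) := by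
      rw [hzz.traceCoord_eq, traceCoord_splitPoint hi hj]
    obtain ⟨hu, l, hl, hl1, hl2, hl3⟩ :=
      c.exists_entries_eq hi hj (fun i => mul_ne_zero (hγ i) (hβ i)) hs1 hs2
    rw [← hk] at hu hl1 hl2
    refine ⟨hu, (orbitSetoidK n).symm ((orbitSetoidK n).trans
      (b := ⟨_, hz'⟩) hzz (sameOrbitK_splitPoint (hl3 hs3) hγ
        (fun i => sqrt_norm_ne_zero (c.entries_ne_zero hi hj hu i)) (fun i => ?_)
        (fun i h => ?_) fun i h => ?_))⟩
    -- The normalization gives |l| = 1, so entries have the absolute value |γ_i β_i| = |γ_i|², and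
    -- the square root chosen by the section is |γ_i|.
    · have h4 : ‖c.entries (c.ofTuple (traceCoord S i₀ j₀ (hyperResidues z.1))) i‖ = ‖γ i‖ ^ 2 := by
        by_cases h : i ∈ S
        · rw [hl1 i h, norm_mul, norm_pow, hl3 hs3, norm_mul, ← hn]
          ring
        · rw [hl2 i h, norm_mul, norm_inv, norm_pow, hl3 hs3, norm_mul, ← hn]
          ring
      rw [Complex.norm_real, Real.norm_eq_abs, abs_of_nonneg (Real.sqrt_nonneg _), h4,
        Real.sqrt_sq (norm_nonneg _)]
    · rw [mul_div_cancel₀ _ (sqrt_norm_ne_zero (c.entries_ne_zero hi hj hu i)), ← hl1 i h]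
    · rw [mul_div_cancel₀ _ (sqrt_norm_ne_zero (c.entries_ne_zero hi hj hu i)), ← hl2 i h]

end HyperpolygonComponent

end

noncomputable section

/-! ## Null polygons: invariants and the action of `SU(1,1)` -/

section Minkowski

theorem minkowski_comm (v w : Fin 3 → ℝ) : minkowski v w = minkowski w v := by
  simp only [minkowski]
  ring

theorem minkowski_sum_left {ι : Type*} (T : Finset ι) (v : ι → Fin 3 → ℝ) (w : Fin 3 → ℝ) :
    minkowski (∑ i ∈ T, v i) w = ∑ i ∈ T, minkowski (v i) w := by
  simp only [minkowski, Finset.sum_apply, Finset.sum_mul, Finset.sum_add_distrib,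
    Finset.sum_sub_distrib, Finset.sum_neg_distrib]

theorem minkowski_sum_right {ι : Type*} (T : Finset ι) (v : Fin 3 → ℝ) (w : ι → Fin 3 → ℝ) :
    minkowski v (∑ i ∈ T, w i) = ∑ i ∈ T, minkowski v (w i) := by
  simp only [minkowski_comm v, minkowski_sum_left]

theorem minkowski_neg_left (v w : Fin 3 → ℝ) : minkowski (-v) w = -minkowski v w := by
  simp only [minkowski, Pi.neg_apply]
  ring

theorem minkowski_smul_right (c : ℝ) (v w : Fin 3 → ℝ) :
    minkowski v (c • w) = c * minkowski v w := by
  simp only [minkowski, Pi.smul_apply, smul_eq_mul]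
  ring

/-- The complex number formed by the space-like components. -/
def planePart (v : Fin 3 → ℝ) : ℂ := ⟨v 0, v 1⟩

theorem planePart_sum {ι : Type*} (T : Finset ι) (v : ι → Fin 3 → ℝ) :
    planePart (∑ i ∈ T, v i) = ∑ i ∈ T, planePart (v i) := by
  apply Complex.ext <;> simp [planePart]

theorem minkowski_self_eq (v : Fin 3 → ℝ) : minkowski v v = v 2 ^ 2 - ‖planePart v‖ ^ 2 := by
  rw [← Complex.normSq_eq_norm_sq, Complex.normSq_apply]
  simp only [minkowski, planePart]
  ring

/-- This is the Cauchy–Schwarz inequality for the space-like components, the source of the signs in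
`minkowski_nonneg` and `minkowski_pos`. -/
theorem abs_sub_minkowski_le (v w : Fin 3 → ℝ) :
    |v 2 * w 2 - minkowski v w| ≤ ‖planePart v‖ * ‖planePart w‖ := by
  have h : v 2 * w 2 - minkowski v w = (planePart v * (starRingEnd ℂ) (planePart w)).re := by
    simp only [minkowski, planePart, Complex.mul_re, Complex.conj_re, Complex.conj_im]
    ring
  rw [h]
  refine (Complex.abs_re_le_norm _).trans ?_
  rw [norm_mul, RCLike.norm_conj]

theorem abs_eq_norm_planePart {v : Fin 3 → ℝ} (h : minkowski v v = 0) : |v 2| = ‖planePart v‖ := by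
  rw [minkowski_self_eq, sub_eq_zero] at h
  rw [← abs_of_nonneg (norm_nonneg (planePart v))]
  exact (sq_eq_sq_iff_abs_eq_abs _ _).1 h

theorem mem_futureCone_iff {v : Fin 3 → ℝ} :
    v ∈ futureCone ↔ v 2 = ‖planePart v‖ ∧ planePart v ≠ 0 := by
  constructor
  · rintro ⟨h, h'⟩
    have := abs_eq_norm_planePart h
    rw [abs_of_pos h'] at this
    exact ⟨this, fun h0 => by simp [this, h0] at h'⟩
  · rintro ⟨h, h'⟩
    exact ⟨by rw [minkowski_self_eq, h]; ring, h ▸ norm_pos_iff.2 h'⟩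

theorem mem_pastCone_iff {v : Fin 3 → ℝ} :
    v ∈ pastCone ↔ v 2 = -‖planePart v‖ ∧ planePart v ≠ 0 := by
  constructor
  · rintro ⟨h, h'⟩
    have := abs_eq_norm_planePart h
    rw [abs_of_neg h'] at this
    exact ⟨by rw [← this, neg_neg], fun h0 => by simp [h0] at this; exact h'.ne this⟩
  · rintro ⟨h, h'⟩
    exact ⟨by rw [minkowski_self_eq, h]; ring, h ▸ neg_lt_zero.2 (norm_pos_iff.2 h')⟩

theorem neg_mem_futureCone {v : Fin 3 → ℝ} (h : v ∈ pastCone) : -v ∈ futureCone :=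
  ⟨by simpa [minkowski] using h.1, by simpa using h.2⟩

theorem minkowski_nonneg {v w : Fin 3 → ℝ} (hv : ‖planePart v‖ ≤ v 2) (hw : w ∈ futureCone) :
    0 ≤ minkowski v w := by
  have h1 := abs_le.1 (abs_sub_minkowski_le v w)
  have h2 := (mem_futureCone_iff.1 hw).1
  have h3 := mul_le_mul_of_nonneg_right hv (norm_nonneg (planePart w))
  rw [h2] at h1
  linarith [h1.2]

theorem minkowski_pos {v w : Fin 3 → ℝ} (hv : 0 < minkowski v v) (hv2 : 0 < v 2)
    (hw : w ∈ futureCone) : 0 < minkowski v w := by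
  have h1 := abs_le.1 (abs_sub_minkowski_le v w)
  obtain ⟨h2, h3⟩ := mem_futureCone_iff.1 hw
  rw [minkowski_self_eq, sub_pos] at hv
  have h4 := mul_lt_mul_of_pos_right (lt_of_pow_lt_pow_left₀ 2 hv2.le hv) (norm_pos_iff.2 h3)
  rw [h2] at h1
  linarith [h1.2]

/-- Orthogonal null vectors are proportional. -/
theorem eq_smul_of_minkowski_eq_zero {v w : Fin 3 → ℝ} (hv : minkowski v v = 0)
    (hw : minkowski w w = 0) (h : minkowski v w = 0) (hw2 : w 2 ≠ 0) : v = (v 2 / w 2) • w := by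
  simp only [minkowski] at hv hw h
  -- The squared Euclidean length of the plane part of w₂ v - v₂ w is a combination of the three
  -- vanishing products.
  have key : (w 2 * v 0 - v 2 * w 0) ^ 2 + (w 2 * v 1 - v 2 * w 1) ^ 2 = 0 := by
    linear_combination -(w 2 ^ 2) * hv - v 2 ^ 2 * hw + 2 * v 2 * w 2 * h
  have h0 : w 2 * v 0 - v 2 * w 0 = 0 := by
    nlinarith [sq_nonneg (w 2 * v 0 - v 2 * w 0), sq_nonneg (w 2 * v 1 - v 2 * w 1)]
  have h1 : w 2 * v 1 - v 2 * w 1 = 0 := by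
    nlinarith [sq_nonneg (w 2 * v 0 - v 2 * w 0), sq_nonneg (w 2 * v 1 - v 2 * w 1)]
  ext k
  fin_cases k
  · simp only [Fin.zero_eta, Pi.smul_apply, smul_eq_mul]
    field_simp
    linarith
  · simp only [Fin.mk_one, Pi.smul_apply, smul_eq_mul]
    field_simp
    linarith
  · simp [hw2]

variable {k₁ k₂ : ℕ} {u : EdgeTuple k₁ k₂}

/-- Two non-orthogonal null edges suffice: split y as (y - c u_j) + c u_j. The second term is
tangent at u_j because u_j is null, and c is chosen to make the first orthogonal to u_i. -/
theorem isRegularTuple_of_minkowski_ne_zero (hu : ∀ i, minkowski (u i) (u i) = 0)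
    {i j : Fin k₁ ⊕ Fin k₂} (h : minkowski (u i) (u j) ≠ 0) : IsRegularTuple u := by
  have hij : i ≠ j := by
    rintro rfl
    exact h (hu i)
  intro y
  set c := minkowski y (u i) / minkowski (u i) (u j) with hc
  refine ⟨Pi.single i (y - c • u j) + Pi.single j (c • u j), fun l => ?_, ?_⟩
  · have hm : ∀ a b v : Fin 3 → ℝ, minkowski (a + b) v = minkowski a v + minkowski b v := by
      intro a b v
      simp only [minkowski, Pi.add_apply]
      ring
    have h0 : ∀ v : Fin 3 → ℝ, minkowski 0 v = 0 := fun v => by simp [minkowski]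
    rw [Pi.add_apply, hm]
    rcases eq_or_ne l i with rfl | hl
    · rw [Pi.single_eq_same, Pi.single_eq_of_ne hij, h0, sub_eq_add_neg, hm, minkowski_neg_left,
        minkowski_comm (c • u j), minkowski_smul_right, hc]
      field_simp
      ring
    · rcases eq_or_ne l j with rfl | hl'
      · rw [Pi.single_eq_same, Pi.single_eq_of_ne hl, h0, minkowski_comm, minkowski_smul_right, hu]
        ring
      · rw [Pi.single_eq_of_ne hl, Pi.single_eq_of_ne hl', h0, add_zero]
  · simp [Finset.sum_add_distrib]

/-- If all edges were multiples of v, every sum of tangent vectors would be orthogonal to v; the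
unit vector on the time axis is not, as v₂ ≠ 0. -/
theorem IsRegularTuple.exists_not_smul (h : IsRegularTuple u) (hu : ∀ i, u i 2 ≠ 0)
    {v : Fin 3 → ℝ} (hv : v 2 ≠ 0) : ∃ i, u i ≠ (u i 2 / v 2) • v := by
  by_contra! hp
  obtain ⟨w, hw, hw'⟩ := h ![0, 0, 1]
  have h1 : minkowski ![0, 0, 1] v = 0 := by
    rw [← hw', minkowski_sum_left]
    refine Finset.sum_eq_zero fun i _ => ?_
    have h2 := hw i
    rw [hp i, minkowski_smul_right] at h2
    exact (mul_eq_zero.1 h2).resolve_left (div_ne_zero (hu i) hv)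
  simp [minkowski] at h1
  exact hv h1

end Minkowski

/-! ### Conjugation invariants of vectors in Minkowski space. -/

section Invariants

/-- The determinant of three vectors. -/
def tripleProduct (u v w : Fin 3 → ℝ) : ℝ :=
  u 0 * (v 1 * w 2 - v 2 * w 1) - u 1 * (v 0 * w 2 - v 2 * w 0) + u 2 * (v 0 * w 1 - v 1 * w 0)

/-- Writing the Minkowski product, and below the determinant, as a trace makes invariance under
conjugation evident. -/
theorem trace_toSu11_mul (u v : Fin 3 → ℝ) :
    (toSu11 u * toSu11 v).trace = ((-(minkowski u v) / 2 : ℝ) : ℂ) := by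
  apply Complex.ext <;> simp [toSu11, Matrix.trace_fin_two, minkowski] <;> ring

theorem trace_toSu11_mul_mul (u v w : Fin 3 → ℝ) :
    (toSu11 u * toSu11 v * toSu11 w).trace = ((-(tripleProduct u v w) / 4 : ℝ) : ℂ) := by
  apply Complex.ext <;> simp [toSu11, Matrix.trace_fin_two, tripleProduct] <;> ring

theorem toSu11_sum {ι : Type*} (T : Finset ι) (v : ι → Fin 3 → ℝ) :
    toSu11 (∑ i ∈ T, v i) = ∑ i ∈ T, toSu11 (v i) := by
  simp only [toSu11, ← Finset.smul_sum]
  congr 1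
  ext j k
  rw [Matrix.sum_apply]
  fin_cases j <;> fin_cases k <;>
    simp [Finset.mul_sum, Finset.sum_add_distrib]

variable {A B : Matrix (Fin 2) (Fin 2) ℂ} (h : B * A = 1)

include h

theorem minkowski_eq_of_conj {u v u' v' : Fin 3 → ℝ} (hu : toSu11 u' = A * toSu11 u * B)
    (hv : toSu11 v' = A * toSu11 v * B) : minkowski u' v' = minkowski u v := by
  have h1 := trace_toSu11_mul u' v'
  rw [hu, hv, show (A * toSu11 u * B) * (A * toSu11 v * B) =
    A * (toSu11 u * (B * A) * toSu11 v * B) by simp only [mul_assoc], h, mul_one,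
    Matrix.trace_mul_comm, mul_assoc, h, mul_one, trace_toSu11_mul] at h1
  have := Complex.ofReal_injective h1
  linarith

theorem tripleProduct_eq_of_conj {u v w u' v' w' : Fin 3 → ℝ}
    (hu : toSu11 u' = A * toSu11 u * B) (hv : toSu11 v' = A * toSu11 v * B)
    (hw : toSu11 w' = A * toSu11 w * B) : tripleProduct u' v' w' = tripleProduct u v w := by
  have h1 := trace_toSu11_mul_mul u' v' w'
  rw [hu, hv, hw, show (A * toSu11 u * B) * (A * toSu11 v * B) * (A * toSu11 w * B) =
    A * (toSu11 u * (B * A) * toSu11 v * (B * A) * toSu11 w * B) by simp only [mul_assoc], h,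
    mul_one, mul_one, Matrix.trace_mul_comm, mul_assoc, h, mul_one, trace_toSu11_mul_mul] at h1
  have := Complex.ofReal_injective h1
  linarith

end Invariants

/-! ### Moving a time-like vector to the time axis. -/

section Action

/-- The action of the element of `SU(1,1)` with first row `(α, β)`. -/
def su11Act (α β : ℂ) (v : Fin 3 → ℝ) : Fin 3 → ℝ :=
  ![(α ^ 2 * planePart v - β ^ 2 * star (planePart v) + 2 * Complex.I * α * β * v 2).re,
    (α ^ 2 * planePart v - β ^ 2 * star (planePart v) + 2 * Complex.I * α * β * v 2).im,
    (Complex.normSq α + Complex.normSq β) * v 2 + 2 * (α * star β * planePart v).im]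

theorem planePart_su11Act (α β : ℂ) (v : Fin 3 → ℝ) : planePart (su11Act α β v) =
    α ^ 2 * planePart v - β ^ 2 * star (planePart v) + 2 * Complex.I * α * β * v 2 := rfl

theorem su11Act_add (α β : ℂ) (v w : Fin 3 → ℝ) :
    su11Act α β (v + w) = su11Act α β v + su11Act α β w := by
  ext k
  fin_cases k <;> simp [su11Act, planePart, pow_two] <;> ring

theorem su11Act_sum {ι : Type*} (α β : ℂ) (T : Finset ι) (v : ι → Fin 3 → ℝ) :
    su11Act α β (∑ i ∈ T, v i) = ∑ i ∈ T, su11Act α β (v i) :=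
  map_sum (AddMonoidHom.mk' (su11Act α β) (su11Act_add α β)) v T

theorem exists_su11Act {α β : ℂ} (h : Complex.normSq α - Complex.normSq β = 1) :
    ∃ A ∈ SU11, ∀ v, toSu11 (su11Act α β v) = A.1 * toSu11 v * (A⁻¹).1 := by
  simp only [Complex.normSq_apply] at h
  have hd : (!![α, β; star β, star α] : Matrix (Fin 2) (Fin 2) ℂ).det = 1 := by
    rw [Matrix.det_fin_two_of]
    apply Complex.ext <;> simp <;> linarith
  obtain ⟨A, hA⟩ : ∃ A : Matrix.SpecialLinearGroup (Fin 2) ℂ, A.1 = !![α, β; star β, star α] :=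
    ⟨⟨_, hd⟩, rfl⟩
  refine ⟨A, ?_, fun v => ?_⟩
  · change A.1ᴴ * _ * A.1 = _
    rw [hA]
    ext j k
    fin_cases j <;> fin_cases k <;> apply Complex.ext <;>
      simp [Matrix.mul_apply, Fin.sum_univ_two] <;> linarith
  · rw [Matrix.SpecialLinearGroup.coe_inv, Matrix.adjugate_fin_two, hA]
    ext j k
    fin_cases j <;> fin_cases k <;> apply Complex.ext <;>
      simp [toSu11, su11Act, planePart, Matrix.mul_apply, Fin.sum_univ_two, pow_two,
        Complex.normSq_apply] <;> ring

/-- A time-like vector can be brought to the time axis. -/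
theorem exists_su11Act_eq {P : Fin 3 → ℝ} (hP : 0 < minkowski P P) (hP2 : 0 < P 2) :
    ∃ α β : ℂ, Complex.normSq α - Complex.normSq β = 1 ∧ planePart (su11Act α β P) = 0 ∧
      0 < su11Act α β P 2 := by
  obtain ⟨m, hm, hm2⟩ : ∃ m, 0 < m ∧ m ^ 2 = minkowski P P :=
    ⟨_, Real.sqrt_pos.2 hP, Real.sq_sqrt hP.le⟩
  simp only [minkowski] at hm2
  obtain ⟨c, hc, hc2⟩ : ∃ c, 0 < c ∧ c ^ 2 = 2 * m * (P 2 + m) :=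
    ⟨_, Real.sqrt_pos.2 (by positivity), Real.sq_sqrt (by positivity)⟩
  have hc' : (c : ℂ) ≠ 0 := by exact_mod_cast hc.ne'
  -- This is the boost from P to (0, 0, m). The constant c makes the determinant one, since the
  -- plane part has squared norm P₂² - m² and (P₂ + m)² - (P₂² - m²) = 2m(P₂ + m).
  refine ⟨((P 2 + m) / c : ℝ), Complex.I * planePart P / c, ?_, ?_, ?_⟩
  · simp only [Complex.normSq_apply, planePart]
    simp
    field_simp
    linarith
  · rw [planePart_su11Act]
    have e : star (Complex.ofReal c) = c := Complex.conj_ofReal c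
    have hn : planePart P * star (planePart P) = (P 2 : ℂ) ^ 2 - (m : ℂ) ^ 2 := by
      apply Complex.ext
      · simp [planePart, pow_two]
        linarith
      · simp [planePart, pow_two]
        ring
    push_cast
    field_simp
    rw [Complex.I_sq]
    linear_combination planePart P * hn
  · have : su11Act ((P 2 + m) / c : ℝ) (Complex.I * planePart P / c) P 2 = m := by
      simp [su11Act, planePart, Complex.normSq_apply]
      field_simp
      rw [hc2]
      have : P 0 * P 0 + P 1 * P 1 = P 2 * P 2 - m ^ 2 := by linarith
      linear_combination (-P 2 - 2 * m) * this
    rw [this]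
    exact hm

end Action

end

noncomputable section

/-! ## Coordinates on the space of null polygons -/

section Polygons

variable {n : ℕ} {S : Finset (Fin n)} {i₀ j₀ : Fin n}

theorem reshuffle_inl_mem (k : Fin S.card) : reshuffle S (Sum.inl k) ∈ S := by
  rw [reshuffle, finSumEquivOfFinset_inl]
  exact Finset.orderEmbOfFin_mem _ _ _

theorem reshuffle_inr_notMem (k : Fin Sᶜ.card) : reshuffle S (Sum.inr k) ∉ S := by
  rw [reshuffle, finSumEquivOfFinset_inr, ← Finset.mem_compl]
  exact Finset.orderEmbOfFin_mem _ _ _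

theorem Matrix.SpecialLinearGroup.coe_inv_mul_coe (A : Matrix.SpecialLinearGroup (Fin 2) ℂ) :
    (A⁻¹).1 * A.1 = 1 := by
  rw [← Matrix.SpecialLinearGroup.coe_mul, inv_mul_cancel]
  rfl

variable (S) in
/-- The edges, indexed as the points of the hyperpolygon. -/
def edges (u : EdgeTuple S.card Sᶜ.card) (i : Fin n) : Fin 3 → ℝ := u ((reshuffle S).symm i)

theorem mem_regularNullPolygons_iff {u : EdgeTuple S.card Sᶜ.card} :
    u ∈ regularNullPolygons S.card Sᶜ.card ↔ (∀ i ∈ S, edges S u i ∈ pastCone) ∧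
      (∀ i ∉ S, edges S u i ∈ futureCone) ∧ ∑ i ∈ S, edges S u i + ∑ i ∈ Sᶜ, edges S u i = 0 ∧
      IsRegularTuple u := by
  have h : ∀ k, u k = edges S u (reshuffle S k) := fun k => by simp [edges]
  have hs : ∑ k, u k = ∑ i ∈ S, edges S u i + ∑ i ∈ Sᶜ, edges S u i := by
    rw [Finset.sum_add_sum_compl, ← Equiv.sum_comp (reshuffle S)]
    exact Finset.sum_congr rfl fun k _ => h k
  have e1 : (∀ k, u (Sum.inl k) ∈ pastCone) ↔ ∀ i ∈ S, edges S u i ∈ pastCone := by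
    refine ⟨fun hu i hi => ?_, fun hu k => h _ ▸ hu _ (reshuffle_inl_mem k)⟩
    obtain ⟨k | k, rfl⟩ := (reshuffle S).surjective i
    · exact h _ ▸ hu k
    · exact absurd hi (reshuffle_inr_notMem k)
  have e2 : (∀ k, u (Sum.inr k) ∈ futureCone) ↔ ∀ i ∉ S, edges S u i ∈ futureCone := by
    refine ⟨fun hu i hi => ?_, fun hu k => h _ ▸ hu _ (reshuffle_inr_notMem k)⟩
    obtain ⟨k | k, rfl⟩ := (reshuffle S).surjective i
    · exact absurd (reshuffle_inl_mem k) hi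
    · exact h _ ▸ hu k
  rw [← e1, ← e2, ← hs]
  rfl

/-- The sum of the future edges of a regular null polygon is time-like. -/
theorem minkowski_sum_compl_edges_pos (hj : j₀ ∉ S) {u : EdgeTuple S.card Sᶜ.card}
    (hu : u ∈ regularNullPolygons S.card Sᶜ.card) :
    0 < (∑ i ∈ Sᶜ, edges S u i) 2 ∧
      0 < minkowski (∑ i ∈ Sᶜ, edges S u i) (∑ i ∈ Sᶜ, edges S u i) := by
  obtain ⟨h1, h2, h3, h4⟩ := mem_regularNullPolygons_iff.1 hu
  set P := ∑ i ∈ Sᶜ, edges S u i with hP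
  have hP2 : 0 < P 2 := by
    rw [hP, Finset.sum_apply]
    exact Finset.sum_pos (fun i hi => (h2 i (Finset.mem_compl.1 hi)).2)
      ⟨j₀, Finset.mem_compl.2 hj⟩
  have hPn : ‖planePart P‖ ≤ P 2 := by
    rw [hP, Finset.sum_apply, planePart_sum]
    refine (norm_sum_le _ _).trans (Finset.sum_le_sum fun i hi => ?_)
    exact (mem_futureCone_iff.1 (h2 i (Finset.mem_compl.1 hi))).1.ge
  refine ⟨hP2, lt_of_le_of_ne ?_ fun h0 => ?_⟩
  · rw [minkowski_self_eq]
    nlinarith [norm_nonneg (planePart P)]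
  -- If P were null, the products of P with the future edges and with the negatives of the past
  -- edges would be nonnegative with sum zero. Every edge would then be a multiple of P, contrary to
  -- regularity.
  have hS : ∑ i ∈ S, minkowski P (-edges S u i) = 0 := by
    rw [← minkowski_sum_right, Finset.sum_neg_distrib, neg_eq_of_add_eq_zero_right h3, ← h0]
  have hS' : ∑ i ∈ Sᶜ, minkowski P (edges S u i) = 0 := by
    rw [← minkowski_sum_right, ← hP, ← h0]
  have key : ∀ i, edges S u i 2 ≠ 0 ∧ edges S u i = (edges S u i 2 / P 2) • P := by
    intro i
    by_cases hi : i ∈ S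
    · refine ⟨(h1 i hi).2.ne, eq_smul_of_minkowski_eq_zero (h1 i hi).1 h0.symm ?_ hP2.ne'⟩
      have := (Finset.sum_eq_zero_iff_of_nonneg fun i hi =>
        minkowski_nonneg hPn (neg_mem_futureCone (h1 i hi))).1 hS i hi
      rwa [minkowski_comm, minkowski_neg_left, neg_eq_zero] at this
    · refine ⟨(h2 i hi).2.ne', eq_smul_of_minkowski_eq_zero (h2 i hi).1 h0.symm ?_ hP2.ne'⟩
      have := (Finset.sum_eq_zero_iff_of_nonneg fun i hi =>
        minkowski_nonneg hPn (h2 i (Finset.mem_compl.1 hi))).1 hS' i (Finset.mem_compl.2 hi)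
      rwa [minkowski_comm] at this
  have he : ∀ k, u k = edges S u (reshuffle S k) := fun k => by simp [edges]
  obtain ⟨k, hk⟩ := h4.exists_not_smul (fun k => he k ▸ (key _).1) hP2.ne'
  exact hk (he k ▸ (key _).2)

/-- The edges of the polygon whose projection to the plane has the edges `w_i` for `i ∈ S` and the
complex conjugates of `w_i` for the other `i`. -/
def entryEdge (S : Finset (Fin n)) (w : Fin n → ℂ) (i : Fin n) : Fin 3 → ℝ :=
  if i ∈ S then ![(w i).re, (w i).im, -‖w i‖] else ![(w i).re, -(w i).im, ‖w i‖]

theorem entryEdge_of_mem {i : Fin n} (hi : i ∈ S) (w : Fin n → ℂ) :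
    entryEdge S w i = ![(w i).re, (w i).im, -‖w i‖] := if_pos hi

theorem entryEdge_of_notMem {i : Fin n} (hi : i ∉ S) (w : Fin n → ℂ) :
    entryEdge S w i = ![(w i).re, -(w i).im, ‖w i‖] := if_neg hi

variable (S) in
/-- The polygon with the edges `entryEdge S w i`. -/
def entryPolygon (w : Fin n → ℂ) : EdgeTuple S.card Sᶜ.card :=
  fun k => entryEdge S w (reshuffle S k)

theorem edges_entryPolygon (w : Fin n → ℂ) : edges S (entryPolygon S w) = entryEdge S w := by
  ext i : 1
  simp [edges, entryPolygon]

/-- A null vector in a given light cone is determined by its plane part. -/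
theorem eq_entryEdge {v : Fin 3 → ℝ} {w : Fin n → ℂ} {i : Fin n}
    (h : v 2 = if i ∈ S then -‖planePart v‖ else ‖planePart v‖)
    (hw : w i = if i ∈ S then planePart v else star (planePart v)) : entryEdge S w i = v := by
  unfold entryEdge
  split_ifs at h hw ⊢ <;>
  · ext k
    fin_cases k <;> simp [hw, h, planePart]

theorem sum_entryEdge_compl {w : Fin n → ℂ} (h2 : ∑ i ∈ Sᶜ, w i = 0) :
    ∑ i ∈ Sᶜ, entryEdge S w i = ![0, 0, ∑ i ∈ Sᶜ, ‖w i‖] := by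
  have h2r := congrArg Complex.re h2
  have h2i := congrArg Complex.im h2
  rw [Complex.re_sum, Complex.zero_re] at h2r
  rw [Complex.im_sum, Complex.zero_im] at h2i
  rw [Finset.sum_congr rfl fun i hi => entryEdge_of_notMem (Finset.mem_compl.1 hi) w]
  ext k
  rw [Finset.sum_apply]
  fin_cases k <;> simp [h2r, h2i]

theorem sum_entryEdge {w : Fin n → ℂ} (h1 : ∑ i ∈ S, w i = 0) :
    ∑ i ∈ S, entryEdge S w i = ![0, 0, -∑ i ∈ S, ‖w i‖] := by
  have h1r := congrArg Complex.re h1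
  have h1i := congrArg Complex.im h1
  rw [Complex.re_sum, Complex.zero_re] at h1r
  rw [Complex.im_sum, Complex.zero_im] at h1i
  rw [Finset.sum_congr rfl fun i hi => entryEdge_of_mem hi w]
  ext k
  rw [Finset.sum_apply]
  fin_cases k <;> simp [h1r, h1i]

/-- The null polygons in normal form. -/
theorem entryPolygon_mem (hi : i₀ ∈ S) (hj : j₀ ∉ S) {w : Fin n → ℂ} (hw : ∀ i, w i ≠ 0)
    (h1 : ∑ i ∈ S, w i = 0) (h2 : ∑ i ∈ Sᶜ, w i = 0)
    (h3 : ∑ i ∈ S, ‖w i‖ = ∑ i ∈ Sᶜ, ‖w i‖) :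
    entryPolygon S w ∈ regularNullPolygons S.card Sᶜ.card := by
  have hS : ∀ i ∈ S, entryEdge S w i ∈ pastCone := by
    intro i hi
    simp only [entryEdge, hi, if_true]
    exact mem_pastCone_iff.2 ⟨rfl, hw i⟩
  have hS' : ∀ i ∉ S, entryEdge S w i ∈ futureCone := by
    intro i hi
    simp only [entryEdge, hi, if_false]
    refine mem_futureCone_iff.2 ⟨(RCLike.norm_conj (w i)).symm, ?_⟩
    exact (map_ne_zero (starRingEnd ℂ)).2 (hw i)
  rw [mem_regularNullPolygons_iff, edges_entryPolygon]
  refine ⟨hS, hS', ?_, ?_⟩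
  · rw [sum_entryEdge h1, sum_entryEdge_compl h2, h3]
    simp
  have hm : ∀ i ∈ S, minkowski (entryEdge S w i) (entryEdge S w j₀) =
      -(w i * w j₀).re - ‖w i‖ * ‖w j₀‖ := by
    intro i hi
    simp only [entryEdge, hi, hj, if_true, if_false]
    simp [minkowski]
    ring
  -- If all these products vanished, their sum over `S` would leave -|w_{j₀}| ∑ |w_i| = 0, because
  -- the linear terms cancel.
  obtain ⟨i, hi', hi0⟩ : ∃ i ∈ S, minkowski (entryEdge S w i) (entryEdge S w j₀) ≠ 0 := by
    by_contra! h0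
    have h4 : ∑ i ∈ S, (-(w i * w j₀).re - ‖w i‖ * ‖w j₀‖) = 0 :=
      Finset.sum_eq_zero fun i hi => hm i hi ▸ h0 i hi
    rw [Finset.sum_sub_distrib, Finset.sum_neg_distrib, ← Complex.re_sum, ← Finset.sum_mul, h1,
      ← Finset.sum_mul] at h4
    simp only [zero_mul, Complex.zero_re, neg_zero, zero_sub, neg_eq_zero] at h4
    exact (mul_pos (sum_norm_pos hw hi) (norm_pos_iff.2 (hw j₀))).ne' h4
  refine isRegularTuple_of_minkowski_ne_zero (i := (reshuffle S).symm i)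
    (j := (reshuffle S).symm j₀) (fun k => ?_) (by simpa [entryPolygon] using hi0)
  by_cases hk : reshuffle S k ∈ S
  · exact (hS _ hk).1
  · exact (hS' _ hk).1

/-- Every regular null polygon has a normal form. -/
theorem exists_conj_entryEdge (hj : j₀ ∉ S) {u : EdgeTuple S.card Sᶜ.card}
    (hu : u ∈ regularNullPolygons S.card Sᶜ.card) :
    ∃ w : Fin n → ℂ, (∀ i, w i ≠ 0) ∧ ∑ i ∈ S, w i = 0 ∧ ∑ i ∈ Sᶜ, w i = 0 ∧
      ∑ i ∈ S, ‖w i‖ = ∑ i ∈ Sᶜ, ‖w i‖ ∧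
      ∃ A ∈ SU11, ∀ i, toSu11 (entryEdge S w i) = A.1 * toSu11 (edges S u i) * (A⁻¹).1 := by
  obtain ⟨hP2, hP⟩ := minkowski_sum_compl_edges_pos hj hu
  obtain ⟨h1, h2, h3, -⟩ := mem_regularNullPolygons_iff.1 hu
  obtain ⟨α, β, hαβ, hb, hb2⟩ := exists_su11Act_eq hP hP2
  obtain ⟨A, hA, hact⟩ := exists_su11Act hαβ
  have hinv := Matrix.SpecialLinearGroup.coe_inv_mul_coe A
  set P := ∑ i ∈ Sᶜ, edges S u i
  set v : Fin n → Fin 3 → ℝ := fun i => su11Act α β (edges S u i)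
  set P' := su11Act α β P
  -- As P' lies on the time axis, this invariant fixes the sign of the time component, which shows
  -- that the moved edges stay in their light cones.
  have hmv : ∀ i, P' 2 * v i 2 = minkowski P (edges S u i) := fun i => by
    rw [← minkowski_eq_of_conj hinv (hact _) (hact _)]
    have e0 : P' 0 = 0 := congrArg Complex.re hb
    have e1 : P' 1 = 0 := congrArg Complex.im hb
    change _ = minkowski P' (v i)
    simp [minkowski, e0, e1]
  have hvv : ∀ i, minkowski (v i) (v i) = minkowski (edges S u i) (edges S u i) := fun i =>
    minkowski_eq_of_conj hinv (hact _) (hact _)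
  have hS : ∀ i ∈ S, v i ∈ pastCone := fun i hi => by
    have h4 := minkowski_pos hP hP2 (neg_mem_futureCone (h1 i hi))
    rw [minkowski_comm, minkowski_neg_left, minkowski_comm, ← hmv, ← mul_neg] at h4
    exact ⟨(hvv i).trans (h1 i hi).1, neg_pos.1 (pos_of_mul_pos_right h4 hb2.le)⟩
  have hS' : ∀ i ∉ S, v i ∈ futureCone := fun i hi => by
    have h4 := minkowski_pos hP hP2 (h2 i hi)
    rw [← hmv] at h4
    exact ⟨(hvv i).trans (h2 i hi).1, pos_of_mul_pos_right h4 hb2.le⟩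
  have hs' : ∑ i ∈ Sᶜ, v i = P' := (su11Act_sum α β _ _).symm
  have hs : ∑ i ∈ S, v i = -P' := by
    rw [eq_neg_iff_add_eq_zero, ← su11Act_sum, ← su11Act_add, h3]
    simpa using su11Act_sum α β (∅ : Finset (Fin n)) v
  have hw1 : ∀ i ∈ S, ‖planePart (v i)‖ = -v i 2 := fun i hi => by
    rw [(mem_pastCone_iff.1 (hS i hi)).1, neg_neg]
  have hw2 : ∀ i ∉ S, ‖planePart (v i)‖ = v i 2 := fun i hi =>
    (mem_futureCone_iff.1 (hS' i hi)).1.symm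
  let w : Fin n → ℂ := fun i => if i ∈ S then planePart (v i) else star (planePart (v i))
  have e1 : ∀ i ∈ S, w i = planePart (v i) := fun i hi => if_pos hi
  have e2 : ∀ i ∈ Sᶜ, w i = star (planePart (v i)) := fun i hi => if_neg (Finset.mem_compl.1 hi)
  refine ⟨w, fun i => ?_, ?_, ?_, ?_, A, hA, fun i => ?_⟩
  · by_cases hi : i ∈ S
    · rw [e1 i hi]
      exact (mem_pastCone_iff.1 (hS i hi)).2
    · rw [e2 i (Finset.mem_compl.2 hi)]
      exact star_ne_zero.2 (mem_futureCone_iff.1 (hS' i hi)).2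
  · rw [Finset.sum_congr rfl e1, ← planePart_sum, hs]
    have : planePart (-P') = -planePart P' := rfl
    rw [this, hb, neg_zero]
  · rw [Finset.sum_congr rfl e2, ← star_sum, ← planePart_sum, hs', hb, star_zero]
  · have s1 : ∑ i ∈ S, ‖w i‖ = ∑ i ∈ S, -v i 2 :=
      Finset.sum_congr rfl fun i hi => by rw [e1 i hi, hw1 i hi]
    have s2 : ∑ i ∈ Sᶜ, ‖w i‖ = ∑ i ∈ Sᶜ, v i 2 := Finset.sum_congr rfl fun i hi => by
      rw [e2 i hi, norm_star, hw2 i (Finset.mem_compl.1 hi)]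
    rw [s1, s2, Finset.sum_neg_distrib, ← Finset.sum_apply, hs, ← Finset.sum_apply, hs',
      Pi.neg_apply, neg_neg]
  · rw [← hact]
    congr 1
    refine eq_entryEdge ?_ rfl
    split_ifs with hi
    · exact (mem_pastCone_iff.1 (hS i hi)).1
    · exact (mem_futureCone_iff.1 (hS' i hi)).1

/-- The diagonal element with entries l and its conjugate fixes the time axis and rotates the plane
by l². For i ∉ S the entry is the conjugate of the plane part, hence the inverse factor. -/
theorem exists_conj_entryEdge_of_norm_eq_one {w w' : Fin n → ℂ} {l : ℂ} (hl : ‖l‖ = 1)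
    (h1 : ∀ i ∈ S, w' i = l ^ 2 * w i) (h2 : ∀ i ∉ S, w' i = (l ^ 2)⁻¹ * w i) :
    ∃ A ∈ SU11, ∀ i, toSu11 (entryEdge S w' i) = A.1 * toSu11 (entryEdge S w i) * (A⁻¹).1 := by
  have hn : Complex.normSq l = 1 := by rw [Complex.normSq_eq_norm_sq, hl, one_pow]
  obtain ⟨A, hA, hact⟩ := exists_su11Act (α := l) (β := 0) (by simp [hn])
  refine ⟨A, hA, fun i => ?_⟩
  rw [← hact]
  congr 1
  have hp : ∀ v, planePart (su11Act l 0 v) = l ^ 2 * planePart v := fun v => by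
    simp [planePart_su11Act]
  have hp2 : ∀ v, su11Act l 0 v 2 = v 2 := fun v => by simp [su11Act, hn]
  apply eq_entryEdge
  · rw [hp, hp2, norm_mul, norm_pow, hl, one_pow, one_mul]
    split_ifs with hi
    · rw [entryEdge_of_mem hi]
      rfl
    · rw [entryEdge_of_notMem hi]
      exact (norm_star (w i)).symm
  · rw [hp]
    split_ifs with hi
    · rw [entryEdge_of_mem hi, h1 i hi]
      rfl
    · rw [entryEdge_of_notMem hi, h2 i hi, star_mul']
      rw [Complex.inv_eq_conj (by rw [norm_pow, hl, one_pow])]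
      congr 1
      exact (star_star (w i)).symm

/-- The invariant of two vectors and a time-like vector that is the product of the plane
projections of the vectors if the third vector is on the time axis. -/
def edgePairing (a b P : Fin 3 → ℝ) : ℂ :=
  ((-minkowski a b + minkowski a P * minkowski b P / minkowski P P : ℝ) : ℂ) +
    ((-tripleProduct a b P / √(minkowski P P) : ℝ) : ℂ) * Complex.I

/-- The coordinates of a polygon. -/
def polygonCoord (S : Finset (Fin n)) (i₀ j₀ : Fin n) (u : EdgeTuple S.card Sᶜ.card) (i : Fin n) :
    ℂ :=
  edgePairing (edges S u (if i ∈ S then i else i₀)) (edges S u (if i ∈ S then j₀ else i))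
    (∑ i ∈ Sᶜ, edges S u i)

/-- With P = (0, 0, t), the correction term in `edgePairing` removes the time components and leaves
the plane inner product, while the determinant divided by t is the plane determinant. Since the
plane part of a future edge is the conjugate of its entry, these are the real and imaginary parts of
the product. -/
theorem polygonCoord_entryPolygon (hi : i₀ ∈ S) (hj : j₀ ∉ S) {w : Fin n → ℂ}
    (hw : ∀ i, w i ≠ 0) (h2 : ∑ i ∈ Sᶜ, w i = 0) :
    polygonCoord S i₀ j₀ (entryPolygon S w) = pairCoord S i₀ j₀ w := by
  have key : ∀ a ∈ S, ∀ b ∉ S, ∀ t : ℝ, 0 < t →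
      edgePairing (entryEdge S w a) (entryEdge S w b) ![0, 0, t] = w a * w b := by
    intro a ha b hb t ht
    have e : minkowski ![0, 0, t] ![0, 0, t] = t ^ 2 := by simp [minkowski, pow_two]
    rw [edgePairing, e, Real.sqrt_sq ht.le, entryEdge_of_mem ha, entryEdge_of_notMem hb]
    apply Complex.ext
    · simp only [minkowski, Complex.add_re, Complex.ofReal_re, Complex.ofReal_im, Complex.I_re,
        Complex.I_im, Complex.mul_re, Matrix.cons_val]
      field_simp
      ring
    · simp only [tripleProduct, Complex.add_im, Complex.ofReal_re, Complex.ofReal_im,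
        Complex.I_re, Complex.I_im, Complex.mul_im, Matrix.cons_val]
      field_simp
      ring
  have ht := sum_norm_pos hw (Finset.mem_compl.2 hj)
  ext i
  rw [polygonCoord, edges_entryPolygon, sum_entryEdge_compl h2, pairCoord]
  split_ifs with h
  · exact key i h j₀ hj _ ht
  · rw [key i₀ hi i h _ ht, mul_comm]

theorem polygonCoord_conj {A B : Matrix (Fin 2) (Fin 2) ℂ} (h : B * A = 1)
    {u u' : EdgeTuple S.card Sᶜ.card} (hu : ∀ k, toSu11 (u' k) = A * toSu11 (u k) * B) :
    polygonCoord S i₀ j₀ u' = polygonCoord S i₀ j₀ u := by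
  have h1 : ∀ i, toSu11 (edges S u' i) = A * toSu11 (edges S u i) * B := fun i => hu _
  have h2 : toSu11 (∑ i ∈ Sᶜ, edges S u' i) = A * toSu11 (∑ i ∈ Sᶜ, edges S u i) * B := by
    rw [toSu11_sum, toSu11_sum, Finset.mul_sum, Finset.sum_mul]
    exact Finset.sum_congr rfl fun i _ => h1 i
  ext i
  simp only [polygonCoord, edgePairing]
  rw [minkowski_eq_of_conj h (h1 _) (h1 _), minkowski_eq_of_conj h (h1 _) h2,
    minkowski_eq_of_conj h (h1 _) h2, minkowski_eq_of_conj h h2 h2,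
    tripleProduct_eq_of_conj h (h1 _) (h1 _) h2]

variable (S) in
/-- The tuples whose future edges have a time-like sum. -/
def timelikeTuples : Set (EdgeTuple S.card Sᶜ.card) :=
  {u | 0 < minkowski (∑ i ∈ Sᶜ, edges S u i) (∑ i ∈ Sᶜ, edges S u i)}

theorem contDiff_edges_apply (i : Fin n) (k : Fin 3) :
    ContDiff ℝ ∞ fun u : EdgeTuple S.card Sᶜ.card => edges S u i k :=
  (contDiff_apply ℝ ℝ k).comp (contDiff_apply ℝ (Fin 3 → ℝ) ((reshuffle S).symm i))

theorem contDiff_minkowski {E : Type*} [NormedAddCommGroup E] [NormedSpace ℝ E]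
    {f g : E → Fin 3 → ℝ} (hf : ∀ k, ContDiff ℝ ∞ fun x => f x k)
    (hg : ∀ k, ContDiff ℝ ∞ fun x => g x k) : ContDiff ℝ ∞ fun x => minkowski (f x) (g x) :=
  (((hf 0).mul (hg 0)).neg.sub ((hf 1).mul (hg 1))).add ((hf 2).mul (hg 2))

theorem contDiff_tripleProduct {E : Type*} [NormedAddCommGroup E] [NormedSpace ℝ E]
    {f g h : E → Fin 3 → ℝ} (hf : ∀ k, ContDiff ℝ ∞ fun x => f x k)
    (hg : ∀ k, ContDiff ℝ ∞ fun x => g x k) (hh : ∀ k, ContDiff ℝ ∞ fun x => h x k) :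
    ContDiff ℝ ∞ fun x => tripleProduct (f x) (g x) (h x) := by
  have h2 : ∀ k l, ContDiff ℝ ∞ fun x => g x k * h x l - g x l * h x k := fun k l =>
    ((hg k).mul (hh l)).sub ((hg l).mul (hh k))
  exact (((hf 0).mul (h2 1 2)).sub ((hf 1).mul (h2 0 2))).add ((hf 2).mul (h2 0 1))

theorem contDiff_sum_edges_apply (k : Fin 3) :
    ContDiff ℝ ∞ fun u : EdgeTuple S.card Sᶜ.card => (∑ i ∈ Sᶜ, edges S u i) k := by
  simp only [Finset.sum_apply]
  exact ContDiff.sum fun i _ => contDiff_edges_apply i k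

theorem isOpen_timelikeTuples : IsOpen (timelikeTuples S) :=
  isOpen_lt continuous_const
    (contDiff_minkowski contDiff_sum_edges_apply contDiff_sum_edges_apply).continuous

/-- The divisions by P ∘ P and by its square root are the reason for the restriction to time-like
sums. -/
theorem contDiffOn_polygonCoord :
    ContDiffOn ℝ ∞ (polygonCoord S i₀ j₀) (timelikeTuples S) := by
  rw [contDiffOn_pi]
  intro i
  simp only [polygonCoord, edgePairing]
  have hP := contDiff_minkowski (contDiff_sum_edges_apply (S := S)) contDiff_sum_edges_apply
  refine ContDiffOn.add ?_ (ContDiffOn.mul ?_ contDiffOn_const)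
  · refine Complex.ofRealCLM.contDiff.comp_contDiffOn ?_
    refine (contDiff_minkowski (contDiff_edges_apply _)
      (contDiff_edges_apply _)).neg.contDiffOn.add (ContDiffOn.div ?_ hP.contDiffOn fun u hu => ?_)
    · exact ((contDiff_minkowski (contDiff_edges_apply _) contDiff_sum_edges_apply).mul
        (contDiff_minkowski (contDiff_edges_apply _) contDiff_sum_edges_apply)).contDiffOn
    · exact ne_of_gt hu
  · refine Complex.ofRealCLM.contDiff.comp_contDiffOn ?_
    refine ContDiffOn.div ?_ (hP.contDiffOn.sqrt fun u hu => ne_of_gt hu) fun u hu => ?_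
    · exact (contDiff_tripleProduct (contDiff_edges_apply _) (contDiff_edges_apply _)
        contDiff_sum_edges_apply).neg.contDiffOn
    · exact (Real.sqrt_pos.2 hu).ne'

theorem contDiffAt_entryPolygon {w : Fin n → ℂ} (hw : ∀ i, w i ≠ 0) :
    ContDiffAt ℝ ∞ (entryPolygon S) w := by
  rw [contDiffAt_pi]
  intro k
  rw [contDiffAt_pi]
  intro l
  have h : ContDiffAt ℝ ∞ (fun w : Fin n → ℂ => w (reshuffle S k)) w :=
    (contDiff_apply ℝ ℂ (reshuffle S k)).contDiffAt
  have hr := Complex.reCLM.contDiff.contDiffAt.comp w h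
  have hi := Complex.imCLM.contDiff.contDiffAt.comp w h
  have hn := h.norm ℝ (hw _)
  simp only [entryPolygon, entryEdge]
  split_ifs
  · fin_cases l
    exacts [hr, hi, hn.neg]
  · fin_cases l
    exacts [hr, hi.neg, hn]

variable {d : ℕ}

/-- The polygon in normal form with given coordinates. -/
def polygonSection (hi : i₀ ∈ S) (hj : j₀ ∉ S) (c : LinearCoordinates S i₀ j₀ d) (v : c.domain) :
    regularNullPolygons S.card Sᶜ.card :=
  ⟨entryPolygon S (c.entries v), entryPolygon_mem hi hj (c.entries_ne_zero hi hj v.2)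
    (c.sum_entries v) (c.sum_compl_entries v) (c.sum_norm_entries hi hj v.2)⟩

/-- Regularity places every polygon in the open set where the invariants are smooth. An orbit is
recovered from them by first moving the sum of the future edges to the time axis and then rotating
about it. -/
theorem nullPolygonSpace_quotientCoordinates (hi : i₀ ∈ S) (hj : j₀ ∉ S)
    (c : LinearCoordinates S i₀ j₀ d) :
    SmoothFunctions.QuotientCoordinates
      (fun u : regularNullPolygons S.card Sᶜ.card => (u : EdgeTuple S.card Sᶜ.card))
      (polygonSetoid S.card Sᶜ.card) Set.univ (timelikeTuples S)
      (fun u => c.ofTuple (polygonCoord S i₀ j₀ u)) c.domain (polygonSection hi hj c)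
      (fun v => entryPolygon S (c.entries v)) where
  inducing := Topology.IsInducing.subtypeVal
  isOpen_domain := isOpen_timelikeTuples
  mem_domain u := (minkowski_sum_compl_edges_pos hj u.2).2
  contDiffOn := c.ofTuple.contDiff.comp_contDiffOn contDiffOn_polygonCoord
  invariant := by
    rintro u u' ⟨A, -, h⟩
    rw [polygonCoord_conj (Matrix.SpecialLinearGroup.coe_inv_mul_coe A) h]
  isOpen := c.isOpen_domain
  section_coe _ := rfl
  section_contDiffOn v hv := (contDiffAt_entryPolygon
    (c.entries_ne_zero hi hj hv)).comp_contDiffWithinAt v (c.contDiffOn_entries hi hj v hv)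
  section_mem _ := Set.mem_univ _
  coord_section v := by
    change c.ofTuple (polygonCoord S i₀ j₀ (entryPolygon S (c.entries v))) = v
    rw [polygonCoord_entryPolygon hi hj (c.entries_ne_zero hi hj v.2) (c.sum_compl_entries v),
      c.ofTuple_pairCoord_entries hi hj v.2]
  section_coord u _ := by
    obtain ⟨w, hw, h1, h2, h3, A, hA, hu⟩ := exists_conj_entryEdge hj u.2
    have hu' : ∀ k, toSu11 (entryPolygon S w k) = A.1 * toSu11 (u.1 k) * (A⁻¹).1 := fun k => by
      rw [entryPolygon, hu]
      simp [edges]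
    have hk : polygonCoord S i₀ j₀ u.1 = pairCoord S i₀ j₀ w := by
      rw [← polygonCoord_conj (Matrix.SpecialLinearGroup.coe_inv_mul_coe A) hu',
        polygonCoord_entryPolygon hi hj hw h2]
    rw [hk]
    obtain ⟨hd, l, -, hl1, hl2, hl3⟩ := c.exists_entries_eq hi hj hw h1 h2
    refine ⟨hd, ?_⟩
    obtain ⟨B, hB, hB'⟩ := exists_conj_entryEdge_of_norm_eq_one (hl3 h3) hl1 hl2
    have e1 : (polygonSetoid S.card Sᶜ.card).r u
        ⟨entryPolygon S w, entryPolygon_mem hi hj hw h1 h2 h3⟩ := ⟨A, hA, hu'⟩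
    have e2 : (polygonSetoid S.card Sᶜ.card).r
        ⟨entryPolygon S w, entryPolygon_mem hi hj hw h1 h2 h3⟩ (polygonSection hi hj c ⟨_, hd⟩) :=
      ⟨B, hB, fun k => hB' _⟩
    exact (polygonSetoid S.card Sᶜ.card).symm' ((polygonSetoid S.card Sᶜ.card).trans' e1 e2)

end Polygons

end

noncomputable section

/-! ### Comparison of the coordinates on the three spaces. -/

section Comparison

variable {n : ℕ} {S : Finset (Fin n)} {i₀ j₀ : Fin n}

/-- The equality |p_i| = |q_i| turns the squared norm in the third component into |γ_i β_i|. -/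
theorem splitEdge_splitPoint {β γ : Fin n → ℂ} (h : ∀ i, ‖γ i‖ = ‖β i‖) (i : Fin n) :
    splitEdge S (splitPoint S β γ) i = entryEdge S (fun i => γ i * β i) i := by
  by_cases hi : i ∈ S
  · rw [entryEdge_of_mem hi, norm_mul, ← h, ← sq, mul_comm (γ i)]
    simp [splitEdge, splitPoint, hi]
  · rw [entryEdge_of_notMem hi, norm_mul, h, ← sq, mul_comm (γ i)]
    simp [splitEdge, splitPoint, hi]

/-- The polygon of a hyperpolygon in split form, and its coordinates. -/
theorem IsSplitForm.exists_polygon (hi : i₀ ∈ S) (hj : j₀ ∉ S) {z : CotangentSpace n}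
    (hz : z ∈ nullLevelSet n) (h : IsSplitForm S z) :
    ∃ u ∈ regularNullPolygons S.card Sᶜ.card, (∀ k, u k = splitEdge S z (reshuffle S k)) ∧
      polygonCoord S i₀ j₀ u = traceCoord S i₀ j₀ (hyperResidues z) := by
  have hz' := h.eq_splitPoint
  revert hz'
  generalize (fun i => if i ∈ S then z.1 i 1 else z.1 i 0) = β
  generalize (fun i => if i ∈ S then z.2 i 0 else z.2 i 1) = γ
  rintro rfl
  obtain ⟨hn, hγ, h1, h2, h3⟩ := splitPoint_mem_nullLevelSet_iff.1 hz
  have hw : ∀ i, γ i * β i ≠ 0 := fun i =>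
    mul_ne_zero (hγ i) (norm_ne_zero_iff.1 (hn i ▸ norm_ne_zero_iff.2 (hγ i)))
  refine ⟨entryPolygon S fun i => γ i * β i, entryPolygon_mem hi hj hw h1 h2 h3,
    fun k => (splitEdge_splitPoint hn _).symm, ?_⟩
  rw [polygonCoord_entryPolygon hi hj hw h2, traceCoord_splitPoint hi hj]

theorem IsSplitForm.mk_mem_hyperpolygonComponent {z : nullLevelSet n} (h : IsSplitForm S z.1) :
    Quotient.mk (orbitSetoidK n) z ∈ hyperpolygonComponent S :=
  mem_hyperpolygonComponent_iff.2 (h.isStraight z.2)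

/-- Proportionality of q_{i₀} and q_{j₀} would persist along the orbit; in split form they lie on
different axes, which would force q_{i₀} = 0. -/
theorem det_ne_zero_of_isStraight (hi : i₀ ∈ S) (hj : j₀ ∉ S) {z : CotangentSpace n}
    (hz : z ∈ nullLevelSet n) (hS : IsStraight S z) (hSc : IsStraight Sᶜ z) :
    z.2 i₀ 0 * z.2 j₀ 1 - z.2 i₀ 1 * z.2 j₀ 0 ≠ 0 := by
  intro h0
  have hq := (mem_nullLevelSet_iff.1 hz).2.2.2.2
  obtain ⟨c, hc⟩ := Submodule.mem_span_singleton.1 (mem_span_singleton_of_det (hq j₀) h0)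
  obtain ⟨z', ⟨A, e, h⟩, hz', hs⟩ := exists_isSplitForm hi hj hz hS hSc
  refine (mem_nullLevelSet_iff.1 hz').2.2.2.2 i₀ ?_
  have h1 : z'.2 i₀ = ((e i₀ : ℂ) * c * (e j₀ : ℂ)⁻¹) • z'.2 j₀ := by
    rw [(h i₀).2, (h j₀).2, ← hc, Matrix.mulVec_smul, smul_smul, smul_smul,
      mul_assoc _ _ (e j₀ : ℂ), inv_mul_cancel₀ (Circle.coe_ne_zero _), mul_one]
  ext k
  fin_cases k
  · simp [h1, (hs.2 j₀ hj).2]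
  · exact (hs.1 i₀ hi).2

theorem HiggsBundle.IsAssociatedTo.hasTwoFlags {x : Fin n → RiemannSphere} {E : HiggsBundle x}
    {z : CotangentSpace n} (h : E.IsAssociatedTo z) (hi : i₀ ∈ S) (hj : j₀ ∉ S)
    (hz : z ∈ nullLevelSet n) (hS : IsStraight S z) (hSc : IsStraight Sᶜ z) :
    E.HasTwoFlags S (z.2 i₀) (z.2 j₀) := by
  have hq := (mem_nullLevelSet_iff.1 hz).2.2.2.2
  have key : ∀ i j, (∃ c : ℂ, z.2 i = c • z.2 j) → E.flag i = Submodule.span ℂ {z.2 j} := by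
    rintro i j ⟨c, hc⟩
    rw [(h i).1]
    exact (span_singleton_eq_of_mem (hq i) (Submodule.mem_span_singleton.2 ⟨c, hc.symm⟩)).symm
  exact ⟨fun i hiS => key i i₀ (hS i hiS i₀ hi), fun i hiS => key i j₀
    (hSc i (Finset.mem_compl.2 hiS) j₀ (Finset.mem_compl.2 hj))⟩

theorem HiggsBundle.IsAssociatedTo.residues_eq {x : Fin n → RiemannSphere}
    {E : StableHiggsBundle x} {z : CotangentSpace n} (h : E.1.IsAssociatedTo z) :
    E.residues = hyperResidues z :=
  funext fun i => (h i).2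

end Comparison

end

/-! ### The main theorem. -/

theorem mainTheorem4 {n : ℕ} [NeZero n] (x : Fin n → RiemannSphere) (hx : Function.Injective x)
    (S : Finset (Fin n)) (h1 : (0 : Fin n) ∈ S) (h2 : 2 ≤ S.card) (hn : S.card + 2 ≤ n) :
    ∃ (_ : ChartedSpace (EuclideanSpace ℝ (Fin (2 * (n - 3)))) (hyperpolygonComponent S))
      (_ : ChartedSpace (EuclideanSpace ℝ (Fin (2 * (n - 3)))) (higgsComponent x S))
      (_ : ChartedSpace (EuclideanSpace ℝ (Fin (2 * (n - 3)))) (NullPolygonSpace S.card Sᶜ.card)),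
      -- the three atlases are compatible with the quotient and subspace structures
      ((NullHyperpolygonSpace.smoothFunctions n).restrict
        (hyperpolygonComponent S)).IsManifoldStructure (2 * (n - 3)) ∧
      ((HiggsModuliSpace.smoothFunctions x).restrict
        (higgsComponent x S)).IsManifoldStructure (2 * (n - 3)) ∧
      (NullPolygonSpace.smoothFunctions S.card Sᶜ.card).IsManifoldStructure (2 * (n - 3)) ∧
      ∃ (φ : hyperpolygonComponent S ≃ₘ^∞⟮𝓡 (2 * (n - 3)), 𝓡 (2 * (n - 3))⟯
            NullPolygonSpace S.card Sᶜ.card)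
        (ψ : higgsComponent x S ≃ₘ^∞⟮𝓡 (2 * (n - 3)), 𝓡 (2 * (n - 3))⟯
            NullPolygonSpace S.card Sᶜ.card),
        -- every point of `Z_S` has a representative in split form, and the first diffeomorphism
        -- is given on such representatives by the explicit formula
        (∀ ξ : hyperpolygonComponent S, ∃ z : nullLevelSet n,
          IsSplitForm S z.1 ∧ Quotient.mk (orbitSetoidK n) z = ξ) ∧
        (∀ z : nullLevelSet n, IsSplitForm S z.1 →
          ∃ (hz : Quotient.mk (orbitSetoidK n) z ∈ hyperpolygonComponent S)
            (u : regularNullPolygons S.card Sᶜ.card),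
            (∀ k, u.1 k = splitEdge S z.1 (reshuffle S k)) ∧
            φ ⟨Quotient.mk (orbitSetoidK n) z, hz⟩ = Quotient.mk (polygonSetoid _ _) u) ∧
        -- the second diffeomorphism corresponds to the first one under `[p, q] ↦ [E, Φ]`
        (∀ (z : nullLevelSet n)
          (hz : Quotient.mk (orbitSetoidK n) z ∈ hyperpolygonComponent S)
          (E : StableHiggsBundle x), E.1.IsAssociatedTo z.1 →
          ∃ hE : Quotient.mk (higgsSetoid x) E ∈ higgsComponent x S,
            ψ ⟨Quotient.mk (higgsSetoid x) E, hE⟩ =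
              φ ⟨Quotient.mk (orbitSetoidK n) z, hz⟩) := by
  obtain ⟨j₀, hj⟩ : ∃ j₀, j₀ ∉ S := by
    by_contra! h
    rw [Finset.eq_univ_iff_forall.2 h, Finset.card_univ, Fintype.card_fin] at hn
    omega
  obtain ⟨c⟩ := nonempty_linearCoordinates h1 hj h2 hn
  have hX := hyperpolygonComponent_quotientCoordinates h1 hj c
  have hH := higgsComponent_quotientCoordinates hx h1 hj c
  have hM := nullPolygonSpace_quotientCoordinates h1 hj c
  obtain ⟨v, hv⟩ := c.nonempty_domain h1 hj h2 hn
  have : Nonempty (hyperpolygonComponent S) := ⟨⟨_, hX.section_mem ⟨v, hv⟩⟩⟩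
  have : Nonempty (higgsComponent x S) := ⟨⟨_, hH.section_mem ⟨v, hv⟩⟩⟩
  have : Nonempty (NullPolygonSpace S.card Sᶜ.card) :=
    ⟨Quotient.mk _ (polygonSection h1 hj c ⟨v, hv⟩)⟩
  have gX := hX.isGlobalChart_restrict
  have gH := hH.isGlobalChart_restrict
  have gM := hM.isGlobalChart
  -- All three charts have the image `c.domain`; both diffeomorphisms are the identity in these
  -- coordinates.
  obtain ⟨φ, hφ⟩ := gX.exists_diffeomorph gM (hX.range_coord.trans hM.range_coord_univ.symm)
  obtain ⟨ψ, hψ⟩ := gH.exists_diffeomorph gM (hH.range_coord.trans hM.range_coord_univ.symm)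
  refine ⟨gX.isOpenEmbedding.singletonChartedSpace, gH.isOpenEmbedding.singletonChartedSpace,
    gM.isOpenEmbedding.singletonChartedSpace, gX.isManifoldStructure, gH.isManifoldStructure,
    gM.isManifoldStructure, φ, ψ, fun ξ => ?_, fun z hz => ?_, fun z hz E hE => ?_⟩
  · obtain ⟨hu, hξ⟩ := hX.mk_section_coord ξ ξ.2
    exact ⟨_, isSplitForm_splitPoint _ _, hξ⟩
  -- Equality of classes of polygons can be tested in the global chart, where it becomes the
  -- equality of `polygonCoord` and `traceCoord`.
  · obtain ⟨u, hu, huz, hk⟩ := hz.exists_polygon h1 hj z.2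
    refine ⟨hz.mk_mem_hyperpolygonComponent, ⟨u, hu⟩, huz, gM.isOpenEmbedding.injective ?_⟩
    rw [hφ]
    exact congrArg c.ofTuple hk.symm
  · obtain ⟨hS, hSc⟩ := mem_hyperpolygonComponent_iff.1 hz
    refine ⟨(hE.hasTwoFlags h1 hj z.2 hS hSc).mem_higgsComponent hx
      (det_ne_zero_of_isStraight h1 hj z.2 hS hSc), gM.isOpenEmbedding.injective ?_⟩
    rw [hφ, hψ]
    -- The residues of the associated bundle are the matrices q_i p_i, so both coordinates are the
    -- same traces.
    exact congrArg (fun N => c.ofTuple (traceCoord S 0 j₀ N)) hE.residues_eq
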